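/- **Setting.** Let $d,L\ge 1$, $m_1\ge\dots\ge m_L\ge 0$ be integers, $n_\ell=2^{m_\ell}$, $N=\sum_\ell n_\ell$. Let $K((\ell,\boldsymbol x),(\ell',\boldsymbol x'))=R(\ell,\ell')\,Q(\boldsymbol x,\boldsymbol x')$ be a symmetric positive definite kernel on $\{1,\dots,L\}\times[0,1)^d$ (symmetric, and $\sum_{i,j}c_ic_jK(z_i,z_j)>0$ for pairwise distinct $z_i$ and $c\neq 0$), whose evaluation costs between $1$ and $\kappa d$ operations. Let $\xi_\ell\ge 0$ be noise variances, $\boldsymbol x_{\ell i}$ ($0\le i<n_\ell$) the collocation points of task $\ell$, and $\widetilde{\mathsf K}=\big(K((\ell,\boldsymbol x_{\ell i}),(\ell',\boldsymbol x_{\ell' i'}))+\delta_{\ell\ell'}\delta_{ii'}\xi_\ell\big)\in\mathbb R^{N\times N}$, with blocks $\widetilde{\mathsf K}_{\ell\ell'}\in\mathbb R^{n_\ell\times n_{\ell'}}$. Write $\mathsf i_p$ for the binary digits of $i=\sum_p\mathsf i_p2^p$ and $v(i)=\sum_p\mathsf i_p2^{-p-1}$. Assume one of the following. * (SI-LAT)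 $Q(\boldsymbol x,\boldsymbol x')=\widehat Q((\boldsymbol x-\boldsymbol x')\bmod 1)$ and $\boldsymbol x_{\ell i}=(v(i)\boldsymbol g+\boldsymbol\Delta_\ell)\bmod 1$ with $\boldsymbol g\in\mathbb N_0^d$, $\boldsymbol\Delta_\ell\in[0,1)^d$. Put $(\mathsf V_m)_{ij}=2^{-m/2}e^{2\pi\mathrm i\,j\,v(i)}$, so that $\mathsf V_m^*$ is a bit-reversal followed by a normalized discrete Fourier transform. * (DSI-DSEQ) $Q(\boldsymbol x,\boldsymbol x')=\widehat Q(\boldsymbol x\oplus\boldsymbol x')$ and $\boldsymbol x_{\ell i}=\big(\bigoplus_p \mathsf i_p\boldsymbol g_p\big)\oplus\boldsymbol\Delta_\ell$ with $\boldsymbol g_p,\boldsymbol\Delta_\ell\in[0,1)^d$, where $\oplus$ is the componentwise exclusive or of binary digits. Binary expansions do not end in an infinite tail of ones: the identity for $Q$ is required for those $\boldsymbol x,\boldsymbol x'$ whose digitwise exclusive or has no such tail in any coordinate, and none of the exclusive ors that form the points $\boldsymbol x_{\ell i}$ or the $\boldsymbol x_{\ell i}\oplus\boldsymbol x_{\ell'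 i'}$ has one. Put $(\mathsf V_m)_{ij}=2^{-m/2}(-1)^{\sum_p\mathsf i_p\mathsf j_p}$ (Walsh–Hadamard). Let $\mathsf V=\mathrm{diag}(\mathsf V_{m_1},\dots,\mathsf V_{m_L})$ and $\widetilde{\mathsf\Lambda}=\mathsf V^*\widetilde{\mathsf K}\mathsf V$. Costs are counted for straight-line programs over $\mathbb C$ (constants, copies, $+,-,\times,\div$, negation, conjugation, kernel evaluations at pairs of collocation points) that depend only on $d$, $L$, the $m_\ell$, the variant and the cost of a kernel evaluation, and never divide by zero; storage is the number of registers used. The constants in $\mathcal O$ depend only on $\kappa$. **Algorithm 1.** Start with $\mathsf A=\widetilde{\mathsf\Lambda}_{11}^{-1}$, $\varrho=|\widetilde{\mathsf\Lambda}_{11}|$. For $\ell=2,\dots,L$, with $\mathsf D=\widetilde{\mathsf\Lambda}_{\ell\ell}$ and $\mathsf B=(\widetilde{\mathsf\Lambda}_{\ell'\ell})_{\ell'<\ell}$, compute $\mathsf L=\mathsf A\mathsf B$, $\mathsf F=\mathsf B^*\mathsf L$, $\mathsf S_\ell=\mathsf D-\mathsf F$, $\varrho\leftarrow\varrho|\mathsf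 S_\ell|$, $\mathsf G=\mathsf S_\ell^{-1}$, $\mathsf H=\mathsf L\mathsf G$, $\mathsf M=\mathsf A+\mathsf H\mathsf L^*$, $\mathsf A\leftarrow\begin{pmatrix}\mathsf M&-\mathsf H\\-\mathsf H^*&\mathsf G\end{pmatrix}$. Return $\mathsf A,\varrho$. All matrices are stored, and all operations performed, only on the diagonals of their diagonal blocks (blocks of size $n_\ell\times n_\ell$ at stage $\ell$, with $\mathsf A$ still having $n_{\ell-1}\times n_{\ell-1}$ blocks at the start of the stage). **Theorem.** $\mathsf V$ is unitary, so $\widetilde{\mathsf K}=\mathsf V\widetilde{\mathsf\Lambda}\mathsf V^*$ and $|\widetilde{\mathsf K}|=|\widetilde{\mathsf\Lambda}|$; $\widetilde{\mathsf\Lambda}$ is Hermitian, and for $\ell\le\ell'$ the $(i,i')$ entry of $\widetilde{\mathsf\Lambda}_{\ell\ell'}$ vanishes unless $i\equiv i'\pmod{n_{\ell'}}$. Moreover: 1. Evaluating $\widetilde{\mathsf\Lambda}$ (the remaining entries with $\ell\le\ell'$) takes $\mathcal O\big(\sum_{\ell=1}^L(L-\ell+1)(n_\ell\log n_\ell+dn_\ell)\big)$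 operations and $\mathcal O\big(\sum_{\ell=1}^L(L-\ell+1)n_\ell\big)$ storage. 2. Given $\widetilde{\mathsf\Lambda}$, computing $\widetilde{\mathsf K}\boldsymbol y=\mathsf V\widetilde{\mathsf\Lambda}\mathsf V^*\boldsymbol y$ for any $\boldsymbol y\in\mathbb R^N$ takes $\mathcal O\big(\sum_{\ell=1}^Ln_\ell\log n_\ell+\sum_{\ell=1}^L(L-\ell+1)n_\ell\big)$ operations. Assume in addition that for each task $\xi_\ell>0$ or the points $\boldsymbol x_{\ell 0},\dots,\boldsymbol x_{\ell,n_\ell-1}$ are distinct. Then $\widetilde{\mathsf K}$ and $\widetilde{\mathsf\Lambda}$ are invertible, $\widetilde{\mathsf K}^{-1}=\mathsf V\widetilde{\mathsf\Lambda}^{-1}\mathsf V^*$, the $((\ell,i),(\ell',i'))$ entry of $\widetilde{\mathsf\Lambda}^{-1}$ vanishes unless $i\equiv i'\pmod{n_L}$, and: 3. Given $\widetilde{\mathsf\Lambda}$, Algorithm 1 computes $\widetilde{\mathsf\Lambda}^{-1}$ and $|\widetilde{\mathsf\Lambda}|=|\widetilde{\mathsf K}|$; each $\mathsf S_\ell$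 is the Schur complement of the leading $\ell-1$ block rows and columns in the leading $\ell$ ones, and is diagonal. It takes $\mathcal O\big(\sum_{\ell=2}^L(\sum_{\ell'=1}^{\ell-1}n_{\ell'})^2/n_\ell\big)$ operations if $L\ge 2$ ($\mathcal O(N)$ if $L=1$) and $\mathcal O(N^2/n_L)$ storage. 4. Given $\widetilde{\mathsf\Lambda}^{-1}$, computing $\widetilde{\mathsf K}^{-1}\boldsymbol y=\mathsf V\widetilde{\mathsf\Lambda}^{-1}\mathsf V^*\boldsymbol y$ for any $\boldsymbol y\in\mathbb R^N$ takes $\mathcal O\big(\sum_{\ell=1}^Ln_\ell\log n_\ell+N^2/n_L\big)$ operations. -/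

import Mathlib

namespace FastMTGP

/-! ## Kernels and sampling points on the unit cube -/

/-- The half-open unit cube `[0,1)^d`. -/
def cube (d : ℕ) : Set (Fin d → ℝ) := {x | ∀ j, x j ∈ Set.Ico (0 : ℝ) 1}

/-- `K` is a symmetric positive definite kernel on the set `s`: it is symmetric, and its quadratic
form is positive at every nonzero coefficient vector, for pairwise distinct points of `s`. -/
def IsSPDKernel {α : Type*} (s : Set α) (K : α → α → ℝ) : Prop :=
  (∀ x ∈ s, ∀ y ∈ s, K x y = K y x) ∧
  ∀ (n : ℕ) (x : Fin n → α) (c : Fin n → ℝ), (∀ i, x i ∈ s) → Function.Injective x → c ≠ 0 →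
    0 < ∑ i, ∑ j, c i * c j * K (x i) (x j)

/-- The multitask product kernel with task kernel `R` and spatial kernel `Q`. -/
def productKernel {L d : ℕ} (R : Fin L → Fin L → ℝ) (Q : (Fin d → ℝ) → (Fin d → ℝ) → ℝ) :
    Fin L × (Fin d → ℝ) → Fin L × (Fin d → ℝ) → ℝ :=
  fun a b => R a.1 b.1 * Q a.2 b.2

/-- The binary digit of `i` at position `p`, as a number. -/
def bit (i p : ℕ) : ℕ := if i.testBit p then 1 else 0

/-- The van der Corput sequence in base 2 (for `i = 0` the only summand vanishes). -/
noncomputable def vdc (i : ℕ) : ℝ :=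
  ∑ p ∈ Finset.range (Nat.log 2 i + 1), (bit i p : ℝ) * (1 / 2) ^ (p + 1)

/-- The `i`-th point of the shifted rank-1 lattice in radical-inverse order. -/
noncomputable def latticePoint {d : ℕ} (g : Fin d → ℕ) (Δ : Fin d → ℝ) (i : ℕ) : Fin d → ℝ :=
  fun j => Int.fract (Int.fract (vdc i * (g j : ℝ)) + Δ j)

/-- `Q` is shift-invariant on `[0,1)^d`. -/
def IsShiftInvariant {d : ℕ} (Q : (Fin d → ℝ) → (Fin d → ℝ) → ℝ) : Prop :=
  ∃ Qhat : (Fin d → ℝ) → ℝ, ∀ x ∈ cube d, ∀ y ∈ cube d,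
    Q x y = Qhat (fun j => Int.fract (x j - y j))

/-- The binary digit of weight `2^{-(p+1)}` of `a ∈ [0,1)`, in the binary expansion
that does not end in an infinite tail of ones. -/
noncomputable def digit (a : ℝ) (p : ℕ) : ℕ := ⌊(2 : ℝ) ^ (p + 1) * a⌋₊ % 2

/-- The digital-shift operator (exclusive or of the binary digits), componentwise. -/
noncomputable def dshift {d : ℕ} (a b : Fin d → ℝ) : Fin d → ℝ :=
  fun j => ∑' p : ℕ, (((digit (a j) p + digit (b j) p) % 2 : ℕ) : ℝ) * (1 / 2) ^ (p + 1)

/-- In no coordinate does the digitwise exclusive or of `a` and `b` end in an infinite tail of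
ones, so that it is the binary expansion of `dshift a b`. -/
def NoTail {d : ℕ} (a b : Fin d → ℝ) : Prop :=
  ∀ j, ∀ P : ℕ, ∃ p ≥ P, (digit (a j) p + digit (b j) p) % 2 = 0

/-- The `i`-th point of the base-2 digital sequence with generating matrices `G`
(column `p` is `G p`), in radical-inverse order. -/
noncomputable def digitalPoint {d : ℕ} (G : ℕ → Fin d → ℝ) (i : ℕ) : Fin d → ℝ :=
  (List.range (Nat.log 2 i + 1)).foldl (fun z p => if i.testBit p then dshift z (G p) else z) 0

/-- `Q` is digitally-shift-invariant on `[0,1)^d`. -/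
def IsDigitallyShiftInvariant {d : ℕ} (Q : (Fin d → ℝ) → (Fin d → ℝ) → ℝ) : Prop :=
  ∃ Qhat : (Fin d → ℝ) → ℝ, ∀ x ∈ cube d, ∀ y ∈ cube d, NoTail x y → Q x y = Qhat (dshift x y)

/-! ## Fast multitask Gaussian processes -/

/-- Row and column indices of the block matrices: the pair of a task `ℓ` and a position
`i < n_ℓ = 2^(m ℓ)` within the task. -/
abbrev Idx {L : ℕ} (m : Fin L → ℕ) : Type := Σ ℓ : Fin L, Fin (2 ^ m ℓ)

/-- The two kinds of fast MTGPs. -/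
inductive Variant : Type
  | siLat : Variant
  | dsiDseq : Variant

/-- The data of a multitask problem with a product kernel: task kernel, spatial kernel,
collocation points and noise variances. -/
structure Problem (d : ℕ) {L : ℕ} (m : Fin L → ℕ) : Type where
  R : Fin L → Fin L → ℝ
  Q : (Fin d → ℝ) → (Fin d → ℝ) → ℝ
  x : Idx m → Fin d → ℝ
  ξ : Fin L → ℝ

variable {d L : ℕ} {m : Fin L → ℕ}

/-- Shifted lattices with a common generating vector and a shift-invariant spatial kernel. -/
def Problem.IsSILat (P : Problem d m) : Prop :=
  IsShiftInvariant P.Q ∧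
  ∃ (g : Fin d → ℕ) (Δ : Fin L → Fin d → ℝ), (∀ ℓ, Δ ℓ ∈ cube d) ∧
    ∀ p : Idx m, P.x p = latticePoint g (Δ p.1) p.2

/-- Digitally-shifted digital sequences with common generating matrices and a
digitally-shift-invariant spatial kernel. None of the digitwise exclusive ors that occur ends in
an infinite tail of ones. -/
def Problem.IsDSIDseq (P : Problem d m) : Prop :=
  IsDigitallyShiftInvariant P.Q ∧
  ∃ (G : ℕ → Fin d → ℝ) (Δ : Fin L → Fin d → ℝ), (∀ p, G p ∈ cube d) ∧ (∀ ℓ, Δ ℓ ∈ cube d) ∧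
    (∀ p : Idx m, P.x p = dshift (digitalPoint G p.2) (Δ p.1)) ∧
    (∀ ℓ, ∀ q < m ℓ, ∀ i < 2 ^ q, NoTail (digitalPoint G i) (G q)) ∧
    (∀ p : Idx m, NoTail (digitalPoint G p.2) (Δ p.1)) ∧
    (∀ p q : Idx m, NoTail (P.x p) (P.x q))

/-- The fast MTGP condition (the ordering of the sample sizes is stated on `m`). -/
structure Problem.IsFast (P : Problem d m) (v : Variant) : Prop where
  spd : IsSPDKernel (Set.univ ×ˢ cube d) (productKernel P.R P.Q)
  noise_nonneg : ∀ ℓ, 0 ≤ P.ξ ℓ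
  design : match v with
    | .siLat => P.IsSILat
    | .dsiDseq => P.IsDSIDseq

/-- For every task the observations are noisy or the collocation points are pairwise distinct. -/
def Problem.Nondegenerate (P : Problem d m) : Prop :=
  ∀ ℓ, 0 < P.ξ ℓ ∨ Function.Injective (fun i : Fin (2 ^ m ℓ) => P.x ⟨ℓ, i⟩)

/-- The kernel evaluated at a pair of collocation points. -/
def Problem.kernelAt (P : Problem d m) (p q : Idx m) : ℝ :=
  productKernel P.R P.Q (p.1, P.x p) (q.1, P.x q)

/-- The noisy Gram matrix. -/
def Problem.gram (P : Problem d m) : Matrix (Idx m) (Idx m) ℝ :=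
  Matrix.of fun p q => P.kernelAt p q + if p = q then P.ξ p.1 else 0

/-- The noisy Gram matrix as a complex matrix. -/
def Problem.gramC (P : Problem d m) : Matrix (Idx m) (Idx m) ℂ := P.gram.map (fun t => (t : ℂ))

/-- The unitary transform of size `2^k`. For lattices its conjugate transpose is a bit-reversal
permutation followed by the discrete Fourier transform (recall `vdc i = rev i / 2^k` for
`i < 2^k`); for digital sequences it is the Walsh-Hadamard transform. Both are normalized. -/
noncomputable def transform (v : Variant) (k : ℕ) : Matrix (Fin (2 ^ k)) (Fin (2 ^ k)) ℂ :=
  Matrix.of fun i j =>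
    (match v with
      | .siLat => Complex.exp (2 * (Real.pi : ℂ) * Complex.I * ((j : ℕ) : ℂ) * ((vdc i : ℝ) : ℂ))
      | .dsiDseq => (-1 : ℂ) ^ (∑ p ∈ Finset.range k, bit i p * bit j p))
    / ((Real.sqrt ((2 : ℝ) ^ k) : ℝ) : ℂ)

/-- The block diagonal matrix `V = diag(V_{m_1}, …, V_{m_L})`. -/
noncomputable def transformBlocks (v : Variant) (m : Fin L → ℕ) : Matrix (Idx m) (Idx m) ℂ :=
  Matrix.blockDiagonal' fun ℓ => transform v (m ℓ)

/-- The transformed Gram matrix, i.e. the matrix `Λ` with `K = V Λ Vᴴ`. -/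
noncomputable def Problem.lam (P : Problem d m) (v : Variant) : Matrix (Idx m) (Idx m) ℂ :=
  (transformBlocks v m).conjTranspose * P.gramC * transformBlocks v m

/-- The Schur complement of the leading blocks (tasks before `ℓ`) in the leading blocks up to and
including task `ℓ`. -/
noncomputable def schur (A : Matrix (Idx m) (Idx m) ℂ) (ℓ : Fin L) :
    Matrix (Fin (2 ^ m ℓ)) (Fin (2 ^ m ℓ)) ℂ :=
  let before : {p : Idx m // p.1 < ℓ} → Idx m := Subtype.val
  let here : Fin (2 ^ m ℓ) → Idx m := fun i => ⟨ℓ, i⟩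
  A.submatrix here here - A.submatrix here before * (A.submatrix before before)⁻¹ *
    A.submatrix before here

/-! ## Arithmetic programs

Straight-line programs over the complex numbers. A program is fixed before the numerical data
(kernel values, noise variances, vectors) are known, and may depend on the sizes only. -/

/-- The registers. `lam` holds the transformed Gram matrix, `noise` the noise variances,
`vec` and `out` an input and an output vector; the others are working registers. -/
inductive Reg (m : Fin L → ℕ) : Type
  | lam (p q : Idx m)
  | noise (ℓ : Fin L)
  | vec (p : Idx m)
  | out (p : Idx m)
  | det
  | matA (p q : Idx m)
  | matD (p : Idx m)
  | matB (p : Idx m)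
  | matL (p : Idx m)
  | matF (p : Idx m)
  | matS (p : Idx m)
  | matG (p : Idx m)
  | matH (p : Idx m)
  | matJ (p q : Idx m)
  | matM (p q : Idx m)
  | tmp (k : ℕ)

/-- The instructions; the first argument is the destination. `kern r p q` evaluates the kernel at
the collocation points with indices `p` and `q`. -/
inductive Instr (m : Fin L → ℕ) : Type
  | const (r : Reg m) (c : ℂ)
  | copy (r a : Reg m)
  | neg (r a : Reg m)
  | conj (r a : Reg m)
  | add (r a b : Reg m)
  | sub (r a b : Reg m)
  | mul (r a b : Reg m)
  | div (r a b : Reg m)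
  | kern (r : Reg m) (p q : Idx m)

abbrev Program (m : Fin L → ℕ) : Type := List (Instr m)

/-- The destination of an instruction. -/
def Instr.dest : Instr m → Reg m
  | .const r _ | .copy r _ | .neg r _ | .conj r _ | .add r _ _ | .sub r _ _ | .mul r _ _
  | .div r _ _ | .kern r _ _ => r

/-- The registers that an instruction reads or writes. -/
def Instr.regs : Instr m → List (Reg m)
  | .const r _ => [r]
  | .copy r a | .neg r a | .conj r a => [r, a]
  | .add r a b | .sub r a b | .mul r a b | .div r a b => [r, a, b]
  | .kern r _ _ => [r]

/-- The value that an instruction computes in memory `σ`, with kernel values `k`. -/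
noncomputable def Instr.value (k : Idx m → Idx m → ℂ) (σ : Reg m → ℂ) : Instr m → ℂ
  | .const _ c => c
  | .copy _ a => σ a
  | .neg _ a => -σ a
  | .conj _ a => star (σ a)
  | .add _ a b => σ a + σ b
  | .sub _ a b => σ a - σ b
  | .mul _ a b => σ a * σ b
  | .div _ a b => σ a / σ b
  | .kern _ p q => k p q

/-- An instruction can be executed unless it divides by zero. -/
def Instr.Defined (σ : Reg m → ℂ) : Instr m → Prop
  | .div _ _ b => σ b ≠ 0
  | _ => True

open Classical in
/-- `Runs k prog σ τ`: started in memory `σ`, the program runs to its end without a division by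
zero and leaves memory `τ`. -/
noncomputable def Runs (k : Idx m → Idx m → ℂ) : Program m → (Reg m → ℂ) → (Reg m → ℂ) → Prop
  | [], σ, τ => τ = σ
  | i :: prog, σ, τ => i.Defined σ ∧ Runs k prog (Function.update σ i.dest (i.value k σ)) τ

/-- A kernel evaluation costs `kc`; every other instruction costs one operation. -/
def Instr.cost (kc : ℕ) : Instr m → ℕ
  | .kern _ _ _ => kc
  | _ => 1

/-- The number of operations of a program. -/
def cost (kc : ℕ) (prog : Program m) : ℕ := (prog.map (Instr.cost kc)).sum

/-- The number of registers that a program reads or writes. -/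
noncomputable def storage (prog : Program m) : ℕ := {r : Reg m | ∃ i ∈ prog, r ∈ i.regs}.ncard

/-! ## Storage patterns -/

/-- The index in task `ℓ` whose position is that of `p` modulo `n_ℓ`. -/
def proj (ℓ : Fin L) (p : Idx m) : Idx m :=
  ⟨ℓ, ⟨(p.2 : ℕ) % 2 ^ m ℓ, Nat.mod_lt _ (Nat.two_pow_pos _)⟩⟩

/-- The entries by which the transformed Gram matrix is represented: those in blocks
`(ℓ, ℓ')` with `ℓ ≤ ℓ'` which lie on the diagonals of the `n_ℓ' × n_ℓ'` subblocks. -/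
def Stored (p q : Idx m) : Prop := p.1 ≤ q.1 ∧ proj q.1 p = q

/-- The diagonals of the `n_ℓ × n_ℓ` subblocks. -/
def OnDiag (ℓ : Fin L) (p q : Idx m) : Prop := (p.2 : ℕ) % 2 ^ m ℓ = (q.2 : ℕ) % 2 ^ m ℓ

instance (ℓ : Fin L) (p q : Idx m) : Decidable (OnDiag ℓ p q) := by
  unfold OnDiag; infer_instance

/-! ## The recursive inversion algorithm

Every matrix operation is carried out entry by entry on the diagonals of the blocks. A diagonal
block of task `ℓ` is indexed by its diagonal; a block column of task `ℓ` (one nonzero entry in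
each row) by its rows. -/

/-- The indices of task `ℓ`. -/
def rows (m : Fin L → ℕ) (ℓ : Fin L) : List (Idx m) :=
  (List.finRange (2 ^ m ℓ)).map fun i => ⟨ℓ, i⟩

/-- The indices of the tasks before `ℓ`. -/
def before (m : Fin L → ℕ) (ℓ : Fin L) : List (Idx m) :=
  ((List.finRange L).filter (fun ℓ' => ℓ' < ℓ)).flatMap (rows m)

/-- The pairs of indices of tasks before `ℓ` on the diagonals of the `n_e × n_e` subblocks. -/
def pairs (m : Fin L → ℕ) (ℓ e : Fin L) : List (Idx m × Idx m) :=
  (before m ℓ).flatMap fun p =>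
    ((before m ℓ).filter (fun q => OnDiag e p q)).map fun q => (p, q)

/-- The task that precedes `ℓ` (the first task precedes itself). -/
def prev (ℓ : Fin L) : Fin L := ⟨(ℓ : ℕ) - 1, lt_of_le_of_lt (Nat.sub_le _ _) ℓ.isLt⟩

/-- Before the loop: `D ← Λ₁₁`, `A ← D⁻¹`, `ϱ ← |D|`. -/
noncomputable def firstStage (m : Fin L → ℕ) (ℓ : Fin L) : Program m :=
  ((rows m ℓ).map fun r => .copy (.matD r) (.lam r r)) ++
  [.const (.tmp 0) 1] ++
  ((rows m ℓ).map fun r => .div (.matA r r) (.tmp 0) (.matD r)) ++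
  [.const .det 1] ++
  ((rows m ℓ).map fun r => .mul .det .det (.matD r))

/-- The body of the loop, for the tasks after the first. -/
noncomputable def stage (m : Fin L → ℕ) (ℓ : Fin L) : Program m :=
  -- `D ← Λ_{ℓ,ℓ}`
  ((rows m ℓ).map fun r => .copy (.matD r) (.lam r r)) ++
  -- `B ← Λ_{:(ℓ-1),ℓ}`
  ((before m ℓ).map fun p => .copy (.matB p) (.lam p (proj ℓ p))) ++
  -- `L ← A B`
  ((before m ℓ).map fun p => .const (.matL p) 0) ++
  ((pairs m ℓ (prev ℓ)).flatMap fun pq =>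
    [.mul (.tmp 0) (.matA pq.1 pq.2) (.matB pq.2), .add (.matL pq.1) (.matL pq.1) (.tmp 0)]) ++
  -- `F ← Bᴴ L`
  ((rows m ℓ).map fun r => .const (.matF r) 0) ++
  ((before m ℓ).flatMap fun p =>
    [.conj (.tmp 0) (.matB p), .mul (.tmp 0) (.tmp 0) (.matL p),
      .add (.matF (proj ℓ p)) (.matF (proj ℓ p)) (.tmp 0)]) ++
  -- `S ← D - F`
  ((rows m ℓ).map fun r => .sub (.matS r) (.matD r) (.matF r)) ++
  -- `ϱ ← ϱ |S|`
  ((rows m ℓ).map fun r => .mul .det .det (.matS r)) ++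
  -- `G ← S⁻¹`
  [.const (.tmp 0) 1] ++
  ((rows m ℓ).map fun r => .div (.matG r) (.tmp 0) (.matS r)) ++
  -- `H ← L G`
  ((before m ℓ).map fun p => .mul (.matH p) (.matL p) (.matG (proj ℓ p))) ++
  -- `J ← H Lᴴ`
  ((pairs m ℓ ℓ).flatMap fun pq =>
    [.conj (.tmp 0) (.matL pq.2), .mul (.matJ pq.1 pq.2) (.matH pq.1) (.tmp 0)]) ++
  -- `M ← A + J`; off the diagonals of its own subblocks the old `A` is zero
  ((pairs m ℓ ℓ).map fun pq =>
    if OnDiag (prev ℓ) pq.1 pq.2 then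
      .add (.matM pq.1 pq.2) (.matA pq.1 pq.2) (.matJ pq.1 pq.2)
    else .copy (.matM pq.1 pq.2) (.matJ pq.1 pq.2)) ++
  -- `A ← (M, -H; -Hᴴ, G)`
  ((pairs m ℓ ℓ).map fun pq => .copy (.matA pq.1 pq.2) (.matM pq.1 pq.2)) ++
  ((before m ℓ).flatMap fun p =>
    [.neg (.matA p (proj ℓ p)) (.matH p), .conj (.tmp 0) (.matH p),
      .neg (.matA (proj ℓ p) p) (.tmp 0)]) ++
  ((rows m ℓ).map fun r => .copy (.matA r r) (.matG r))

/-- The algorithm for the inverse and the determinant of the transformed Gram matrix. It reads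
`lam`, and leaves the inverse in `matA` and the determinant in `det`. -/
noncomputable def invDet (m : Fin L → ℕ) : Program m :=
  (List.finRange L).flatMap fun ℓ : Fin L => if (ℓ : ℕ) = 0 then firstStage m ℓ else stage m ℓ

/-! ## Sizes -/

/-- The sample size `n_ℓ = 2^(m ℓ)` as a real number. -/
def size (m : Fin L → ℕ) (ℓ : Fin L) : ℝ := 2 ^ m ℓ

/-- The total sample size `N`. -/
def total (m : Fin L → ℕ) : ℝ := ∑ ℓ, size m ℓ

/-- The last task. -/
def lastTask (hL : 0 < L) : Fin L := ⟨L - 1, Nat.sub_lt hL Nat.one_pos⟩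

/-- `∑_{ℓ=1}^L (L-ℓ+1) n_ℓ`; the tasks are numbered from `0` here. -/
def tri (m : Fin L → ℕ) : ℝ := ∑ ℓ : Fin L, ((L : ℝ) - (ℓ : ℕ)) * size m ℓ

/-- `∑_{ℓ=1}^L (L-ℓ+1) (n_ℓ log n_ℓ + d n_ℓ)`. -/
noncomputable def triLog (d : ℕ) (m : Fin L → ℕ) : ℝ :=
  ∑ ℓ : Fin L, ((L : ℝ) - (ℓ : ℕ)) * (size m ℓ * Real.log (size m ℓ) + (d : ℝ) * size m ℓ)

/-- `∑_{ℓ=1}^L n_ℓ log n_ℓ`. -/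
noncomputable def sumLog (m : Fin L → ℕ) : ℝ := ∑ ℓ, size m ℓ * Real.log (size m ℓ)

/-- `∑_{ℓ=2}^L (∑_{ℓ'<ℓ} n_ℓ')² / n_ℓ`. -/
noncomputable def schurSum (m : Fin L → ℕ) : ℝ :=
  ∑ ℓ ∈ Finset.univ.filter (fun ℓ : Fin L => 0 < (ℓ : ℕ)),
    (∑ ℓ' ∈ Finset.Iio ℓ, size m ℓ') ^ 2 / size m ℓ

end FastMTGP

open FastMTGP

/-! ### The transforms: block recursion, orthogonality, nesting. -/

namespace FastMTGP
open Finset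

/-! For a fixed column j, the unnormalized entry `rawTransform v k i j` is a character of i, in the
group ℤ/2^k for lattices (i enters through v(i) modulo 1) or (ℤ/2)^k for digital sequences
(exclusive or). All tasks use initial segments of one point sequence, up to a shift. A Gram block
(ℓ, ℓ') with n_ℓ' ≤ n_ℓ therefore depends on i and i' only through their difference s in the larger
group (`Problem.IsFast.kernelAt_eq`); so does the noise, which sits at s = 0
(`Problem.IsFast.gram_eq`).

Substituting i = s + i' in Λ = V*KV splits the double sum of an entry (j, j') into two factors. One
is the transform of the first column of the Gram block. The other is the inner product, over i' <
n_ℓ', of column j of the large transform and column j' of the small one. The groups are nested: on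
its first n_ℓ' rows, column j of the large transform is column j mod n_ℓ' of the small one
(`rawTransform_of_lt`). Orthogonality then leaves only j ≡ j' mod n_ℓ'. This is
`Problem.IsFast.lam_eq`. It gives the sparsity, and it reduces the evaluation of a block to one fast
transform of one column.

Both transforms satisfy the same block recursion V_{k+1} = (V_k, V_k; V_k T, −V_k T) with a diagonal
T of unit twiddle factors. It yields unitarity and the in-place butterflies; since v(i) already
contains the bit reversal, no reordering is needed.

Nondegeneracy makes the Gram matrix positive definite (`Problem.IsFast.gram_posDef`), hence Λ and
all its leading principal blocks. The inversion proceeds by block elimination. Suppose that the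
inverse A of the blocks before ℓ is supported on p ≡ q mod n_{ℓ-1}. Since n_ℓ divides n_{ℓ-1}, this
implies p ≡ q mod n_ℓ, so each row of AB has at most one nonzero entry, the Schur complement is
diagonal, and the new inverse is supported on p ≡ q mod n_ℓ (`IsBlockSparse.leadInv_succ_sparse`).
The product of the entries of the Schur complement is a quotient of nonzero determinants, so no
division fails. The algorithm performs exactly these formulas on the stored entries; `InvState` is
the loop invariant.

The operation counts rest on one estimate: among B indices of tasks whose sizes are multiples of n,
at most B²/n pairs are congruent modulo n (`card_pairs_mul_le`). -/

theorem bit_add_two_pow_of_lt {i k p : ℕ} (hp : p < k) : bit (i + 2 ^ k) p = bit i p := by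
  unfold bit
  rw [add_comm, Nat.testBit_two_pow_add_gt hp]

theorem bit_eq_zero {i k : ℕ} (h : i < 2 ^ k) : bit i k = 0 := by
  simp [bit, Nat.testBit_lt_two_pow h]

theorem bit_add_two_pow_self {i k : ℕ} (h : i < 2 ^ k) : bit (i + 2 ^ k) k = 1 := by
  simp [bit, add_comm i, Nat.testBit_two_pow_add_eq, Nat.testBit_lt_two_pow h]

/-- The digits of i from position k on vanish, so every cutoff k with i < 2^k gives the same sum.
This removes the logarithm of the definition. -/
theorem vdc_eq_sum {i k : ℕ} (h : i < 2 ^ k) :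
    vdc i = ∑ p ∈ range k, (bit i p : ℝ) * (1 / 2) ^ (p + 1) := by
  have key : ∀ a b : ℕ, a ≤ b → i < 2 ^ a →
      ∑ p ∈ range a, (bit i p : ℝ) * (1 / 2) ^ (p + 1) =
        ∑ p ∈ range b, (bit i p : ℝ) * (1 / 2) ^ (p + 1) := by
    intro a b hab ha
    refine sum_subset (range_mono hab) fun p _ hp => ?_
    have hp' : a ≤ p := by simpa using hp
    rw [bit_eq_zero (lt_of_lt_of_le ha (Nat.pow_le_pow_right two_pos hp'))]
    simp
  have hlog : i < 2 ^ (Nat.log 2 i + 1) := Nat.lt_pow_succ_log_self one_lt_two i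
  rcases le_total (Nat.log 2 i + 1) k with hk | hk
  · exact key _ _ hk hlog
  · exact (key _ _ hk h).symm

theorem vdc_add_two_pow {i k : ℕ} (h : i < 2 ^ k) :
    vdc (i + 2 ^ k) = vdc i + (1 / 2) ^ (k + 1) := by
  have h2 : i + 2 ^ k < 2 ^ (k + 1) := by rw [pow_succ]; omega
  rw [vdc_eq_sum h2, vdc_eq_sum h, sum_range_succ, bit_add_two_pow_self h]
  congr 1
  · exact sum_congr rfl fun p hp => by rw [bit_add_two_pow_of_lt (mem_range.1 hp)]
  · simp

theorem vdc_zero : vdc 0 = 0 := by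
  rw [vdc_eq_sum (k := 0) (by simp)]; simp

/-- Integrality of 2^k v(i) makes a shift of the column index by 2^k invisible in the rows below
2^k. -/
theorem exists_vdc_eq_div : ∀ (k : ℕ) {i : ℕ}, i < 2 ^ k → ∃ a < 2 ^ k, vdc i = (a : ℕ) / 2 ^ k
  | 0, i, h => ⟨0, by simp, by
      have : i = 0 := by simpa using h
      simp [this, vdc_zero]⟩
  | k + 1, i, h => by
    rcases lt_or_ge i (2 ^ k) with hi | hi
    · obtain ⟨a, ha, e⟩ := exists_vdc_eq_div k hi
      refine ⟨2 * a, by rw [pow_succ]; omega, ?_⟩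
      rw [e]; push_cast; field_simp; ring
    · obtain ⟨j, rfl⟩ := Nat.exists_eq_add_of_le' hi
      have hj : j < 2 ^ k := by rw [pow_succ] at h; omega
      obtain ⟨a, ha, e⟩ := exists_vdc_eq_div k hj
      refine ⟨2 * a + 1, by rw [pow_succ]; omega, ?_⟩
      rw [vdc_add_two_pow hj, e]; push_cast
      rw [one_div, inv_pow]; field_simp; ring

/-- The transform of size `2^k` without normalization, with natural numbers as indices. -/
noncomputable def rawTransform (v : Variant) (k i j : ℕ) : ℂ :=
  match v with
  | .siLat => Complex.exp (2 * (Real.pi : ℂ) * Complex.I * (j : ℂ) * ((vdc i : ℝ) : ℂ))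
  | .dsiDseq => (-1 : ℂ) ^ (∑ p ∈ Finset.range k, bit i p * bit j p)

/-- The twiddle factors of the butterflies that combine two transforms of size `2^k`. -/
noncomputable def twiddle (v : Variant) (k j : ℕ) : ℂ :=
  match v with
  | .siLat => Complex.exp (2 * (Real.pi : ℂ) * Complex.I * (j : ℂ) * (((1 / 2) ^ (k + 1) : ℝ) : ℂ))
  | .dsiDseq => 1

theorem transform_apply (v : Variant) (k : ℕ) (i j : Fin (2 ^ k)) :
    transform v k i j = rawTransform v k i j / ((Real.sqrt ((2 : ℝ) ^ k) : ℝ) : ℂ) := by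
  cases v <;> rfl

theorem star_exp_mul_exp (x : ℝ) :
    Complex.exp (2 * (Real.pi : ℂ) * Complex.I * x) *
      star (Complex.exp (2 * (Real.pi : ℂ) * Complex.I * x)) = 1 := by
  have h2 : (starRingEnd ℂ) 2 = 2 := map_ofNat _ 2
  rw [Complex.star_def, ← Complex.exp_conj, ← Complex.exp_add]
  simp [h2]

theorem twiddle_mul_star (v : Variant) (k j : ℕ) : twiddle v k j * star (twiddle v k j) = 1 := by
  cases v
  · have := star_exp_mul_exp ((j : ℝ) * (1 / 2) ^ (k + 1))
    simpa [twiddle, mul_assoc] using this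
  · simp [twiddle]

theorem rawTransform_mul_star (v : Variant) (k i j : ℕ) :
    rawTransform v k i j * star (rawTransform v k i j) = 1 := by
  cases v
  · have := star_exp_mul_exp ((j : ℝ) * vdc i)
    simpa [rawTransform, mul_assoc] using this
  · simp only [rawTransform, star_pow, star_neg, star_one]
    rw [← mul_pow]; simp

theorem rawTransform_zero_left (v : Variant) (k j : ℕ) : rawTransform v k 0 j = 1 := by
  cases v <;> simp [rawTransform, vdc_zero, bit]

theorem exp_two_pi_int (z : ℤ) : Complex.exp (2 * (Real.pi : ℂ) * Complex.I * z) = 1 := by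
  rw [mul_comm]; exact Complex.exp_int_mul_two_pi_mul_I z

section Recursion

variable {v : Variant} {k i j : ℕ}

/-- This lemma and the next three are the blocks of V_{k+1} = (V_k, V_k; V_k T, −V_k T), with T the
diagonal of the twiddle factors. Orthogonality, nesting and the butterflies are derived from them,
uniformly in the variant. -/
theorem rawTransform_succ_lo_lo (hi : i < 2 ^ k) :
    rawTransform v (k + 1) i j = rawTransform v k i j := by
  cases v
  · rfl
  · simp [rawTransform, sum_range_succ, bit_eq_zero hi]

theorem rawTransform_succ_hi_lo (hi : i < 2 ^ k) (hj : j < 2 ^ k) :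
    rawTransform v (k + 1) (i + 2 ^ k) j = rawTransform v k i j * twiddle v k j := by
  cases v
  · simp only [rawTransform, twiddle, vdc_add_two_pow hi]
    rw [← Complex.exp_add]; push_cast; ring_nf
  · simp only [rawTransform, twiddle, sum_range_succ, bit_eq_zero hj, mul_zero, add_zero, mul_one]
    congr 1
    exact sum_congr rfl fun p hp => by rw [bit_add_two_pow_of_lt (mem_range.1 hp)]

theorem rawTransform_succ_lo_hi (hi : i < 2 ^ k) :
    rawTransform v (k + 1) i (j + 2 ^ k) = rawTransform v k i j := by
  cases v
  · obtain ⟨a, -, e⟩ := exists_vdc_eq_div k hi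
    have h1 := exp_two_pi_int a
    simp only [rawTransform]
    -- Multiply by e^{2πia} = 1 with a = 2^k v(i), which absorbs the shift of j by 2^k.
    rw [← mul_one (Complex.exp (2 * _ * _ * (j : ℂ) * _)), ← h1, ← Complex.exp_add, e]
    congr 1; push_cast; field_simp
  · simp only [rawTransform, sum_range_succ, bit_eq_zero hi, zero_mul, add_zero]
    congr 1
    exact sum_congr rfl fun p hp => by rw [bit_add_two_pow_of_lt (mem_range.1 hp)]

theorem rawTransform_succ_hi_hi (hi : i < 2 ^ k) (hj : j < 2 ^ k) :
    rawTransform v (k + 1) (i + 2 ^ k) (j + 2 ^ k) = -(rawTransform v k i j * twiddle v k j) := by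
  cases v
  · obtain ⟨a, -, e⟩ := exists_vdc_eq_div k hi
    have h1 := exp_two_pi_int a
    simp only [rawTransform, twiddle]
    -- The sign is e^{πi}: the shift of the column by 2^k meets the new digit 2^{-(k+1)} of v, which
    -- gives half a turn.
    rw [vdc_add_two_pow hi, neg_eq_neg_one_mul, ← Complex.exp_pi_mul_I, ← Complex.exp_add,
      ← Complex.exp_add, ← mul_one (Complex.exp (_ + _)), ← h1, ← Complex.exp_add, e]
    congr 1; push_cast; rw [one_div, inv_pow]; field_simp; ring
  · simp only [rawTransform, twiddle, sum_range_succ, bit_add_two_pow_self hi,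
      bit_add_two_pow_self hj, mul_one, pow_succ]
    rw [mul_neg_one]
    congr 2
    exact sum_congr rfl fun p hp => by
      rw [bit_add_two_pow_of_lt (mem_range.1 hp), bit_add_two_pow_of_lt (mem_range.1 hp)]

end Recursion

theorem sum_range_two_pow_succ {M : Type*} [AddCommMonoid M] (f : ℕ → M) (k : ℕ) :
    ∑ i ∈ range (2 ^ (k + 1)), f i = ∑ i ∈ range (2 ^ k), (f i + f (i + 2 ^ k)) := by
  rw [pow_succ, mul_two, sum_range_add, sum_add_distrib]
  simp [add_comm]

/-- By the block recursion, two rows of the same half contribute equally from both halves of the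
columns, because the twiddle factors have modulus 1; rows of different halves cancel column by
column. -/
theorem sum_rawTransform_mul_star (v : Variant) : ∀ (k : ℕ) {i i' : ℕ}, i < 2 ^ k → i' < 2 ^ k →
    ∑ j ∈ range (2 ^ k), rawTransform v k i j * star (rawTransform v k i' j) =
      if i = i' then 2 ^ k else 0
  | 0, i, i', hi, hi' => by
    have h1 : i = 0 := by simpa using hi
    have h2 : i' = 0 := by simpa using hi'
    simp [h1, h2, rawTransform_zero_left]
  | k + 1, i, i', hi, hi' => by
    have tt := fun j => twiddle_mul_star v k j
    have ih := fun {i i' : ℕ} (hi : i < 2 ^ k) (hi' : i' < 2 ^ k) =>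
      sum_rawTransform_mul_star v k hi hi'
    rw [sum_range_two_pow_succ]
    rcases lt_or_ge i (2 ^ k) with h | h <;> rcases lt_or_ge i' (2 ^ k) with h' | h'
    · rw [sum_congr rfl (g := fun j => 2 * (rawTransform v k i j * star (rawTransform v k i' j))),
        ← mul_sum, ih h h']
      · split_ifs <;> ring
      · intro j hj
        rw [rawTransform_succ_lo_lo h, rawTransform_succ_lo_lo h', rawTransform_succ_lo_hi h,
          rawTransform_succ_lo_hi h']
        ring
    · obtain ⟨i', rfl⟩ := Nat.exists_eq_add_of_le' h'
      have h'' : i' < 2 ^ k := by rw [pow_succ] at hi'; omega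
      rw [if_neg (by omega)]
      refine sum_eq_zero fun j hj => ?_
      have hj := mem_range.1 hj
      rw [rawTransform_succ_lo_lo h, rawTransform_succ_hi_lo h'' hj, rawTransform_succ_lo_hi h,
          rawTransform_succ_hi_hi h'' hj, star_neg]
      ring
    · obtain ⟨i, rfl⟩ := Nat.exists_eq_add_of_le' h
      have h'' : i < 2 ^ k := by rw [pow_succ] at hi; omega
      rw [if_neg (by omega)]
      refine sum_eq_zero fun j hj => ?_
      have hj := mem_range.1 hj
      rw [rawTransform_succ_lo_lo h', rawTransform_succ_hi_lo h'' hj, rawTransform_succ_lo_hi h',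
          rawTransform_succ_hi_hi h'' hj]
      ring
    · obtain ⟨i, rfl⟩ := Nat.exists_eq_add_of_le' h
      obtain ⟨i', rfl⟩ := Nat.exists_eq_add_of_le' h'
      have g : i < 2 ^ k := by rw [pow_succ] at hi; omega
      have g' : i' < 2 ^ k := by rw [pow_succ] at hi'; omega
      rw [sum_congr rfl (g := fun j => 2 * (rawTransform v k i j * star (rawTransform v k i' j))),
        ← mul_sum, ih g g']
      · simp only [Nat.add_right_cancel_iff]; split_ifs <;> ring
      · intro j hj
        have hj := mem_range.1 hj
        rw [rawTransform_succ_hi_lo g hj, rawTransform_succ_hi_lo g' hj,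
          rawTransform_succ_hi_hi g hj, rawTransform_succ_hi_hi g' hj, star_neg, star_mul]
        linear_combination (2 * (rawTransform v k i j * star (rawTransform v k i' j))) * tt j

/-- Distinct rows are orthogonal and no row is zero. Equalities of group elements are reduced to
equalities of rows in this way. -/
theorem rawTransform_injective {v : Variant} {k i i' : ℕ} (hi : i < 2 ^ k) (hi' : i' < 2 ^ k)
    (h : ∀ j < 2 ^ k, rawTransform v k i j = rawTransform v k i' j) : i = i' := by
  by_contra hne
  have h1 := sum_rawTransform_mul_star v k hi hi'
  have h2 := sum_rawTransform_mul_star v k hi hi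
  rw [if_neg hne] at h1
  rw [if_pos rfl, sum_congr rfl (g := fun j => rawTransform v k i j * star (rawTransform v k i' j)),
    h1] at h2
  · exact (pow_ne_zero k two_ne_zero) h2.symm
  · intro j hj; rw [h j (mem_range.1 hj)]

/-- Nesting of the groups, one doubling at a time: in the upper half of the rows both column blocks
of the recursion are V_k, without twiddle factors. -/
theorem rawTransform_add_of_lt (v : Variant) {k : ℕ} (s : ℕ) {i : ℕ} (hi : i < 2 ^ k) :
    ∀ {j : ℕ}, j < 2 ^ (k + s) → rawTransform v (k + s) i j = rawTransform v k i (j % 2 ^ k) := by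
  induction s with
  | zero => intro j hj; rw [add_zero, Nat.mod_eq_of_lt (by simpa using hj)]
  | succ s ih =>
    intro j hj
    have hi' : i < 2 ^ (k + s) := lt_of_lt_of_le hi (Nat.pow_le_pow_right two_pos (by omega))
    rw [← add_assoc] at hj ⊢
    rcases lt_or_ge j (2 ^ (k + s)) with h | h
    · rw [rawTransform_succ_lo_lo hi', ih h]
    · obtain ⟨j, rfl⟩ := Nat.exists_eq_add_of_le' h
      have g : j < 2 ^ (k + s) := by rw [pow_succ] at hj; omega
      rw [rawTransform_succ_lo_hi hi', ih g]
      congr 1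
      rw [pow_add, Nat.add_mul_mod_self_left]

theorem rawTransform_of_lt (v : Variant) {k K i j : ℕ} (hk : k ≤ K) (hi : i < 2 ^ k)
    (hj : j < 2 ^ K) : rawTransform v K i j = rawTransform v k i (j % 2 ^ k) := by
  obtain ⟨s, rfl⟩ := Nat.exists_eq_add_of_le hk
  exact rawTransform_add_of_lt v s hi hj

theorem sqrt_two_pow_mul_self (k : ℕ) :
    ((Real.sqrt ((2 : ℝ) ^ k) : ℝ) : ℂ) * ((Real.sqrt ((2 : ℝ) ^ k) : ℝ) : ℂ) = 2 ^ k := by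
  rw [← Complex.ofReal_mul, Real.mul_self_sqrt (by positivity)]; push_cast; rfl

theorem sqrt_two_pow_ne_zero (k : ℕ) : ((Real.sqrt ((2 : ℝ) ^ k) : ℝ) : ℂ) ≠ 0 := by
  intro h
  have := sqrt_two_pow_mul_self k
  rw [h, zero_mul] at this
  exact pow_ne_zero k two_ne_zero this.symm

theorem transform_mul_conjTranspose (v : Variant) (k : ℕ) :
    transform v k * (transform v k).conjTranspose = 1 := by
  ext i i'
  rw [Matrix.mul_apply]
  simp only [Matrix.conjTranspose_apply, transform_apply, Matrix.one_apply]
  have h := sum_rawTransform_mul_star v k i.isLt i'.isLt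
  rw [Finset.sum_range] at h
  have e : ∀ j : Fin (2 ^ k), rawTransform v k i j / ((Real.sqrt ((2 : ℝ) ^ k) : ℝ) : ℂ) *
      star (rawTransform v k i' j / ((Real.sqrt ((2 : ℝ) ^ k) : ℝ) : ℂ)) =
      (rawTransform v k i j * star (rawTransform v k i' j)) / 2 ^ k := by
    intro j
    rw [star_div₀, ← sqrt_two_pow_mul_self]
    simp only [Complex.star_def, Complex.conj_ofReal]
    field_simp
  rw [sum_congr rfl fun j _ => e j, ← sum_div, h]
  by_cases hii : i = i'
  · simp [hii]
  · rw [if_neg hii, if_neg (fun h => hii (Fin.ext h)), zero_div]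

theorem transformBlocks_mem_unitaryGroup {L : ℕ} (v : Variant) (m : Fin L → ℕ) :
    transformBlocks v m ∈ Matrix.unitaryGroup (Idx m) ℂ := by
  rw [Matrix.mem_unitaryGroup_iff, Matrix.star_eq_conjTranspose, transformBlocks,
    Matrix.blockDiagonal'_conjTranspose, ← Matrix.blockDiagonal'_mul]
  simp only [transform_mul_conjTranspose]
  exact Matrix.blockDiagonal'_one

end FastMTGP

namespace FastMTGP
open Finset

/-! ### Binary digits of real numbers -/

section Digits

theorem hasSum_half_pow_succ : HasSum (fun p : ℕ => ((1 : ℝ) / 2) ^ (p + 1)) 1 := by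
  have := hasSum_geometric_two.mul_right (1 / 2 : ℝ)
  simpa [pow_succ] using this

theorem binary_term_le (b : ℕ → ℕ) (hb : ∀ p, b p ≤ 1) (p : ℕ) :
    (b p : ℝ) * (1 / 2) ^ (p + 1) ≤ (1 / 2) ^ (p + 1) :=
  mul_le_of_le_one_left (by positivity) (by exact_mod_cast hb p)

theorem summable_binary {b : ℕ → ℕ} (hb : ∀ p, b p ≤ 1) :
    Summable fun p => (b p : ℝ) * (1 / 2) ^ (p + 1) :=
  Summable.of_nonneg_of_le (fun _ => by positivity) (binary_term_le b hb)
    hasSum_half_pow_succ.summable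

theorem tsum_binary_mem_Ico {b : ℕ → ℕ} (hb : ∀ p, b p ≤ 1) (h0 : ∃ p, b p = 0) :
    ∑' p, (b p : ℝ) * (1 / 2) ^ (p + 1) ∈ Set.Ico (0 : ℝ) 1 := by
  refine ⟨tsum_nonneg fun _ => by positivity, ?_⟩
  obtain ⟨p, hp⟩ := h0
  have := Summable.tsum_lt_tsum (i := p) (binary_term_le b hb) (by rw [hp]; simp)
    (summable_binary hb) hasSum_half_pow_succ.summable
  rwa [hasSum_half_pow_succ.tsum_eq] at this

theorem tsum_binary_eq {b : ℕ → ℕ} (hb : ∀ p, b p ≤ 1) :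
    2 * ∑' p, (b p : ℝ) * (1 / 2) ^ (p + 1) =
      b 0 + ∑' p, (b (p + 1) : ℝ) * (1 / 2) ^ (p + 1) := by
  rw [(summable_binary hb).tsum_eq_zero_add, mul_add, ← tsum_mul_left]
  congr 1
  · simp; ring
  · exact tsum_congr fun p => by ring

/-- Doubling moves the leading digit in front of the binary point. The rest lies in [0,1) because
zeros recur, so the floor reads the digits off one by one; a tail of ones would sum to 1 and carry.
-/
theorem digit_tsum_binary (q : ℕ) : ∀ {b : ℕ → ℕ}, (∀ p, b p ≤ 1) → (∀ P, ∃ p ≥ P, b p = 0) →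
    digit (∑' p, (b p : ℝ) * (1 / 2) ^ (p + 1)) q = b q := by
  induction q with
  | zero =>
    intro b hb h0
    obtain ⟨p, hp, e⟩ := h0 1
    have ht := tsum_binary_mem_Ico (b := fun p => b (p + 1)) (fun p => hb _)
      ⟨p - 1, by rw [Nat.sub_add_cancel hp]; exact e⟩
    have hfl : ⌊∑' p, (b (p + 1) : ℝ) * (1 / 2) ^ (p + 1)⌋₊ = 0 := Nat.floor_eq_zero.2 ht.2
    rw [digit, zero_add, pow_one, tsum_binary_eq hb, add_comm, Nat.floor_add_natCast ht.1, hfl,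
      zero_add]
    exact Nat.mod_eq_of_lt (Nat.lt_succ_of_le (hb 0))
  | succ q ih =>
    intro b hb h0
    have h0' : ∀ P, ∃ p ≥ P, b (p + 1) = 0 := fun P => by
      obtain ⟨p, hp, e⟩ := h0 (P + 1)
      exact ⟨p - 1, by omega, by rw [Nat.sub_add_cancel (by omega)]; exact e⟩
    obtain ⟨p, hp, e⟩ := h0' 0
    have ht := tsum_binary_mem_Ico (b := fun p => b (p + 1)) (fun p => hb _) ⟨p, e⟩
    rw [← ih (b := fun p => b (p + 1)) (fun p => hb _) h0', digit, pow_succ, mul_assoc,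
      tsum_binary_eq hb, mul_add, add_comm, digit]
    have : (2 : ℝ) ^ (q + 1) * (b 0 : ℝ) = ((2 ^ (q + 1) * b 0 : ℕ) : ℝ) := by push_cast; rfl
    -- The leading digit contributes an even integer, which does not change the parity of the floor.
    have h2 : 2 ^ (q + 1) * b 0 = 2 * (2 ^ q * b 0) := by ring
    rw [this, Nat.floor_add_natCast (mul_nonneg (by positivity) ht.1), h2,
      Nat.add_mul_mod_self_left]

variable {d : ℕ} {a b : Fin d → ℝ}

theorem digit_dshift (h : NoTail a b) (j : Fin d) (p : ℕ) :
    digit (dshift a b j) p = (digit (a j) p + digit (b j) p) % 2 :=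
  digit_tsum_binary p (b := fun p => (digit (a j) p + digit (b j) p) % 2)
    (fun _ => Nat.le_of_lt_succ (Nat.mod_lt _ two_pos)) (h j)

theorem dshift_mem_cube (h : NoTail a b) : dshift a b ∈ cube d := fun j => by
  obtain ⟨p, -, e⟩ := h j 0
  exact tsum_binary_mem_Ico (fun _ => Nat.le_of_lt_succ (Nat.mod_lt _ two_pos)) ⟨p, e⟩

theorem digit_zero (p : ℕ) : digit 0 p = 0 := by simp [digit]

/-- The partial fold that defines `digitalPoint`. -/
theorem digitalPoint_eq_foldl {G : ℕ → Fin d → ℝ} {i k : ℕ} (h : i < 2 ^ k) :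
    digitalPoint G i =
      (List.range k).foldl (fun z p => if i.testBit p then dshift z (G p) else z) 0 := by
  have key : ∀ a s : ℕ, i < 2 ^ a →
      (List.range (a + s)).foldl (fun z p => if i.testBit p then dshift z (G p) else z) 0 =
      (List.range a).foldl (fun z p => if i.testBit p then dshift z (G p) else z) 0 := by
    intro a s ha
    induction s with
    | zero => rfl
    | succ s ih =>
      have : i < 2 ^ (a + s) := lt_of_lt_of_le ha (Nat.pow_le_pow_right two_pos (by omega))
      rw [← add_assoc, List.range_succ, List.foldl_append, ih]
      simp [Nat.testBit_lt_two_pow this]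
  have hlog : i < 2 ^ (Nat.log 2 i + 1) := Nat.lt_pow_succ_log_self one_lt_two i
  rcases le_total (Nat.log 2 i + 1) k with hk | hk
  · obtain ⟨s, rfl⟩ := Nat.exists_eq_add_of_le hk
    exact (key _ s hlog).symm
  · obtain ⟨s, e⟩ := Nat.exists_eq_add_of_le hk
    rw [digitalPoint, e]
    exact key _ s h

theorem digitalPoint_add_two_pow {G : ℕ → Fin d → ℝ} {i k : ℕ} (h : i < 2 ^ k) :
    digitalPoint G (i + 2 ^ k) = dshift (digitalPoint G i) (G k) := by
  have h2 : i + 2 ^ k < 2 ^ (k + 1) := by rw [pow_succ]; omega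
  rw [digitalPoint_eq_foldl h2, digitalPoint_eq_foldl h, List.range_succ, List.foldl_append]
  have hk : (i + 2 ^ k).testBit k = true := by
    rw [add_comm, Nat.testBit_two_pow_add_eq, Nat.testBit_lt_two_pow h]; rfl
  simp only [List.foldl_cons, List.foldl_nil, hk, if_true]
  congr 1
  refine List.foldl_ext _ _ _ fun z p hp => ?_
  rw [add_comm, Nat.testBit_two_pow_add_gt (List.mem_range.1 hp)]

/-- Every binary digit of the point is linear over 𝔽₂ in the bits of i. The top bit is peeled off;
the absence of tails of ones lets each exclusive or act digit by digit. -/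
theorem digit_digitalPoint {G : ℕ → Fin d → ℝ} (j : Fin d) (p : ℕ) : ∀ {k : ℕ},
    (∀ q < k, ∀ i < 2 ^ q, NoTail (digitalPoint G i) (G q)) → ∀ {i : ℕ}, i < 2 ^ k →
    digit (digitalPoint G i j) p = (∑ q ∈ range k, bit i q * digit (G q j) p) % 2 := by
  intro k
  induction k with
  | zero =>
    intro _ i hi
    rw [digitalPoint_eq_foldl hi]
    simp [digit_zero]
  | succ k ih =>
    intro hG i hi
    have ih := fun {i : ℕ} (h : i < 2 ^ k) => ih (fun q hq => hG q (by omega)) h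
    rw [sum_range_succ]
    rcases lt_or_ge i (2 ^ k) with h | h
    · rw [ih h, bit_eq_zero h, zero_mul, add_zero]
    · obtain ⟨i, rfl⟩ := Nat.exists_eq_add_of_le' h
      have g : i < 2 ^ k := by rw [pow_succ] at hi; omega
      rw [digitalPoint_add_two_pow g, digit_dshift (hG k (by omega) i g), ih g,
        bit_add_two_pow_self g, one_mul, Nat.mod_add_mod]
      congr 2
      exact sum_congr rfl fun q hq => by rw [bit_add_two_pow_of_lt (mem_range.1 hq)]

end Digits

theorem bit_xor_modEq (i i' p : ℕ) : bit (i ^^^ i') p ≡ bit i p + bit i' p [MOD 2] := by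
  unfold bit Nat.ModEq
  rw [Nat.testBit_xor]
  cases i.testBit p <;> cases i'.testBit p <;> rfl

/-! ### The group structure on the positions -/

/-- `s` is the difference of `i` and `i'` in the group underlying the transform. -/
def IsDiff (v : Variant) (s i i' : ℕ) : Prop :=
  match v with
  | .siLat => ∃ z : ℤ, vdc i - vdc i' = vdc s + z
  | .dsiDseq => s = i ^^^ i'

section Diff

variable {v : Variant} {k i i' s : ℕ}

/-- The character property in the row index. For lattices, the integer by which v(i) − v(i') exceeds
v(s) disappears because j is an integer; for digital sequences only the parity of the exponent
matters. -/
theorem IsDiff.rawTransform_eq (h : IsDiff v s i i') (j : ℕ) :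
    rawTransform v k i j = rawTransform v k s j * rawTransform v k i' j := by
  cases v
  · obtain ⟨z, e⟩ := h
    have e' : vdc i = vdc s + vdc i' + z := by linarith
    have h1 := exp_two_pi_int ((j : ℤ) * z)
    simp only [rawTransform]
    rw [← Complex.exp_add, ← mul_one (Complex.exp (_ + _)), ← h1, ← Complex.exp_add, e']
    congr 1; push_cast; ring
  · have hs : s = i ^^^ i' := h
    subst hs
    simp only [rawTransform, ← pow_add]
    rw [← sum_add_distrib, neg_one_pow_eq_pow_mod_two,
      neg_one_pow_eq_pow_mod_two (n := ∑ p ∈ range k, (_ + _))]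
    congr 1
    refine Nat.ModEq.sum fun p _ => ?_
    rw [← add_mul]
    have := bit_xor_modEq i i' p
    refine Nat.ModEq.mul_right _ ?_
    unfold Nat.ModEq at this ⊢
    omega

theorem vdc_inj_of_lt {i i' : ℕ} (hi : i < 2 ^ k) (hi' : i' < 2 ^ k) (h : vdc i = vdc i') :
    i = i' :=
  rawTransform_injective (v := .siLat) hi hi' fun j _ => by simp only [rawTransform, h]

/-- On the indices below 2^k, v is an injection into the 2^k multiples of 2^{-k} in [0,1), hence a
bijection. -/
theorem exists_vdc_eq {a : ℕ} (ha : a < 2 ^ k) : ∃ i < 2 ^ k, vdc i = (a : ℝ) / 2 ^ k := by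
  choose f hf hv using fun i : Fin (2 ^ k) => exists_vdc_eq_div k i.isLt
  have hinj : Function.Injective fun i => (⟨f i, hf i⟩ : Fin (2 ^ k)) := fun i i' h => by
    have : f i = f i' := congrArg Fin.val h
    exact Fin.ext (vdc_inj_of_lt i.isLt i'.isLt (by rw [hv, hv, this]))
  obtain ⟨i, hi⟩ := (Finite.surjective_of_injective hinj) ⟨a, ha⟩
  have : f i = a := congrArg Fin.val hi
  exact ⟨i, i.isLt, by rw [hv, this]⟩

theorem exists_isDiff (v : Variant) (hi : i < 2 ^ k) (hi' : i' < 2 ^ k) :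
    ∃ s < 2 ^ k, IsDiff v s i i' := by
  cases v
  · obtain ⟨a, -, e⟩ := exists_vdc_eq_div k hi
    obtain ⟨a', -, e'⟩ := exists_vdc_eq_div k hi'
    have hpos : (0 : ℤ) < 2 ^ k := by positivity
    obtain ⟨b, hb⟩ := Int.eq_ofNat_of_zero_le (Int.emod_nonneg ((a : ℤ) - a') hpos.ne')
    have hb2 : b < 2 ^ k := by
      have := Int.emod_lt_of_pos ((a : ℤ) - a') hpos
      rw [hb] at this; exact_mod_cast this
    obtain ⟨s, hs, es⟩ := exists_vdc_eq hb2
    -- With v(i) = a/2^k and v(i') = a'/2^k, the index s stands for the remainder of a − a' modulo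
    -- 2^k, and the discarded integer is the quotient.
    refine ⟨s, hs, ((a : ℤ) - a') / 2 ^ k, ?_⟩
    have h1 := Int.emod_add_mul_ediv ((a : ℤ) - a') (2 ^ k)
    rw [hb] at h1
    have h2 : ((b : ℝ) + 2 ^ k * ((((a : ℤ) - a') / 2 ^ k : ℤ) : ℝ)) = (a : ℝ) - a' := by
      exact_mod_cast h1
    rw [e, e', es, ← sub_div, ← h2]
    field_simp
  · exact ⟨i ^^^ i', Nat.xor_lt_two_pow hi hi', rfl⟩

/-- It makes the noise, which sits on the diagonal i = i', a function of the difference. -/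
theorem IsDiff.eq_zero_iff (h : IsDiff v s i i') (hs : s < 2 ^ k) (hi : i < 2 ^ k)
    (hi' : i' < 2 ^ k) : s = 0 ↔ i = i' := by
  have hr := h.rawTransform_eq (k := k)
  constructor
  · rintro rfl
    refine rawTransform_injective (v := v) hi hi' fun j _ => ?_
    rw [hr, rawTransform_zero_left, one_mul]
  · rintro rfl
    refine rawTransform_injective (v := v) hs (Nat.two_pow_pos k) fun j _ => ?_
    have h1 := rawTransform_mul_star v k i j
    rw [rawTransform_zero_left]
    have : rawTransform v k i j ≠ 0 := left_ne_zero_of_mul_eq_one h1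
    exact mul_right_cancel₀ this (by rw [← hr, one_mul])

theorem IsDiff.left_injective {i₂ : ℕ} (h : IsDiff v s i i') (h₂ : IsDiff v s i₂ i')
    (hi : i < 2 ^ k) (hi₂ : i₂ < 2 ^ k) : i = i₂ :=
  rawTransform_injective (v := v) hi hi₂ fun j _ => by
    rw [h.rawTransform_eq, h₂.rawTransform_eq]

end Diff

variable {d L : ℕ} {m : Fin L → ℕ} {P : Problem d m} {v : Variant}

/-! ### The structure of the Gram matrix -/

/-- The index in task `ℓ` with position `i` modulo the size of the task. -/
def idx (m : Fin L → ℕ) (ℓ : Fin L) (i : ℕ) : Idx m :=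
  ⟨ℓ, ⟨i % 2 ^ m ℓ, Nat.mod_lt _ (Nat.two_pow_pos _)⟩⟩

theorem proj_eq_idx (ℓ : Fin L) (p : Idx m) : proj ℓ p = idx m ℓ p.2 := rfl

theorem idx_self (p : Idx m) : idx m p.1 p.2 = p := by
  obtain ⟨ℓ, i⟩ := p
  simp [idx, Nat.mod_eq_of_lt i.isLt]

theorem latticePoint_eq {g : Fin d → ℕ} {Δ : Fin d → ℝ} (i : ℕ) (j : Fin d) :
    ∃ z : ℤ, latticePoint g Δ i j = vdc i * g j + Δ j + z := by
  refine ⟨-⌊vdc i * g j⌋ - ⌊Int.fract (vdc i * g j) + Δ j⌋, ?_⟩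
  rw [latticePoint, Int.fract, Int.fract]
  push_cast
  ring

theorem Problem.IsFast.mem_cube (h : P.IsFast v) (p : Idx m) : P.x p ∈ cube d := by
  cases v
  · obtain ⟨-, g, Δ, -, hx⟩ := h.design
    rw [hx]
    exact fun j => ⟨Int.fract_nonneg _, Int.fract_lt_one _⟩
  · obtain ⟨-, G, Δ, -, -, hx, -, h2, -⟩ := h.design
    rw [hx]
    exact dshift_mem_cube (h2 p)

/-- The points are the images of i and i' under one homomorphism of the index group, each moved by
the shift of its task. Their difference, modulo 1 or digitwise, is the image of s plus a term that
depends on the two shifts only. The smaller index is read in the larger group. -/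
theorem Problem.IsFast.kernelAt_eq (h : P.IsFast v) {ℓ ℓ' : Fin L} (hm : m ℓ' ≤ m ℓ)
    {i i' s : ℕ} (hi : i < 2 ^ m ℓ) (hi' : i' < 2 ^ m ℓ') (hs : s < 2 ^ m ℓ)
    (hd : IsDiff v s i i') :
    P.kernelAt (idx m ℓ i) (idx m ℓ' i') = P.kernelAt (idx m ℓ s) (idx m ℓ' 0) := by
  have hcube := h.mem_cube
  unfold Problem.kernelAt productKernel
  show P.R ℓ ℓ' * P.Q (P.x (idx m ℓ i)) (P.x (idx m ℓ' i')) =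
    P.R ℓ ℓ' * P.Q (P.x (idx m ℓ s)) (P.x (idx m ℓ' 0))
  congr 1
  cases v
  · obtain ⟨⟨Qh, hQ⟩, g, Δ, -, hx⟩ := h.design
    rw [hQ _ (hcube _) _ (hcube _), hQ _ (hcube _) _ (hcube _)]
    congr 1
    funext j
    obtain ⟨z, e⟩ := hd
    simp only [hx, idx, Nat.mod_eq_of_lt hi, Nat.mod_eq_of_lt hi', Nat.mod_eq_of_lt hs,
      Nat.zero_mod]
    obtain ⟨z1, e1⟩ := latticePoint_eq (g := g) (Δ := Δ ℓ) i j
    obtain ⟨z2, e2⟩ := latticePoint_eq (g := g) (Δ := Δ ℓ') i' j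
    obtain ⟨z3, e3⟩ := latticePoint_eq (g := g) (Δ := Δ ℓ) s j
    obtain ⟨z4, e4⟩ := latticePoint_eq (g := g) (Δ := Δ ℓ') 0 j
    rw [e1, e2, e3, e4, Int.fract_eq_fract]
    -- The integer collects z from the difference of the indices, multiplied by g_j, and the integer
    -- parts dropped from the four lattice points.
    refine ⟨z * g j + z1 - z2 - z3 + z4, ?_⟩
    rw [vdc_zero]
    push_cast
    linear_combination (g j : ℝ) * e
  · obtain ⟨⟨Qh, hQ⟩, G, Δ, -, -, hx, hG, hΔ, hxx⟩ := h.design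
    rw [hQ _ (hcube _) _ (hcube _) (hxx _ _), hQ _ (hcube _) _ (hcube _) (hxx _ _)]
    congr 1
    funext j
    refine tsum_congr fun p => ?_
    congr 2
    have hsub : s = i ^^^ i' := hd
    have hle : 2 ^ m ℓ' ≤ 2 ^ m ℓ := Nat.pow_le_pow_right two_pos hm
    have dx : ∀ q : Idx m, digit (P.x q j) p =
        (digit (digitalPoint G q.2 j) p + digit (Δ q.1 j) p) % 2 := fun q => by
      rw [hx, digit_dshift (hΔ q)]
    simp only [dx, idx, Nat.mod_eq_of_lt hi, Nat.mod_eq_of_lt hi', Nat.mod_eq_of_lt hs,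
      Nat.zero_mod]
    have dd := fun {i : ℕ} (h : i < 2 ^ m ℓ) => digit_digitalPoint (G := G) j p (hG ℓ) h
    rw [dd hi, dd (hi'.trans_le hle), dd hs, dd (Nat.two_pow_pos _)]
    have hmod : ∑ q ∈ range (m ℓ), bit s q * digit (G q j) p ≡
        ∑ q ∈ range (m ℓ), bit i q * digit (G q j) p +
          ∑ q ∈ range (m ℓ), bit i' q * digit (G q j) p [MOD 2] := by
      rw [← sum_add_distrib, hsub]
      refine Nat.ModEq.sum fun q _ => ?_
      rw [← add_mul]
      exact (bit_xor_modEq i i' q).mul_right _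
    have h0 : ∑ q ∈ range (m ℓ), bit 0 q * digit (G q j) p = 0 := by simp [bit]
    -- Modulo 2, the digits of the two shifts appear on both sides, and the digit of point s is the
    -- sum of those of points i and i'.
    rw [h0]
    unfold Nat.ModEq at hmod
    omega

theorem Problem.IsFast.gram_eq (h : P.IsFast v) {ℓ ℓ' : Fin L} (hm : m ℓ' ≤ m ℓ)
    {i i' s : ℕ} (hi : i < 2 ^ m ℓ) (hi' : i' < 2 ^ m ℓ') (hs : s < 2 ^ m ℓ)
    (hd : IsDiff v s i i') :
    P.gram (idx m ℓ i) (idx m ℓ' i') = P.gram (idx m ℓ s) (idx m ℓ' 0) := by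
  simp only [Problem.gram, Matrix.of_apply]
  rw [h.kernelAt_eq hm hi hi' hs hd]
  congr 1
  by_cases hl : ℓ = ℓ'
  · subst hl
    have := hd.eq_zero_iff hs hi hi'
    refine if_congr ?_ rfl rfl
    simp [idx, Nat.mod_eq_of_lt hi, Nat.mod_eq_of_lt hi', Nat.mod_eq_of_lt hs, this]
  · rw [if_neg, if_neg] <;> · intro e; exact hl (congrArg Sigma.fst e)

/-- Translation by i' is a bijection of the index group. -/
theorem sum_eq_sum_of_isDiff {M : Type*} [AddCommMonoid M] (v : Variant) {k i' : ℕ}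
    (hi' : i' < 2 ^ k) (f g : ℕ → M)
    (h : ∀ i < 2 ^ k, ∀ s < 2 ^ k, IsDiff v s i i' → f i = g s) :
    ∑ i ∈ range (2 ^ k), f i = ∑ i ∈ range (2 ^ k), g i := by
  choose! e he hd using fun (i : ℕ) (hi : i < 2 ^ k) => exists_isDiff v hi hi'
  refine sum_bij (fun i _ => e i) (fun i hi => mem_range.2 (he i (mem_range.1 hi)))
    (fun i hi i₂ hi₂ hh => ?_) (fun s hs => ?_)
    (fun i hi => h i (mem_range.1 hi) _ (he i (mem_range.1 hi)) (hd i (mem_range.1 hi)))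
  · have hi := mem_range.1 hi
    have hi₂ := mem_range.1 hi₂
    have h1 := hd i hi
    rw [hh] at h1
    exact h1.left_injective (hd i₂ hi₂) hi hi₂
  · have hinj : Function.Injective fun i : Fin (2 ^ k) => (⟨e i, he i i.isLt⟩ : Fin (2 ^ k)) :=
      fun i i₂ hh => by
        have hh : e i = e i₂ := congrArg Fin.val hh
        have h1 := hd i i.isLt
        rw [hh] at h1
        exact Fin.ext (h1.left_injective (hd i₂ i₂.isLt) i.isLt i₂.isLt)
    obtain ⟨i, hi⟩ := Finite.surjective_of_injective hinj ⟨s, mem_range.1 hs⟩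
    exact ⟨i, mem_range.2 i.isLt, congrArg Fin.val hi⟩

/-- Orthogonality of the columns follows from that of the rows, since a right inverse of a square
matrix is a left inverse. -/
theorem sum_star_rawTransform_mul (v : Variant) (k : ℕ) {j j' : ℕ} (hj : j < 2 ^ k)
    (hj' : j' < 2 ^ k) :
    ∑ i ∈ range (2 ^ k), star (rawTransform v k i j) * rawTransform v k i j' =
      if j = j' then 2 ^ k else 0 := by
  have h := mul_eq_one_comm.1 (transform_mul_conjTranspose v k)
  have h1 := congrFun (congrFun h ⟨j, hj⟩) ⟨j', hj'⟩
  rw [Matrix.mul_apply, Matrix.one_apply] at h1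
  simp only [Matrix.conjTranspose_apply, transform_apply] at h1
  have e : ∀ i : Fin (2 ^ k), star (rawTransform v k i j / ((Real.sqrt ((2 : ℝ) ^ k) : ℝ) : ℂ)) *
      (rawTransform v k i j' / ((Real.sqrt ((2 : ℝ) ^ k) : ℝ) : ℂ)) =
      (star (rawTransform v k i j) * rawTransform v k i j') / 2 ^ k := by
    intro i
    rw [star_div₀, ← sqrt_two_pow_mul_self]
    simp only [Complex.star_def, Complex.conj_ofReal]
    field_simp
  rw [sum_congr rfl fun i _ => e i, ← sum_div, div_eq_iff (pow_ne_zero k two_ne_zero)] at h1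
  rw [Finset.sum_range, h1]
  simp only [Fin.mk.injEq]
  split_ifs <;> simp

theorem lam_apply (P : Problem d m) (v : Variant) (p q : Idx m) :
    P.lam v p q = (∑ i ∈ range (2 ^ m p.1), ∑ i' ∈ range (2 ^ m q.1),
      star (rawTransform v (m p.1) i p.2) * P.gramC (idx m p.1 i) (idx m q.1 i') *
        rawTransform v (m q.1) i' q.2) /
      (((Real.sqrt ((2 : ℝ) ^ m p.1) : ℝ) : ℂ) * ((Real.sqrt ((2 : ℝ) ^ m q.1) : ℝ) : ℂ)) := by
  obtain ⟨ℓ, j⟩ := p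
  obtain ⟨ℓ', j'⟩ := q
  have hidx : ∀ (ℓ : Fin L) (i : Fin (2 ^ m ℓ)), idx m ℓ i = ⟨ℓ, i⟩ := fun ℓ i => idx_self ⟨ℓ, i⟩
  have e1 : P.lam v ⟨ℓ, j⟩ ⟨ℓ', j'⟩ = ∑ i' : Fin (2 ^ m ℓ'), ∑ i : Fin (2 ^ m ℓ),
      star (transform v (m ℓ) i j) * P.gramC ⟨ℓ, i⟩ ⟨ℓ', i'⟩ * transform v (m ℓ') i' j' := by
    rw [Problem.lam, Matrix.mul_apply, Fintype.sum_sigma, Finset.sum_eq_single ℓ']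
    · refine sum_congr rfl fun i' _ => ?_
      rw [Matrix.mul_apply, Fintype.sum_sigma, Finset.sum_eq_single ℓ, ← Finset.sum_mul]
      · simp [transformBlocks, Matrix.blockDiagonal'_apply]
      · intro b _ hb
        refine sum_eq_zero fun i _ => ?_
        simp [transformBlocks, Matrix.blockDiagonal'_apply, hb]
      · simp
    · intro b _ hb
      refine sum_eq_zero fun i _ => ?_
      simp [transformBlocks, Matrix.blockDiagonal'_apply, hb]
    · simp
  rw [e1, sum_comm]
  simp only [Finset.sum_range, sum_div, hidx]
  refine sum_congr rfl fun i _ => sum_congr rfl fun i' _ => ?_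
  rw [transform_apply, transform_apply, star_div₀]
  simp only [Complex.star_def, Complex.conj_ofReal]
  have := sqrt_two_pow_ne_zero (m ℓ)
  have := sqrt_two_pow_ne_zero (m ℓ')
  field_simp

/-- The upper blocks of the transformed Gram matrix have diagonal subblocks, which are obtained
from the first column of the corresponding block of the Gram matrix. -/
theorem Problem.IsFast.lam_eq (h : P.IsFast v) {p q : Idx m} (hm : m q.1 ≤ m p.1) :
    P.lam v p q = if (p.2 : ℕ) % 2 ^ m q.1 = q.2 then
      (((Real.sqrt ((2 : ℝ) ^ m q.1) : ℝ) : ℂ) / ((Real.sqrt ((2 : ℝ) ^ m p.1) : ℝ) : ℂ)) *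
      ∑ i ∈ range (2 ^ m p.1), star (rawTransform v (m p.1) i p.2) *
        P.gramC (idx m p.1 i) (idx m q.1 0) else 0 := by
  rw [lam_apply, sum_comm]
  have hle : 2 ^ m q.1 ≤ 2 ^ m p.1 := Nat.pow_le_pow_right two_pos hm
  have e1 : ∀ i' ∈ range (2 ^ m q.1), ∑ i ∈ range (2 ^ m p.1),
      star (rawTransform v (m p.1) i p.2) * P.gramC (idx m p.1 i) (idx m q.1 i') *
        rawTransform v (m q.1) i' q.2 =
      star (rawTransform v (m q.1) i' ((p.2 : ℕ) % 2 ^ m q.1)) * rawTransform v (m q.1) i' q.2 *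
      ∑ i ∈ range (2 ^ m p.1), star (rawTransform v (m p.1) i p.2) *
        P.gramC (idx m p.1 i) (idx m q.1 0) := by
    intro i' hi'
    have hi' := mem_range.1 hi'
    -- Substitute i = s + i': the character splits into a product, and the Gram entry depends on s
    -- only.
    rw [sum_eq_sum_of_isDiff v (hi'.trans_le hle) _ (fun s =>
      star (rawTransform v (m p.1) s p.2 * rawTransform v (m p.1) i' p.2) *
        P.gramC (idx m p.1 s) (idx m q.1 0) * rawTransform v (m q.1) i' q.2), mul_sum]
    · refine sum_congr rfl fun i _ => ?_
      have hr : rawTransform v (m p.1) i' p.2 =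
          rawTransform v (m q.1) i' ((p.2 : ℕ) % 2 ^ m q.1) :=
        rawTransform_of_lt v hm hi' p.2.isLt
      rw [hr, star_mul]
      ring
    · intro i hi s hs hd
      have hg : P.gramC (idx m p.1 i) (idx m q.1 i') = P.gramC (idx m p.1 s) (idx m q.1 0) := by
        simp only [Problem.gramC, Matrix.map_apply]
        rw [h.gram_eq hm hi hi' hs hd]
      rw [hd.rawTransform_eq, hg]
  -- The sum over i' is an inner product of two columns of the small transform. It gives n_ℓ' or 0,
  -- which leaves √n_ℓ'/√n_ℓ after the normalization.
  rw [sum_congr rfl e1, ← sum_mul, sum_star_rawTransform_mul v _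
    (Nat.mod_lt _ (Nat.two_pow_pos _)) q.2.isLt]
  have h1 := sqrt_two_pow_ne_zero (m p.1)
  have h2 := sqrt_two_pow_ne_zero (m q.1)
  split_ifs
  · rw [← sqrt_two_pow_mul_self]
    field_simp
  · simp

end FastMTGP

/-! ### Positive definiteness, determinants and inverses. -/

namespace FastMTGP
open Finset
open scoped ComplexOrder

variable {d L : ℕ} {m : Fin L → ℕ} {P : Problem d m} {v : Variant}

theorem IsSPDKernel.sum_pos {α : Type*} {s : Set α} {K : α → α → ℝ} (hK : IsSPDKernel s K)
    {S : Finset α} (hS : ∀ x ∈ S, x ∈ s) {b : α → ℝ} (hb : ∃ x ∈ S, b x ≠ 0) :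
    0 < ∑ x ∈ S, ∑ y ∈ S, b x * b y * K x y := by
  have h := hK.2 S.card (fun i => (S.equivFin.symm i : α)) (fun i => b (S.equivFin.symm i))
    (fun i => hS _ (S.equivFin.symm i).2)
    (Subtype.val_injective.comp S.equivFin.symm.injective) (by
      obtain ⟨x, hx, hne⟩ := hb
      intro h0
      have := congrFun h0 (S.equivFin ⟨x, hx⟩)
      simp only [Equiv.symm_apply_apply, Pi.zero_apply] at this
      exact hne this)
  have e : ∀ f : α → ℝ, ∑ i, f (S.equivFin.symm i : α) = ∑ x ∈ S, f x := fun f => by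
    rw [← Finset.sum_coe_sort S f]
    exact Equiv.sum_comp S.equivFin.symm fun x : S => f x
  rw [e fun x => ∑ j, b x * b (S.equivFin.symm j) * K x (S.equivFin.symm j)] at h
  refine h.trans_eq (sum_congr rfl fun x _ => ?_)
  exact e fun y => b x * b y * K x y

/-- Collocation points may coincide, whereas strict positivity of the kernel concerns distinct
points; the coefficients are pooled over coinciding points first. -/
theorem sum_eq_sum_image {ι α : Type*} [Fintype ι] [DecidableEq α] (z : ι → α) (c : ι → ℝ)
    (K : α → α → ℝ) :
    ∑ p, ∑ q, c p * c q * K (z p) (z q) =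
      ∑ x ∈ univ.image z, ∑ y ∈ univ.image z,
        (∑ p with z p = x, c p) * (∑ q with z q = y, c q) * K x y := by
  have h1 : ∀ p ∈ (univ : Finset ι), z p ∈ univ.image z := fun p hp => mem_image_of_mem z hp
  rw [← sum_fiberwise_of_maps_to h1]
  refine sum_congr rfl fun x _ => ?_
  rw [sum_comm, ← sum_fiberwise_of_maps_to h1]
  refine sum_congr rfl fun y _ => ?_
  rw [sum_mul_sum, sum_mul, sum_comm]
  simp only [sum_mul]
  refine sum_congr rfl fun p hp => sum_congr rfl fun q hq => ?_
  rw [(mem_filter.1 hp).2, (mem_filter.1 hq).2]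

theorem Problem.IsFast.gram_symm (h : P.IsFast v) (p q : Idx m) : P.gram p q = P.gram q p := by
  simp only [Problem.gram, Matrix.of_apply, Problem.kernelAt]
  rw [h.spd.1 _ ⟨Set.mem_univ _, h.mem_cube p⟩ _ ⟨Set.mem_univ _, h.mem_cube q⟩]
  congr 1
  by_cases e : p = q
  · subst e; rfl
  · rw [if_neg e, if_neg (Ne.symm e)]

/-- If some pooled coefficient is nonzero, the kernel part of the form is positive. Otherwise it
vanishes, and a nonzero coefficient must share its point with another index of its task; that task
is then noisy, and the noise part is positive. -/
theorem Problem.IsFast.gram_posDef (h : P.IsFast v) (hn : P.Nondegenerate) : P.gram.PosDef := by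
  classical
  rw [Matrix.posDef_iff_dotProduct_mulVec]
  refine ⟨Matrix.IsHermitian.ext fun p q => by rw [h.gram_symm q p]; rfl, fun c hc => ?_⟩
  have hform : star c ⬝ᵥ P.gram.mulVec c =
      ∑ p, ∑ q, c p * c q * P.kernelAt p q + ∑ p : Idx m, P.ξ p.1 * c p ^ 2 := by
    simp only [dotProduct, Matrix.mulVec, Problem.gram, Matrix.of_apply, add_mul, sum_add_distrib,
      mul_add, mul_sum, Pi.star_apply, star_trivial]
    congr 1
    · exact sum_congr rfl fun p _ => sum_congr rfl fun q _ => by ring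
    · refine sum_congr rfl fun p _ => ?_
      rw [sum_eq_single p]
      · simp; ring
      · intro q _ hq; simp [Ne.symm hq]
      · simp
  rw [hform]
  let z : Idx m → Fin L × (Fin d → ℝ) := fun p => (p.1, P.x p)
  have e := sum_eq_sum_image z c (productKernel P.R P.Q)
  have hS : ∀ x ∈ univ.image z, x ∈ (Set.univ : Set (Fin L)) ×ˢ cube d := by
    intro x hx
    obtain ⟨p, -, rfl⟩ := mem_image.1 hx
    exact ⟨Set.mem_univ _, h.mem_cube p⟩
  have hnoise : 0 ≤ ∑ p : Idx m, P.ξ p.1 * c p ^ 2 :=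
    sum_nonneg fun p _ => mul_nonneg (h.noise_nonneg _) (sq_nonneg _)
  have e' : ∑ p, ∑ q, c p * c q * P.kernelAt p q = _ := e
  rw [e']
  by_cases hb : ∃ x ∈ univ.image z, (∑ p with z p = x, c p) ≠ 0
  · exact add_pos_of_pos_of_nonneg (h.spd.sum_pos hS hb) hnoise
  · push Not at hb
    obtain ⟨p, hp⟩ := Function.ne_iff.1 hc
    have h0 : ∑ x ∈ univ.image z, ∑ y ∈ univ.image z,
        (∑ p with z p = x, c p) * (∑ q with z q = y, c q) * productKernel P.R P.Q x y = 0 :=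
      sum_eq_zero fun x hx => sum_eq_zero fun y _ => by rw [hb x hx]; ring
    rw [h0, zero_add]
    have hξ : 0 < P.ξ p.1 := by
      -- With distinct points in the task of p, the pooled coefficient at p is c p alone, which
      -- would vanish.
      refine (hn p.1).resolve_right fun hinj => hp ?_
      have h1 := hb (z p) (mem_image_of_mem z (mem_univ p))
      rw [sum_eq_single p] at h1
      · exact h1
      · intro q hq hne
        exfalso
        have hz := (mem_filter.1 hq).2
        obtain ⟨ℓ, i⟩ := p
        obtain ⟨ℓ', i'⟩ := q
        have h2 : ℓ' = ℓ := congrArg Prod.fst hz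
        subst h2
        have h3 : P.x ⟨ℓ', i'⟩ = P.x ⟨ℓ', i⟩ := congrArg Prod.snd hz
        exact hne (by rw [hinj h3])
      · simp
    exact sum_pos' (fun p _ => mul_nonneg (h.noise_nonneg _) (sq_nonneg _))
      ⟨p, mem_univ p, mul_pos hξ (sq_pos_of_ne_zero hp)⟩

/-- For a symmetric real matrix, the form at a complex vector is the sum of the forms at its real
and imaginary parts. -/
theorem posDef_map_ofReal {ι : Type*} [Fintype ι] {K : Matrix ι ι ℝ} (hK : K.PosDef) :
    (K.map fun t => (t : ℂ)).PosDef := by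
  have hsymm : ∀ i j, K i j = K j i := fun i j => by simpa using (hK.isHermitian.apply i j).symm
  have hH : (K.map fun t => (t : ℂ)).IsHermitian := Matrix.IsHermitian.ext fun i j => by
    simp [hsymm i j]
  rw [Matrix.posDef_iff_dotProduct_mulVec]
  refine ⟨hH, fun x hx => ?_⟩
  have hpos : ∀ c : ι → ℝ, 0 ≤ star c ⬝ᵥ K.mulVec c := hK.posSemidef.dotProduct_mulVec_nonneg
  have him : (star x ⬝ᵥ (K.map fun t => (t : ℂ)).mulVec x).im = 0 := by
    have := hH.im_star_dotProduct_mulVec_self x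
    simpa using this
  have hre : (star x ⬝ᵥ (K.map fun t => (t : ℂ)).mulVec x).re =
      star (fun i => (x i).re) ⬝ᵥ K.mulVec (fun i => (x i).re) +
      star (fun i => (x i).im) ⬝ᵥ K.mulVec (fun i => (x i).im) := by
    simp only [dotProduct, Matrix.mulVec, Complex.re_sum, mul_sum, Pi.star_apply, star_trivial,
      Matrix.map_apply]
    rw [← sum_add_distrib]
    refine sum_congr rfl fun i _ => ?_
    rw [← sum_add_distrib]
    refine sum_congr rfl fun j _ => ?_
    simp [Complex.mul_re, Complex.mul_im]
  refine Complex.pos_iff.2 ⟨?_, him.symm⟩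
  rw [hre]
  by_cases h : (fun i => (x i).re) = 0
  · have h2 : (fun i => (x i).im) ≠ 0 := fun h2 => hx (funext fun i =>
      Complex.ext (congrFun h i) (congrFun h2 i))
    exact add_pos_of_nonneg_of_pos (hpos _) (hK.dotProduct_mulVec_pos h2)
  · exact add_pos_of_pos_of_nonneg (hK.dotProduct_mulVec_pos h) (hpos _)

theorem Problem.gramC_eq (P : Problem d m) (v : Variant) :
    P.gramC = transformBlocks v m * P.lam v * (transformBlocks v m).conjTranspose := by
  have h := transformBlocks_mem_unitaryGroup v m
  have h1 : transformBlocks v m * (transformBlocks v m).conjTranspose = 1 :=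
    Matrix.mem_unitaryGroup_iff.1 h
  rw [Problem.lam, Matrix.mul_assoc, Matrix.mul_assoc, Matrix.mul_assoc, h1, Matrix.mul_one,
    ← Matrix.mul_assoc, h1, Matrix.one_mul]

theorem Problem.det_gramC (P : Problem d m) : P.gramC.det = ((P.gram.det : ℝ) : ℂ) :=
  (RingHom.map_det Complex.ofRealHom P.gram).symm

theorem Problem.det_lam (P : Problem d m) (v : Variant) :
    (P.lam v).det = ((P.gram.det : ℝ) : ℂ) := by
  have h1 : (transformBlocks v m).conjTranspose * transformBlocks v m = 1 :=
    Matrix.mem_unitaryGroup_iff'.1 (transformBlocks_mem_unitaryGroup v m)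
  rw [Problem.lam, Matrix.mul_assoc, Matrix.det_mul_comm, Matrix.mul_assoc,
    mul_eq_one_comm.1 h1, Matrix.mul_one, P.det_gramC]

theorem Problem.IsFast.gramC_isHermitian (h : P.IsFast v) : P.gramC.IsHermitian :=
  Matrix.IsHermitian.ext fun p q => by simp [Problem.gramC, h.gram_symm q p]

theorem Problem.IsFast.lam_isHermitian (h : P.IsFast v) : (P.lam v).IsHermitian :=
  Matrix.isHermitian_conjTranspose_mul_mul _ h.gramC_isHermitian

theorem Problem.IsFast.lam_posDef (h : P.IsFast v) (hn : P.Nondegenerate) : (P.lam v).PosDef := by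
  have h1 : (transformBlocks v m) * (transformBlocks v m).conjTranspose = 1 :=
    Matrix.mem_unitaryGroup_iff.1 (transformBlocks_mem_unitaryGroup v m)
  refine (posDef_map_ofReal (h.gram_posDef hn)).conjTranspose_mul_mul_same ?_
  exact Matrix.mulVec_injective_of_isUnit (IsUnit.of_mul_eq_one _ h1)

theorem Problem.gramC_inv (P : Problem d m) (v : Variant) :
    P.gramC⁻¹ = transformBlocks v m * (P.lam v)⁻¹ * (transformBlocks v m).conjTranspose := by
  have h1 : (transformBlocks v m) * (transformBlocks v m).conjTranspose = 1 :=
    Matrix.mem_unitaryGroup_iff.1 (transformBlocks_mem_unitaryGroup v m)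
  have h2 : (transformBlocks v m).conjTranspose⁻¹ = transformBlocks v m :=
    Matrix.inv_eq_left_inv h1
  have h3 : (transformBlocks v m)⁻¹ = (transformBlocks v m).conjTranspose :=
    Matrix.inv_eq_right_inv h1
  rw [P.gramC_eq v, Matrix.mul_inv_rev, Matrix.mul_inv_rev, h2, h3, ← Matrix.mul_assoc]

theorem Problem.gramC_mulVec (P : Problem d m) (y : Idx m → ℝ) (p : Idx m) :
    P.gramC.mulVec (fun q => ((y q : ℝ) : ℂ)) p = ((P.gram.mulVec y p : ℝ) : ℂ) := by
  simp [Matrix.mulVec, dotProduct, Problem.gramC]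

theorem Problem.gramC_inv_mulVec (P : Problem d m) (hP : IsUnit P.gram.det) (y : Idx m → ℝ)
    (p : Idx m) :
    P.gramC⁻¹.mulVec (fun q => ((y q : ℝ) : ℂ)) p = ((P.gram⁻¹.mulVec y p : ℝ) : ℂ) := by
  have h : P.gramC⁻¹ = P.gram⁻¹.map fun t => (t : ℂ) := by
    refine Matrix.inv_eq_right_inv ?_
    have h1 : (P.gram * P.gram⁻¹).map Complex.ofRealHom = 1 := by
      rw [Matrix.mul_nonsing_inv _ hP]
      exact Matrix.map_one _ (map_zero _) (map_one _)
    rw [Matrix.map_mul] at h1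
    exact h1
  simp [Matrix.mulVec, dotProduct, h]

end FastMTGP

namespace FastMTGP
open Finset

variable {L : ℕ} {m : Fin L → ℕ} {k : Idx m → Idx m → ℂ}

/-! ### Running programs -/

theorem runs_append {a b : Program m} {σ τ : Reg m → ℂ} :
    Runs k (a ++ b) σ τ ↔ ∃ ρ, Runs k a σ ρ ∧ Runs k b ρ τ := by
  induction a generalizing σ with
  | nil => simp [Runs]
  | cons i a ih =>
    rw [List.cons_append]
    simp only [Runs, ih]
    constructor
    · rintro ⟨h, ρ, h1, h2⟩; exact ⟨ρ, ⟨h, h1⟩, h2⟩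
    · rintro ⟨ρ, ⟨h, h1⟩, h2⟩; exact ⟨h, ρ, h1, h2⟩

theorem Runs.append {a b : Program m} {σ ρ τ : Reg m → ℂ} (h1 : Runs k a σ ρ)
    (h2 : Runs k b ρ τ) : Runs k (a ++ b) σ τ := runs_append.2 ⟨ρ, h1, h2⟩

section Loops

variable {α β : Type*}

/-- Loop rule: an invariant of the list of the iterations done and the memory. -/
theorem exists_runs_flatMap (f : α → Program m) (I : List α → (Reg m → ℂ) → Prop) :
    ∀ (l done : List α) (σ : Reg m → ℂ), I done σ →
      (∀ pre a post, l = pre ++ a :: post → ∀ σ', I (done ++ pre) σ' →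
        ∃ τ, Runs k (f a) σ' τ ∧ I (done ++ pre ++ [a]) τ) →
      ∃ τ, Runs k (l.flatMap f) σ τ ∧ I (done ++ l) τ
  | [], done, σ, h0, _ => ⟨σ, rfl, by simpa using h0⟩
  | a :: l, done, σ, h0, step => by
    obtain ⟨ρ, h1, h2⟩ := step [] a l rfl σ (by simpa using h0)
    obtain ⟨τ, h3, h4⟩ := exists_runs_flatMap f I l (done ++ [a]) ρ (by simpa using h2)
      (fun pre b post e σ' hσ' => by
        have := step (a :: pre) b post (by rw [e]; rfl) σ' (by simpa using hσ')
        simpa using this)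
    exact ⟨τ, h1.append h3, by simpa using h4⟩

/-- Parallel loop rule: iteration `a` writes the registers in `D a` and the scratch registers in
`T`, and the lists `D a` are disjoint. -/
theorem exists_runs_parallel (l : List α) (f : α → Program m) (D : α → List (Reg m))
    (T : Set (Reg m)) (V : α → Reg m → ℂ) (σ : Reg m → ℂ)
    (hdisj : l.Pairwise fun a b => List.Disjoint (D a) (D b))
    (hT : ∀ a ∈ l, ∀ r ∈ D a, r ∉ T)
    (h : ∀ a ∈ l, ∀ σ' : Reg m → ℂ, (∀ r ∈ D a, σ' r = σ r) →
      (∀ r, (∀ b ∈ l, r ∉ D b) → r ∉ T → σ' r = σ r) →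
      ∃ τ, Runs k (f a) σ' τ ∧ (∀ r ∈ D a, τ r = V a r) ∧ ∀ r, r ∉ D a → r ∉ T → τ r = σ' r) :
    ∃ τ, Runs k (l.flatMap f) σ τ ∧ (∀ a ∈ l, ∀ r ∈ D a, τ r = V a r) ∧
      ∀ r, (∀ b ∈ l, r ∉ D b) → r ∉ T → τ r = σ r := by
  obtain ⟨τ, h1, h2, h3⟩ := exists_runs_flatMap (k := k) f
    (fun done τ => (∀ a ∈ done, ∀ r ∈ D a, τ r = V a r) ∧
      ∀ r, (∀ b ∈ done, r ∉ D b) → r ∉ T → τ r = σ r) l [] σ ⟨by simp, by simp⟩ (by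
    rintro pre a post rfl σ' ⟨hd, hf⟩
    rw [List.nil_append] at hd hf
    rw [List.pairwise_append] at hdisj
    have ha : a ∈ pre ++ a :: post := by simp
    have hda : ∀ b ∈ pre, List.Disjoint (D b) (D a) := fun b hb =>
      hdisj.2.2 b hb a (by simp)
    obtain ⟨τ, t1, t2, t3⟩ := h a ha σ'
      (fun r hr => hf r (fun b hb hrb => hda b hb hrb hr) (hT a ha r hr))
      (fun r hr hrT => hf r (fun b hb => hr b (by simp [hb])) hrT)
    refine ⟨τ, t1, ?_, ?_⟩
    · intro b hb r hr
      rcases List.mem_append.1 hb with hb | hb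
      · rw [t3 r (fun hra => hda b hb hr hra) (hT b (by simp [show b ∈ pre from hb]) r hr)]
        exact hd b hb r hr
      · obtain rfl : b = a := by simpa using hb
        exact t2 r hr
    · intro r hr hrT
      rw [t3 r (hr a (by simp)) hrT]
      exact hf r (fun b hb => hr b (by simp [hb])) hrT)
  exact ⟨τ, h1, by simpa using h2, by simpa using h3⟩

/-- Parallel loop rule for iterations that write one register each. -/
theorem exists_runs_parallel_one (l : List α) (f : α → Program m) (dst : α → Reg m)
    (T : Set (Reg m)) (V : α → ℂ) (σ : Reg m → ℂ) (hl : (l.map dst).Nodup)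
    (hT : ∀ a ∈ l, dst a ∉ T)
    (h : ∀ a ∈ l, ∀ σ' : Reg m → ℂ, σ' (dst a) = σ (dst a) →
      (∀ r, (∀ b ∈ l, r ≠ dst b) → r ∉ T → σ' r = σ r) →
      ∃ τ, Runs k (f a) σ' τ ∧ τ (dst a) = V a ∧ ∀ r, r ≠ dst a → r ∉ T → τ r = σ' r) :
    ∃ τ, Runs k (l.flatMap f) σ τ ∧ (∀ a ∈ l, τ (dst a) = V a) ∧
      ∀ r, (∀ b ∈ l, r ≠ dst b) → r ∉ T → τ r = σ r := by
  have := exists_runs_parallel (k := k) l f (fun a => [dst a]) T (fun a _ => V a) σ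
    (by
      rw [List.Nodup, List.pairwise_map] at hl
      exact hl.imp fun hne => by simpa using Ne.symm hne)
    (by simpa using hT) (by simpa using h)
  simpa using this

/-- Parallel loop rule for loops of single instructions. -/
theorem exists_runs_map (l : List α) (f : α → Instr m) (dst : α → Reg m)
    (V : α → ℂ) (σ : Reg m → ℂ) (hl : (l.map dst).Nodup) (hdst : ∀ a, (f a).dest = dst a)
    (h : ∀ a ∈ l, ∀ σ' : Reg m → ℂ, σ' (dst a) = σ (dst a) →
      (∀ r, (∀ b ∈ l, r ≠ dst b) → σ' r = σ r) → (f a).Defined σ' ∧ (f a).value k σ' = V a) :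
    ∃ τ, Runs k (l.map f) σ τ ∧ (∀ a ∈ l, τ (dst a) = V a) ∧
      ∀ r, (∀ b ∈ l, r ≠ dst b) → τ r = σ r := by
  have := exists_runs_parallel_one (k := k) l (fun a => [f a]) dst ∅ V σ hl (by simp)
    (fun a ha σ' h1 h2 => by
      classical
      obtain ⟨h3, h4⟩ := h a ha σ' h1 (by simpa using h2)
      refine ⟨_, ⟨h3, rfl⟩, ?_, ?_⟩
      · rw [← hdst, Function.update_self, h4]
      · intro r hr _
        rw [Function.update_of_ne (by rw [hdst]; exact hr)])
  rw [List.map_eq_flatMap]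
  simpa using this

/-- Rule for loops that accumulate sums in the registers `acc b`. -/
theorem exists_runs_accumulate (l : List α) (f : α → Program m) (acc : β → Reg m)
    (dst : α → β) (T : Set (Reg m)) (val : α → ℂ) (σ : Reg m → ℂ) [DecidableEq β]
    (hinj : Function.Injective acc) (hT : ∀ b, acc b ∉ T)
    (h : ∀ a ∈ l, ∀ σ' : Reg m → ℂ, (∀ r, (∀ b, r ≠ acc b) → r ∉ T → σ' r = σ r) →
      ∃ τ, Runs k (f a) σ' τ ∧ τ (acc (dst a)) = σ' (acc (dst a)) + val a ∧
        ∀ r, r ≠ acc (dst a) → r ∉ T → τ r = σ' r) :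
    ∃ τ, Runs k (l.flatMap f) σ τ ∧
      (∀ b, τ (acc b) = σ (acc b) + (l.map fun a => if dst a = b then val a else 0).sum) ∧
      ∀ r, (∀ b, r ≠ acc b) → r ∉ T → τ r = σ r := by
  obtain ⟨τ, h1, h2, h3⟩ := exists_runs_flatMap (k := k) f
    (fun done τ => (∀ b, τ (acc b) = σ (acc b) +
        (done.map fun a => if dst a = b then val a else 0).sum) ∧
      ∀ r, (∀ b, r ≠ acc b) → r ∉ T → τ r = σ r) l [] σ ⟨by simp, by simp⟩ (by
    rintro pre a post rfl σ' ⟨hd, hf⟩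
    obtain ⟨τ, t1, t2, t3⟩ := h a (by simp) σ' hf
    refine ⟨τ, t1, ?_, ?_⟩
    · intro b
      rw [List.map_append, List.sum_append, ← add_assoc, ← hd b]
      by_cases e : dst a = b
      · subst e; simp [t2]
      · rw [t3 _ (fun h => e (hinj h).symm) (hT b)]
        simp [e]
    · intro r hr hrT
      rw [t3 r (hr _) hrT]
      exact hf r hr hrT)
  exact ⟨τ, h1, by simpa using h2, h3⟩

end Loops

/-! ### Fast transforms -/

/-- Butterflies for the conjugate transpose of the transform, in place; `tmp 0` is scratch. -/
noncomputable def butterfly (w : ℂ) (a b : Reg m) : Program m :=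
  [.const (.tmp 0) w, .mul (.tmp 0) (.tmp 0) b, .sub b a (.tmp 0), .add a a (.tmp 0)]

/-- Butterflies for the transform. -/
noncomputable def butterflyInv (w : ℂ) (a b : Reg m) : Program m :=
  [.sub (.tmp 0) a b, .add a a b, .const b w, .mul b b (.tmp 0)]

/-- The fast conjugate transpose of the transform (without normalization), in place. -/
noncomputable def fastStar (v : Variant) : ℕ → (ℕ → Reg m) → Program m
  | 0, _ => []
  | k + 1, r => fastStar v k r ++ (fastStar v k (fun i => r (i + 2 ^ k)) ++
      (List.range (2 ^ k)).flatMap fun j => butterfly (star (twiddle v k j)) (r j) (r (j + 2 ^ k)))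

/-- The fast transform (without normalization), in place. -/
noncomputable def fastTransform (v : Variant) : ℕ → (ℕ → Reg m) → Program m
  | 0, _ => []
  | k + 1, r =>
      ((List.range (2 ^ k)).flatMap fun j => butterflyInv (twiddle v k j) (r j) (r (j + 2 ^ k))) ++
      (fastTransform v k r ++ fastTransform v k (fun i => r (i + 2 ^ k)))

/-- The registers `r i`, `i < 2 ^ n`, are distinct, and none is the scratch register. -/
structure IsArray (n : ℕ) (r : ℕ → Reg m) : Prop where
  inj : ∀ i < 2 ^ n, ∀ j < 2 ^ n, r i = r j → i = j
  ne_tmp : ∀ i < 2 ^ n, r i ≠ .tmp 0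

theorem IsArray.lo {n : ℕ} {r : ℕ → Reg m} (h : IsArray (n + 1) r) : IsArray n r := by
  have e : 2 ^ (n + 1) = 2 ^ n + 2 ^ n := by ring
  exact ⟨fun i hi j hj => h.inj i (by omega) j (by omega), fun i hi => h.ne_tmp i (by omega)⟩

theorem IsArray.hi {n : ℕ} {r : ℕ → Reg m} (h : IsArray (n + 1) r) :
    IsArray n fun i => r (i + 2 ^ n) := by
  have e : 2 ^ (n + 1) = 2 ^ n + 2 ^ n := by ring
  exact ⟨fun i hi j hj hij => by
    have := h.inj (i + 2 ^ n) (by omega) (j + 2 ^ n) (by omega) hij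
    omega, fun i hi => h.ne_tmp _ (by omega)⟩

/-- A pass of operations on the pairs `r j`, `r (j + 2 ^ n)`. -/
theorem exists_runs_pass {n : ℕ} {r : ℕ → Reg m} (hr : IsArray (n + 1) r) (f : ℕ → Program m)
    (ga gb : ℕ → ℂ → ℂ → ℂ) (σ : Reg m → ℂ)
    (hf : ∀ j < 2 ^ n, ∀ σ' : Reg m → ℂ, ∃ τ, Runs k (f j) σ' τ ∧
      τ (r j) = ga j (σ' (r j)) (σ' (r (j + 2 ^ n))) ∧
      τ (r (j + 2 ^ n)) = gb j (σ' (r j)) (σ' (r (j + 2 ^ n))) ∧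
      ∀ s, s ≠ r j → s ≠ r (j + 2 ^ n) → s ≠ .tmp 0 → τ s = σ' s) :
    ∃ τ, Runs k ((List.range (2 ^ n)).flatMap f) σ τ ∧
      (∀ j < 2 ^ n, τ (r j) = ga j (σ (r j)) (σ (r (j + 2 ^ n)))) ∧
      (∀ j < 2 ^ n, τ (r (j + 2 ^ n)) = gb j (σ (r j)) (σ (r (j + 2 ^ n)))) ∧
      ∀ s, (∀ i < 2 ^ (n + 1), s ≠ r i) → s ≠ .tmp 0 → τ s = σ s := by
  classical
  have e2 : 2 ^ (n + 1) = 2 ^ n + 2 ^ n := by ring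
  have hne : ∀ j < 2 ^ n, r (j + 2 ^ n) ≠ r j := fun j hj e => by
    have := hr.inj _ (by omega) _ (by omega) e
    have := Nat.two_pow_pos n
    omega
  obtain ⟨τ, h1, h2, h3⟩ := exists_runs_parallel (k := k) (List.range (2 ^ n)) f
    (fun j => [r j, r (j + 2 ^ n)]) {.tmp 0}
    (fun j s => if s = r j then ga j (σ (r j)) (σ (r (j + 2 ^ n)))
      else gb j (σ (r j)) (σ (r (j + 2 ^ n)))) σ
    (by
      refine List.Pairwise.imp_of_mem ?_ List.nodup_range
      intro a b ha hb hab s hsa hsb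
      have ha := List.mem_range.1 ha
      have hb := List.mem_range.1 hb
      simp only [List.mem_cons, List.not_mem_nil, or_false] at hsa hsb
      rcases hsa with rfl | rfl <;> rcases hsb with e | e <;>
      · have := hr.inj _ (by omega) _ (by omega) e
        omega)
    (by
      intro j hj s hs
      have hj := List.mem_range.1 hj
      simp only [List.mem_cons, List.not_mem_nil, or_false] at hs
      rcases hs with rfl | rfl
      · exact hr.ne_tmp _ (by omega)
      · exact hr.ne_tmp _ (by omega))
    (by
      intro j hj σ' hD _
      have hj := List.mem_range.1 hj
      obtain ⟨τ, t1, t2, t3, t4⟩ := hf j hj σ'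
      rw [hD _ (by simp), hD _ (by simp)] at t2 t3
      refine ⟨τ, t1, ?_, ?_⟩
      · intro s hs
        simp only [List.mem_cons, List.not_mem_nil, or_false] at hs
        rcases hs with rfl | rfl
        · rw [if_pos rfl, t2]
        · rw [if_neg (hne j hj), t3]
      · intro s hs hsT
        simp only [List.mem_cons, List.not_mem_nil, or_false, not_or] at hs
        exact t4 s hs.1 hs.2 hsT)
  refine ⟨τ, h1, ?_, ?_, ?_⟩
  · intro j hj
    rw [h2 j (List.mem_range.2 hj) _ (by simp), if_pos rfl]
  · intro j hj
    rw [h2 j (List.mem_range.2 hj) _ (by simp), if_neg (hne j hj)]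
  · intro s hs hsT
    refine h3 s (fun j hj => ?_) hsT
    have hj := List.mem_range.1 hj
    simp only [List.mem_cons, List.not_mem_nil, or_false, not_or]
    exact ⟨hs _ (by omega), hs _ (by omega)⟩

/-- In the conjugate transpose of the block recursion the two halves of the input are transformed
separately and then combined with weights 1 and ±conj(t_j), so the butterflies come last. -/
theorem exists_runs_fastStar (v : Variant) : ∀ (n : ℕ) {r : ℕ → Reg m}, IsArray n r →
    ∀ σ : Reg m → ℂ, ∃ τ, Runs k (fastStar v n r) σ τ ∧
      (∀ j < 2 ^ n, τ (r j) = ∑ i ∈ range (2 ^ n), star (rawTransform v n i j) * σ (r i)) ∧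
      ∀ s, (∀ i < 2 ^ n, s ≠ r i) → s ≠ .tmp 0 → τ s = σ s
  | 0, r, _, σ => ⟨σ, rfl, by
      intro j hj
      have : j = 0 := by simpa using hj
      subst this
      simp [rawTransform_zero_left], fun _ _ _ => rfl⟩
  | n + 1, r, hr, σ => by
    have e2 : 2 ^ (n + 1) = 2 ^ n + 2 ^ n := by ring
    obtain ⟨σ₁, a1, a2, a3⟩ := exists_runs_fastStar v n hr.lo σ
    obtain ⟨σ₂, b1, b2, b3⟩ := exists_runs_fastStar v n hr.hi σ₁
    obtain ⟨τ, c1, c2, c3, c4⟩ := exists_runs_pass (k := k) hr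
      (fun j => butterfly (star (twiddle v n j)) (r j) (r (j + 2 ^ n)))
      (fun j x y => x + star (twiddle v n j) * y) (fun j x y => x - star (twiddle v n j) * y) σ₂
      (by
        intro j hj σ'
        have h1 := hr.ne_tmp j (by omega)
        have h2 := hr.ne_tmp (j + 2 ^ n) (by omega)
        have h3 : r j ≠ r (j + 2 ^ n) := fun e => by
          have := hr.inj _ (by omega) _ (by omega) e
          have := Nat.two_pow_pos n
          omega
        refine ⟨_, ⟨trivial, trivial, trivial, trivial, rfl⟩, ?_, ?_, ?_⟩
        · simp [Instr.dest, Instr.value, h1, h2, h3, h2.symm]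
        · simp [Function.update_apply, Instr.dest, Instr.value, h1, h2, h3.symm]
        · intro s s1 s2 s3
          simp [Instr.dest, s1, s2, s3])
    have hlo : ∀ j < 2 ^ n, σ₂ (r j) =
        ∑ i ∈ range (2 ^ n), star (rawTransform v n i j) * σ (r i) := fun j hj => by
      rw [b3 _ (fun i hi e => by
        have := hr.inj _ (by omega) _ (by omega) e; omega) (hr.ne_tmp _ (by omega)), a2 j hj]
    have hhi : ∀ j < 2 ^ n, σ₂ (r (j + 2 ^ n)) =
        ∑ i ∈ range (2 ^ n), star (rawTransform v n i j) * σ (r (i + 2 ^ n)) := fun j hj => by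
      rw [b2 j hj]
      refine sum_congr rfl fun i hi => ?_
      have hi := mem_range.1 hi
      rw [a3 _ (fun i' hi' e => by
        have := hr.inj _ (by omega) _ (by omega) e; omega) (hr.ne_tmp _ (by omega))]
    refine ⟨τ, a1.append (b1.append c1), ?_, ?_⟩
    · intro j hj
      rw [sum_range_two_pow_succ]
      rcases lt_or_ge j (2 ^ n) with h | h
      · rw [c2 j h, hlo j h, hhi j h, mul_sum, ← sum_add_distrib]
        refine sum_congr rfl fun i hi => ?_
        have hi := mem_range.1 hi
        rw [rawTransform_succ_lo_lo hi, rawTransform_succ_hi_lo hi h, star_mul]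
        ring
      · obtain ⟨j, rfl⟩ := Nat.exists_eq_add_of_le' h
        have h : j < 2 ^ n := by omega
        rw [c3 j h, hlo j h, hhi j h, mul_sum, ← sum_sub_distrib]
        refine sum_congr rfl fun i hi => ?_
        have hi := mem_range.1 hi
        rw [rawTransform_succ_lo_hi hi, rawTransform_succ_hi_hi hi h, star_neg, star_mul]
        ring
    · intro s hs hsT
      rw [c4 s hs hsT, b3 s (fun i hi => hs _ (by omega)) hsT,
        a3 s (fun i hi => hs _ (by omega)) hsT]

/-- Here the recursion acts on the rows: the upper half transforms x_j + x_{j+2^n}, the lower half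
t_j (x_j − x_{j+2^n}). The butterflies come first and the two half-size transforms afterwards. -/
theorem exists_runs_fastTransform (v : Variant) : ∀ (n : ℕ) {r : ℕ → Reg m}, IsArray n r →
    ∀ σ : Reg m → ℂ, ∃ τ, Runs k (fastTransform v n r) σ τ ∧
      (∀ i < 2 ^ n, τ (r i) = ∑ j ∈ range (2 ^ n), rawTransform v n i j * σ (r j)) ∧
      ∀ s, (∀ i < 2 ^ n, s ≠ r i) → s ≠ .tmp 0 → τ s = σ s
  | 0, r, _, σ => ⟨σ, rfl, by
      intro j hj
      have : j = 0 := by simpa using hj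
      subst this
      simp [rawTransform_zero_left], fun _ _ _ => rfl⟩
  | n + 1, r, hr, σ => by
    have e2 : 2 ^ (n + 1) = 2 ^ n + 2 ^ n := by ring
    obtain ⟨σ₁, c1, c2, c3, c4⟩ := exists_runs_pass (k := k) hr
      (fun j => butterflyInv (twiddle v n j) (r j) (r (j + 2 ^ n)))
      (fun j x y => x + y) (fun j x y => twiddle v n j * (x - y)) σ
      (by
        intro j hj σ'
        have h1 := hr.ne_tmp j (by omega)
        have h2 := hr.ne_tmp (j + 2 ^ n) (by omega)
        have h3 : r j ≠ r (j + 2 ^ n) := fun e => by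
          have := hr.inj _ (by omega) _ (by omega) e
          have := Nat.two_pow_pos n
          omega
        refine ⟨_, ⟨trivial, trivial, trivial, trivial, rfl⟩, ?_, ?_, ?_⟩
        · simp [Function.update_apply, Instr.dest, Instr.value, h1, h2, h3]
        · simp [Function.update_apply, Instr.dest, Instr.value, h1.symm, h2.symm]
        · intro s s1 s2 s3
          simp [Instr.dest, s1, s2, s3])
    obtain ⟨σ₂, a1, a2, a3⟩ := exists_runs_fastTransform v n hr.lo σ₁
    obtain ⟨τ, b1, b2, b3⟩ := exists_runs_fastTransform v n hr.hi σ₂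
    refine ⟨τ, c1.append (a1.append b1), ?_, ?_⟩
    · intro j hj
      rw [sum_range_two_pow_succ]
      rcases lt_or_ge j (2 ^ n) with h | h
      · rw [b3 _ (fun i hi e => by
          have := hr.inj _ (by omega) _ (by omega) e; omega) (hr.ne_tmp _ (by omega)), a2 j h]
        refine sum_congr rfl fun i hi => ?_
        have hi := mem_range.1 hi
        rw [c2 i hi, rawTransform_succ_lo_lo h, rawTransform_succ_lo_hi h]
        ring
      · obtain ⟨j, rfl⟩ := Nat.exists_eq_add_of_le' h
        have h : j < 2 ^ n := by omega
        rw [b2 j h]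
        refine sum_congr rfl fun i hi => ?_
        have hi := mem_range.1 hi
        rw [a3 _ (fun i' hi' e => by
          have := hr.inj _ (by omega) _ (by omega) e; omega) (hr.ne_tmp _ (by omega)), c3 i hi,
          rawTransform_succ_hi_lo h hi, rawTransform_succ_hi_hi h hi]
        ring
    · intro s hs hsT
      rw [b3 s (fun i hi => hs _ (by omega)) hsT, a3 s (fun i hi => hs _ (by omega)) hsT,
        c4 s hs hsT]

end FastMTGP

namespace FastMTGP
open Finset

variable {d L : ℕ} {m : Fin L → ℕ} {v : Variant}

/-! ### Indices -/

theorem idx_snd_of_lt {ℓ : Fin L} {i : ℕ} (hi : i < 2 ^ m ℓ) : ((idx m ℓ i).2 : ℕ) = i :=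
  Nat.mod_eq_of_lt hi

theorem idx_injOn {ℓ : Fin L} {i j : ℕ} (hi : i < 2 ^ m ℓ) (hj : j < 2 ^ m ℓ)
    (h : idx m ℓ i = idx m ℓ j) : i = j := by
  have h1 : (⟨ℓ, ⟨i % 2 ^ m ℓ, _⟩⟩ : Idx m) = ⟨ℓ, ⟨j % 2 ^ m ℓ, _⟩⟩ := h
  simpa [Nat.mod_eq_of_lt hi, Nat.mod_eq_of_lt hj] using h1

theorem mem_rows {ℓ : Fin L} {p : Idx m} : p ∈ rows m ℓ ↔ p.1 = ℓ := by
  constructor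
  · intro h
    obtain ⟨i, -, rfl⟩ := List.mem_map.1 h
    rfl
  · rintro rfl
    exact List.mem_map.2 ⟨p.2, List.mem_finRange _, rfl⟩

theorem nodup_rows (ℓ : Fin L) : (rows m ℓ).Nodup :=
  (List.nodup_finRange _).map fun i j h => by simpa using h

theorem isArray_of_injective {ℓ : Fin L} {F : Idx m → Reg m} (hF : Function.Injective F)
    (hT : ∀ p, F p ≠ .tmp 0) : IsArray (m ℓ) fun i => F (idx m ℓ i) :=
  ⟨fun _ hi _ hj h => idx_injOn hi hj (hF h), fun _ _ => hT _⟩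

theorem transformBlocks_mulVec (v : Variant) (y : Idx m → ℂ) (p : Idx m) :
    (transformBlocks v m).mulVec y p =
      (∑ j ∈ range (2 ^ m p.1), rawTransform v (m p.1) p.2 j * y (idx m p.1 j)) *
        (((Real.sqrt ((2 : ℝ) ^ m p.1))⁻¹ : ℝ) : ℂ) := by
  obtain ⟨ℓ, i⟩ := p
  rw [Matrix.mulVec, dotProduct, Fintype.sum_sigma, Finset.sum_eq_single ℓ]
  · rw [Finset.sum_range, sum_mul]
    refine sum_congr rfl fun j _ => ?_
    rw [show idx m ℓ j = ⟨ℓ, j⟩ from idx_self ⟨ℓ, j⟩, transformBlocks,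
      Matrix.blockDiagonal'_apply_eq, transform_apply]
    push_cast
    ring
  · intro ℓ' _ hne
    refine sum_eq_zero fun j _ => ?_
    rw [transformBlocks, Matrix.blockDiagonal'_apply_ne _ _ _ (Ne.symm hne), zero_mul]
  · simp

theorem transformBlocks_conjTranspose_mulVec (v : Variant) (y : Idx m → ℂ) (p : Idx m) :
    (transformBlocks v m).conjTranspose.mulVec y p =
      ∑ i ∈ range (2 ^ m p.1), star (rawTransform v (m p.1) i p.2) *
        (y (idx m p.1 i) * (((Real.sqrt ((2 : ℝ) ^ m p.1))⁻¹ : ℝ) : ℂ)) := by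
  obtain ⟨ℓ, j⟩ := p
  rw [Matrix.mulVec, dotProduct, Fintype.sum_sigma, Finset.sum_eq_single ℓ]
  · rw [Finset.sum_range]
    refine sum_congr rfl fun i _ => ?_
    rw [show idx m ℓ i = ⟨ℓ, i⟩ from idx_self ⟨ℓ, i⟩, Matrix.conjTranspose_apply, transformBlocks,
      Matrix.blockDiagonal'_apply_eq, transform_apply, star_div₀]
    simp only [Complex.star_def, Complex.conj_ofReal]
    push_cast
    ring
  · intro ℓ' _ hne
    refine sum_eq_zero fun j _ => ?_
    rw [Matrix.conjTranspose_apply, transformBlocks, Matrix.blockDiagonal'_apply_ne _ _ _ hne,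
      star_zero, zero_mul]
  · simp

/-! ### Evaluation of the transformed Gram matrix -/

/-- Evaluation of a block: the first column of the Gram matrix is transformed in place. -/
noncomputable def evalBlock (v : Variant) (m : Fin L → ℕ) (ℓ ℓ' : Fin L) : Program m :=
  ((List.range (2 ^ m ℓ)).map fun i =>
    .kern (.lam (idx m ℓ i) (idx m ℓ' i)) (idx m ℓ i) (idx m ℓ' 0)) ++
  ((if ℓ = ℓ' then [.add (.lam (idx m ℓ 0) (idx m ℓ' 0)) (.lam (idx m ℓ 0) (idx m ℓ' 0))
    (.noise ℓ)] else []) ++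
  (fastStar v (m ℓ) (fun i => .lam (idx m ℓ i) (idx m ℓ' i)) ++
  ([.const (.tmp 0) (((Real.sqrt ((2 : ℝ) ^ m ℓ') : ℝ) : ℂ) /
    ((Real.sqrt ((2 : ℝ) ^ m ℓ) : ℝ) : ℂ))] ++
  (List.range (2 ^ m ℓ)).map fun i =>
    .mul (.lam (idx m ℓ i) (idx m ℓ' i)) (.tmp 0) (.lam (idx m ℓ i) (idx m ℓ' i)))))

/-- Evaluation of the stored entries of the transformed Gram matrix. -/
noncomputable def evalLam (v : Variant) (m : Fin L → ℕ) : Program m :=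
  (univ.filter fun a : Fin L × Fin L => a.1 ≤ a.2).toList.flatMap fun a => evalBlock v m a.1 a.2

theorem isArray_lam (ℓ ℓ' : Fin L) :
    IsArray (m ℓ) fun i => (.lam (idx m ℓ i) (idx m ℓ' i) : Reg m) :=
  ⟨fun _ hi _ hj h => idx_injOn hi hj (Reg.lam.inj h).1, fun _ _ => by simp⟩

theorem nodup_map_range {n : ℕ} {r : ℕ → Reg m} (hr : IsArray n r) :
    ((List.range (2 ^ n)).map r).Nodup :=
  List.Nodup.map_on (fun i hi j hj h => hr.inj i (List.mem_range.1 hi) j (List.mem_range.1 hj) h)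
    List.nodup_range

/-- Row i of a block has one stored entry, in column i mod n_ℓ' (`idx` reduces i). Its n_ℓ registers
can thus hold the first Gram column and be overwritten by its transform, without extra memory. -/
theorem Problem.IsFast.exists_runs_evalBlock {P : Problem d m} (h : P.IsFast v) {ℓ ℓ' : Fin L}
    (hm : m ℓ' ≤ m ℓ) (σ : Reg m → ℂ) (hσ : σ (.noise ℓ) = ((P.ξ ℓ : ℝ) : ℂ)) :
    ∃ τ, Runs (fun p q => ((P.kernelAt p q : ℝ) : ℂ)) (evalBlock v m ℓ ℓ') σ τ ∧
      (∀ i < 2 ^ m ℓ, τ (.lam (idx m ℓ i) (idx m ℓ' i)) = P.lam v (idx m ℓ i) (idx m ℓ' i)) ∧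
      ∀ s, (∀ i < 2 ^ m ℓ, s ≠ .lam (idx m ℓ i) (idx m ℓ' i)) → s ≠ .tmp 0 → τ s = σ s := by
  classical
  have harr := isArray_lam (m := m) ℓ ℓ'
  obtain ⟨σ₁, a1, a2, a3⟩ := exists_runs_map (k := fun p q => ((P.kernelAt p q : ℝ) : ℂ))
    (List.range (2 ^ m ℓ))
    (fun i => .kern (.lam (idx m ℓ i) (idx m ℓ' i)) (idx m ℓ i) (idx m ℓ' 0))
    (fun i => .lam (idx m ℓ i) (idx m ℓ' i))
    (fun i => ((P.kernelAt (idx m ℓ i) (idx m ℓ' 0) : ℝ) : ℂ)) σ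
    (nodup_map_range harr) (fun _ => rfl) (fun _ _ _ _ _ => ⟨trivial, rfl⟩)
  simp only [List.mem_range] at a2 a3
  obtain ⟨σ₂, b1, b2, b3⟩ : ∃ σ₂, Runs (fun p q => ((P.kernelAt p q : ℝ) : ℂ))
      (if ℓ = ℓ' then [.add (.lam (idx m ℓ 0) (idx m ℓ' 0)) (.lam (idx m ℓ 0) (idx m ℓ' 0))
        (.noise ℓ)] else []) σ₁ σ₂ ∧
      (∀ i < 2 ^ m ℓ, σ₂ (.lam (idx m ℓ i) (idx m ℓ' i)) =
        P.gramC (idx m ℓ i) (idx m ℓ' 0)) ∧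
      ∀ s, (∀ i < 2 ^ m ℓ, s ≠ .lam (idx m ℓ i) (idx m ℓ' i)) → σ₂ s = σ₁ s := by
    -- In the first column, the noise enters only at i = 0, and only in a diagonal block.
    by_cases hl : ℓ = ℓ'
    · subst hl
      rw [if_pos rfl]
      refine ⟨_, ⟨trivial, rfl⟩, ?_, ?_⟩
      · intro i hi
        simp only [Problem.gramC, Problem.gram, Matrix.map_apply, Matrix.of_apply, Instr.dest,
          Instr.value]
        by_cases h0 : i = 0
        · subst h0
          rw [Function.update_self, a2 _ hi, a3 _ (by simp), hσ]
          simp [idx]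
        · have hne : idx m ℓ i ≠ idx m ℓ 0 := fun e =>
            h0 (idx_injOn hi (Nat.two_pow_pos _) e)
          rw [Function.update_of_ne (by simp [hne]), a2 _ hi, if_neg hne, add_zero]
      · intro s hs
        exact Function.update_of_ne (hs 0 (Nat.two_pow_pos _)) _ _
    · rw [if_neg hl]
      refine ⟨_, rfl, ?_, fun _ _ => rfl⟩
      intro i hi
      rw [a2 _ hi]
      simp only [Problem.gramC, Problem.gram, Matrix.map_apply, Matrix.of_apply]
      rw [if_neg (fun e => hl (congrArg Sigma.fst e)), add_zero]
  obtain ⟨σ₃, c1, c2, c3⟩ := exists_runs_fastStar (k := fun p q => ((P.kernelAt p q : ℝ) : ℂ)) v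
    (m ℓ) harr σ₂
  let c : ℂ := ((Real.sqrt ((2 : ℝ) ^ m ℓ') : ℝ) : ℂ) / ((Real.sqrt ((2 : ℝ) ^ m ℓ) : ℝ) : ℂ)
  obtain ⟨τ, d1, d2, d3⟩ := exists_runs_map (k := fun p q => ((P.kernelAt p q : ℝ) : ℂ))
    (List.range (2 ^ m ℓ))
    (fun i => .mul (.lam (idx m ℓ i) (idx m ℓ' i)) (.tmp 0) (.lam (idx m ℓ i) (idx m ℓ' i)))
    (fun i => .lam (idx m ℓ i) (idx m ℓ' i))
    (fun i => c * σ₃ (.lam (idx m ℓ i) (idx m ℓ' i)))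
    (Function.update σ₃ (.tmp 0) c)
    (nodup_map_range harr) (fun _ => rfl) (fun i _ σ' e1 e2 => ⟨trivial, by
      simp only [Instr.value]
      rw [e1, e2 _ (by simp), Function.update_self, Function.update_of_ne (by simp)]⟩)
  simp only [List.mem_range] at d2 d3
  refine ⟨τ, a1.append (b1.append (c1.append (Runs.append ⟨trivial, rfl⟩ d1))), ?_, ?_⟩
  · intro i hi
    rw [d2 i hi, c2 i hi, h.lam_eq (p := idx m ℓ i) (q := idx m ℓ' i) hm, if_pos]
    · congr 1
      refine sum_congr rfl fun j hj => ?_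
      rw [b2 j (mem_range.1 hj), idx_snd_of_lt hi]
      rfl
    · simp only [idx, Nat.mod_eq_of_lt hi]
  · intro s hs hsT
    rw [d3 s hs, Function.update_of_ne hsT, c3 s hs hsT, b3 s hs, a3 s hs]

theorem Problem.IsFast.exists_runs_evalLam {P : Problem d m} (h : P.IsFast v) (hm : Antitone m)
    (σ : Reg m → ℂ) (hσ : ∀ ℓ, σ (.noise ℓ) = ((P.ξ ℓ : ℝ) : ℂ)) :
    ∃ τ, Runs (fun p q => ((P.kernelAt p q : ℝ) : ℂ)) (evalLam v m) σ τ ∧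
      ∀ p q, Stored p q → τ (.lam p q) = P.lam v p q := by
  obtain ⟨τ, h1, h2, -⟩ := exists_runs_parallel (k := fun p q => ((P.kernelAt p q : ℝ) : ℂ))
    (univ.filter fun a : Fin L × Fin L => a.1 ≤ a.2).toList (fun a => evalBlock v m a.1 a.2)
    (fun a => (List.range (2 ^ m a.1)).map fun i => .lam (idx m a.1 i) (idx m a.2 i)) {.tmp 0}
    -- The target value can be read off the register; the value 0 for the other registers is never
    -- used.
    (fun _ r => match r with
      | .lam p q => P.lam v p q
      | _ => 0) σ
    (by
      refine List.Pairwise.imp_of_mem ?_ (Finset.nodup_toList _)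
      intro a b _ _ hab s hsa hsb
      obtain ⟨i, -, rfl⟩ := List.mem_map.1 hsa
      obtain ⟨j, -, e⟩ := List.mem_map.1 hsb
      obtain ⟨e1, e2⟩ := Reg.lam.inj e
      exact hab (Prod.ext (congrArg Sigma.fst e1).symm (congrArg Sigma.fst e2).symm))
    (by
      intro a _ s hs
      obtain ⟨i, -, rfl⟩ := List.mem_map.1 hs
      simp)
    (by
      intro a ha σ' _ h2
      have ha : a.1 ≤ a.2 := by simpa using ha
      obtain ⟨τ, t1, t2, t3⟩ := h.exists_runs_evalBlock (hm ha) σ' (by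
        rw [h2 _ (by simp) (by simp), hσ])
      refine ⟨τ, t1, ?_, ?_⟩
      · intro s hs
        obtain ⟨i, hi, rfl⟩ := List.mem_map.1 hs
        exact t2 i (List.mem_range.1 hi)
      · intro s hs hsT
        refine t3 s (fun i hi e => hs ?_) hsT
        exact List.mem_map.2 ⟨i, List.mem_range.2 hi, e.symm⟩)
  refine ⟨τ, h1, fun p q hpq => ?_⟩
  have := h2 (p.1, q.1) (by simpa using hpq.1) (.lam p q) (List.mem_map.2
    ⟨p.2, List.mem_range.2 p.2.isLt, by
      have e2 : idx m q.1 p.2 = q := hpq.2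
      rw [idx_self, e2]⟩)
  exact this

/-! ### Products with the Gram matrix and its inverse -/

/-- Multiplication by `V M Vᴴ`, given a program `mid` that multiplies by `M`. -/
noncomputable def sandwich (v : Variant) (m : Fin L → ℕ) (mid : Program m) : Program m :=
  ((List.finRange L).flatMap fun ℓ =>
    [.const (.tmp 0) (((Real.sqrt ((2 : ℝ) ^ m ℓ))⁻¹ : ℝ) : ℂ)] ++
    (((rows m ℓ).map fun p => .mul (.matB p) (.vec p) (.tmp 0)) ++
    (fastStar v (m ℓ) (fun i => .matB (idx m ℓ i)) ++
    ((rows m ℓ).map fun p => .const (.matL p) 0)))) ++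
  (mid ++
  (List.finRange L).flatMap fun ℓ =>
    fastTransform v (m ℓ) (fun i => .matL (idx m ℓ i)) ++
    ([.const (.tmp 0) (((Real.sqrt ((2 : ℝ) ^ m ℓ))⁻¹ : ℝ) : ℂ)] ++
    ((rows m ℓ).map fun p => .mul (.out p) (.matL p) (.tmp 0))))

variable {k : Idx m → Idx m → ℂ}

theorem nodup_map_rows {F : Idx m → Reg m} (hF : Function.Injective F) (ℓ : Fin L) :
    ((rows m ℓ).map F).Nodup := (nodup_rows ℓ).map hF

theorem exists_runs_sandwich_fst (v : Variant) (σ : Reg m → ℂ) :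
    ∃ τ, Runs k ((List.finRange L).flatMap fun ℓ =>
      [.const (.tmp 0) (((Real.sqrt ((2 : ℝ) ^ m ℓ))⁻¹ : ℝ) : ℂ)] ++
      (((rows m ℓ).map fun p => .mul (.matB p) (.vec p) (.tmp 0)) ++
      (fastStar v (m ℓ) (fun i => .matB (idx m ℓ i)) ++
      ((rows m ℓ).map fun p => .const (.matL p) 0)))) σ τ ∧
      (∀ p, τ (.matB p) =
        (transformBlocks v m).conjTranspose.mulVec (fun q => σ (.vec q)) p ∧ τ (.matL p) = 0) ∧
      ∀ s, (∀ p, s ≠ .matB p) → (∀ p, s ≠ .matL p) → s ≠ .tmp 0 → τ s = σ s := by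
  classical
  have injB : Function.Injective (Reg.matB : Idx m → Reg m) := fun _ _ => Reg.matB.inj
  have injL : Function.Injective (Reg.matL : Idx m → Reg m) := fun _ _ => Reg.matL.inj
  obtain ⟨τ, h1, h2, h3⟩ := exists_runs_parallel (k := k) (List.finRange L)
    (fun ℓ => [.const (.tmp 0) (((Real.sqrt ((2 : ℝ) ^ m ℓ))⁻¹ : ℝ) : ℂ)] ++
      (((rows m ℓ).map fun p => .mul (.matB p) (.vec p) (.tmp 0)) ++
      (fastStar v (m ℓ) (fun i => .matB (idx m ℓ i)) ++
      ((rows m ℓ).map fun p => .const (.matL p) 0))))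
    (fun ℓ => (rows m ℓ).map .matB ++ (rows m ℓ).map .matL) {.tmp 0}
    (fun _ r => match r with
      | .matB p => (transformBlocks v m).conjTranspose.mulVec (fun q => σ (.vec q)) p
      | _ => 0) σ
    (by
      refine List.Pairwise.imp_of_mem ?_ (List.nodup_finRange L)
      intro ℓ ℓ' _ _ hne s hs hs'
      simp only [List.mem_append, List.mem_map, mem_rows] at hs hs'
      rcases hs with ⟨p, rfl, rfl⟩ | ⟨p, rfl, rfl⟩ <;> rcases hs' with ⟨q, rfl, e⟩ | ⟨q, rfl, e⟩
      · exact hne (by rw [Reg.matB.inj e])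
      · simp at e
      · simp at e
      · exact hne (by rw [Reg.matL.inj e]))
    (by
      intro ℓ _ s hs
      simp only [List.mem_append, List.mem_map, mem_rows] at hs
      rcases hs with ⟨p, rfl, rfl⟩ | ⟨p, rfl, rfl⟩ <;> simp)
    (by
      intro ℓ _ σ' _ hf
      let c : ℂ := (((Real.sqrt ((2 : ℝ) ^ m ℓ))⁻¹ : ℝ) : ℂ)
      obtain ⟨σ₁, a1, a2, a3⟩ := exists_runs_map (k := k) (rows m ℓ)
        (fun p => .mul (.matB p) (.vec p) (.tmp 0)) .matB (fun p => σ (.vec p) * c)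
        (Function.update σ' (.tmp 0) c) (nodup_map_rows injB ℓ) (fun _ => rfl)
        (fun p _ σ'' _ e2 => ⟨trivial, by
          simp only [Instr.value]
          rw [e2 _ (by simp), e2 _ (by simp), Function.update_self,
            Function.update_of_ne (by simp), hf _ (by simp) (by simp)]⟩)
      obtain ⟨σ₂, b1, b2, b3⟩ := exists_runs_fastStar (k := k) v (m ℓ)
        (isArray_of_injective (ℓ := ℓ) injB (by simp)) σ₁
      obtain ⟨τ, c1, c2, c3⟩ := exists_runs_map (k := k) (rows m ℓ)
        (fun p => .const (.matL p) 0) .matL (fun p => 0) σ₂ (nodup_map_rows injL ℓ) (fun _ => rfl)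
        (fun p _ σ'' _ e2 => ⟨trivial, rfl⟩)
      refine ⟨τ, Runs.append ⟨trivial, rfl⟩ (a1.append (b1.append c1)), ?_, ?_⟩
      · intro s hs
        simp only [List.mem_append, List.mem_map] at hs
        rcases hs with ⟨p, hp, rfl⟩ | ⟨p, hp, rfl⟩
        · have hp' := mem_rows.1 hp
          subst hp'
          rw [c3 _ (by simp)]
          have := b2 p.2 p.2.isLt
          rw [idx_self] at this
          rw [this]
          refine Eq.trans ?_ (transformBlocks_conjTranspose_mulVec v _ p).symm
          refine sum_congr rfl fun i _ => ?_
          rw [a2 (idx m p.1 i) (mem_rows.2 rfl)]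
        · exact c2 p hp
      · intro s hs hsT
        simp only [List.mem_append, List.mem_map, not_or, not_exists, not_and] at hs
        rw [c3 s (fun p hp e => hs.2 p hp e.symm),
          b3 s (fun i _ e => hs.1 _ (mem_rows.2 rfl) e.symm) hsT,
          a3 s (fun p hp e => hs.1 p hp e.symm), Function.update_of_ne hsT])
  refine ⟨τ, h1, fun p => ⟨?_, ?_⟩, ?_⟩
  · exact h2 p.1 (List.mem_finRange _) (.matB p) (by simp [mem_rows])
  · exact h2 p.1 (List.mem_finRange _) (.matL p) (by simp [mem_rows])
  · intro s s1 s2 s3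
    refine h3 s (fun ℓ _ hs => ?_) s3
    simp only [List.mem_append, List.mem_map] at hs
    rcases hs with ⟨p, -, rfl⟩ | ⟨p, -, rfl⟩
    · exact s1 p rfl
    · exact s2 p rfl

theorem exists_runs_sandwich_snd (v : Variant) (σ : Reg m → ℂ) :
    ∃ τ, Runs k ((List.finRange L).flatMap fun ℓ =>
      fastTransform v (m ℓ) (fun i => .matL (idx m ℓ i)) ++
      ([.const (.tmp 0) (((Real.sqrt ((2 : ℝ) ^ m ℓ))⁻¹ : ℝ) : ℂ)] ++
      ((rows m ℓ).map fun p => .mul (.out p) (.matL p) (.tmp 0)))) σ τ ∧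
      ∀ p, τ (.out p) = (transformBlocks v m).mulVec (fun q => σ (.matL q)) p := by
  classical
  have injO : Function.Injective (Reg.out : Idx m → Reg m) := fun _ _ => Reg.out.inj
  have injL : Function.Injective (Reg.matL : Idx m → Reg m) := fun _ _ => Reg.matL.inj
  obtain ⟨τ, h1, h2⟩ := exists_runs_flatMap (k := k)
    (fun ℓ => fastTransform v (m ℓ) (fun i => .matL (idx m ℓ i)) ++
      ([.const (.tmp 0) (((Real.sqrt ((2 : ℝ) ^ m ℓ))⁻¹ : ℝ) : ℂ)] ++
      ((rows m ℓ).map fun p => .mul (.out p) (.matL p) (.tmp 0))))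
    -- The transform overwrites `matL`, so the invariant keeps the input only for the tasks not yet
    -- treated.
    (fun done τ => (∀ p : Idx m, p.1 ∈ done →
        τ (.out p) = (transformBlocks v m).mulVec (fun q => σ (.matL q)) p) ∧
      ∀ p : Idx m, p.1 ∉ done → τ (.matL p) = σ (.matL p))
    (List.finRange L) [] σ ⟨by simp, by simp⟩ (by
      rintro pre ℓ post e σ' ⟨hd, hf⟩
      rw [List.nil_append] at hd hf ⊢
      have hnd := List.nodup_finRange L
      rw [e, List.nodup_append] at hnd
      have hℓ : ℓ ∉ pre := fun h => hnd.2.2 ℓ h ℓ (by simp) rfl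
      let c : ℂ := (((Real.sqrt ((2 : ℝ) ^ m ℓ))⁻¹ : ℝ) : ℂ)
      obtain ⟨σ₁, b1, b2, b3⟩ := exists_runs_fastTransform (k := k) v (m ℓ)
        (isArray_of_injective (ℓ := ℓ) injL (by simp)) σ'
      obtain ⟨τ, a1, a2, a3⟩ := exists_runs_map (k := k) (rows m ℓ)
        (fun p => .mul (.out p) (.matL p) (.tmp 0)) .out (fun p => σ₁ (.matL p) * c)
        (Function.update σ₁ (.tmp 0) c) (nodup_map_rows injO ℓ) (fun _ => rfl)
        (fun p _ σ'' _ e2 => ⟨trivial, by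
          simp only [Instr.value]
          rw [e2 _ (by simp), e2 _ (by simp), Function.update_self,
            Function.update_of_ne (by simp)]⟩)
      refine ⟨τ, b1.append (Runs.append ⟨trivial, rfl⟩ a1), ?_, ?_⟩
      · intro p hp
        by_cases hpl : p.1 = ℓ
        · subst hpl
          rw [a2 p (mem_rows.2 rfl), transformBlocks_mulVec]
          have := b2 p.2 p.2.isLt
          rw [idx_self] at this
          rw [this]
          congr 1
          refine sum_congr rfl fun i _ => ?_
          rw [hf (idx m p.1 i) hℓ]
        · have hp : p.1 ∈ pre := by simpa [hpl] using hp
          rw [a3 _ (fun q hq e => hpl (by rw [Reg.out.inj e, mem_rows.1 hq])),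
            Function.update_of_ne (by simp), b3 _ (by simp) (by simp), hd p hp]
      · intro p hp
        simp only [List.mem_append, List.mem_singleton, not_or] at hp
        rw [a3 _ (by simp), Function.update_of_ne (by simp), b3 _ (fun i _ e => hp.2 (by
          rw [Reg.matL.inj e]; rfl)) (by simp), hf p hp.1])
  exact ⟨τ, h1, fun p => h2.1 p (by simp)⟩

/-- The middle program is required to work from every memory that has the original `lam` and `matA`
and zeros in `matL`; one frame therefore serves both the Gram matrix and its inverse. -/
theorem exists_runs_sandwich {v : Variant} {mid : Program m} {σ : Reg m → ℂ}
    {M : Matrix (Idx m) (Idx m) ℂ}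
    (hmid : ∀ σ' : Reg m → ℂ, (∀ p q, σ' (.lam p q) = σ (.lam p q)) →
      (∀ p q, σ' (.matA p q) = σ (.matA p q)) → (∀ p, σ' (.matL p) = 0) →
      ∃ τ, Runs k mid σ' τ ∧ ∀ p, τ (.matL p) = M.mulVec (fun q => σ' (.matB q)) p) :
    ∃ τ, Runs k (sandwich v m mid) σ τ ∧ ∀ p, τ (.out p) =
      (transformBlocks v m * M * (transformBlocks v m).conjTranspose).mulVec
        (fun q => σ (.vec q)) p := by
  obtain ⟨σ₁, a1, a2, a3⟩ := exists_runs_sandwich_fst (k := k) v σ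
  obtain ⟨σ₂, b1, b2⟩ := hmid σ₁ (fun p q => a3 _ (by simp) (by simp) (by simp))
    (fun p q => a3 _ (by simp) (by simp) (by simp)) (fun p => (a2 p).2)
  obtain ⟨τ, c1, c2⟩ := exists_runs_sandwich_snd (k := k) v σ₂
  refine ⟨τ, a1.append (b1.append c1), fun p => ?_⟩
  rw [c2, ← Matrix.mulVec_mulVec, ← Matrix.mulVec_mulVec]
  congr 2
  funext q
  rw [b2]
  congr 2
  funext q
  exact (a2 q).1

/-- Multiplication by the transformed Gram matrix: a pass over the stored entries for the upper
block triangle, and another one for the strictly lower block triangle. -/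
noncomputable def mulLam (m : Fin L → ℕ) : Program m :=
  ((univ.filter fun a : Idx m × Fin L => a.1.1 ≤ a.2).toList.flatMap fun a =>
    [.mul (.tmp 0) (.lam a.1 (proj a.2 a.1)) (.matB (proj a.2 a.1)),
      .add (.matL a.1) (.matL a.1) (.tmp 0)]) ++
  ((univ.filter fun a : Idx m × Fin L => a.1.1 < a.2).toList.flatMap fun a =>
    [.conj (.tmp 0) (.lam a.1 (proj a.2 a.1)), .mul (.tmp 0) (.tmp 0) (.matB a.1),
      .add (.matL (proj a.2 a.1)) (.matL (proj a.2 a.1)) (.tmp 0)])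

/-- Multiplication by the matrix in the registers `matA`. -/
noncomputable def mulMatA (m : Fin L → ℕ) (e : Fin L) : Program m :=
  (univ.filter fun a : Idx m × Idx m => OnDiag e a.1 a.2).toList.flatMap fun a =>
    [.mul (.tmp 0) (.matA a.1 a.2) (.matB a.2), .add (.matL a.1) (.matL a.1) (.tmp 0)]

theorem exists_runs_mulMatA {e : Fin L} {σ : Reg m → ℂ} {M : Matrix (Idx m) (Idx m) ℂ}
    (hM : ∀ p q, ¬ OnDiag e p q → M p q = 0)
    (hσ : ∀ p q, OnDiag e p q → σ (.matA p q) = M p q) (h0 : ∀ p, σ (.matL p) = 0) :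
    ∃ τ, Runs k (mulMatA m e) σ τ ∧ ∀ p, τ (.matL p) = M.mulVec (fun q => σ (.matB q)) p := by
  classical
  obtain ⟨τ, h1, h2, -⟩ := exists_runs_accumulate (k := k)
    (univ.filter fun a : Idx m × Idx m => OnDiag e a.1 a.2).toList
    (fun a => [.mul (.tmp 0) (.matA a.1 a.2) (.matB a.2), .add (.matL a.1) (.matL a.1) (.tmp 0)])
    .matL (fun a => a.1) {.tmp 0} (fun a => M a.1 a.2 * σ (.matB a.2)) σ
    (fun _ _ => Reg.matL.inj) (by simp) (by
      intro a ha σ' hf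
      have ha : OnDiag e a.1 a.2 := by simpa using ha
      refine ⟨_, ⟨trivial, trivial, rfl⟩, ?_, ?_⟩
      · simp [Instr.dest, Instr.value, hf, hσ _ _ ha]
      · intro s h1 h2
        have h2 : s ≠ .tmp 0 := h2
        simp [Instr.dest, h1, h2])
  refine ⟨τ, h1, fun p => ?_⟩
  rw [h2, h0, zero_add, Finset.sum_map_toList, Finset.sum_filter, ← univ_product_univ, sum_product,
    sum_eq_single p]
  · refine sum_congr rfl fun q _ => ?_
    by_cases h : OnDiag e p q
    · simp [h]
    · simp [h, hM p q h]
  · intro q _ hq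
    simp [hq]
  · simp

theorem exists_runs_mulLam {σ : Reg m → ℂ} {M : Matrix (Idx m) (Idx m) ℂ} (hH : M.IsHermitian)
    (hM : ∀ p q : Idx m, p.1 ≤ q.1 → ¬ Stored p q → M p q = 0)
    (hσ : ∀ p q, Stored p q → σ (.lam p q) = M p q) (h0 : ∀ p, σ (.matL p) = 0) :
    ∃ τ, Runs k (mulLam m) σ τ ∧ ∀ p, τ (.matL p) = M.mulVec (fun q => σ (.matB q)) p := by
  classical
  have hst : ∀ (p : Idx m) (ℓ : Fin L), p.1 ≤ ℓ → Stored p (proj ℓ p) := fun p ℓ h => ⟨h, rfl⟩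
  obtain ⟨σ₁, h1, h2, h3⟩ := exists_runs_accumulate (k := k)
    (univ.filter fun a : Idx m × Fin L => a.1.1 ≤ a.2).toList
    (fun a => [.mul (.tmp 0) (.lam a.1 (proj a.2 a.1)) (.matB (proj a.2 a.1)),
      .add (.matL a.1) (.matL a.1) (.tmp 0)])
    .matL (fun a => a.1) {.tmp 0}
    (fun a => M a.1 (proj a.2 a.1) * σ (.matB (proj a.2 a.1))) σ
    (fun _ _ => Reg.matL.inj) (by simp) (by
      intro a ha σ' hf
      have ha : a.1.1 ≤ a.2 := by simpa using ha
      refine ⟨_, ⟨trivial, trivial, rfl⟩, ?_, ?_⟩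
      · simp [Instr.dest, Instr.value, hf, hσ _ _ (hst _ _ ha)]
      · intro s h1 h2
        have h2 : s ≠ .tmp 0 := h2
        simp [Instr.dest, h1, h2])
  obtain ⟨τ, g1, g2, -⟩ := exists_runs_accumulate (k := k)
    (univ.filter fun a : Idx m × Fin L => a.1.1 < a.2).toList
    (fun a => [.conj (.tmp 0) (.lam a.1 (proj a.2 a.1)), .mul (.tmp 0) (.tmp 0) (.matB a.1),
      .add (.matL (proj a.2 a.1)) (.matL (proj a.2 a.1)) (.tmp 0)])
    .matL (fun a => proj a.2 a.1) {.tmp 0}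
    (fun a => star (M a.1 (proj a.2 a.1)) * σ (.matB a.1)) σ₁
    (fun _ _ => Reg.matL.inj) (by simp) (by
      intro a ha σ' hf
      have ha : a.1.1 < a.2 := by simpa using ha
      refine ⟨_, ⟨trivial, trivial, trivial, rfl⟩, ?_, ?_⟩
      · simp [Instr.dest, Instr.value, hf, h3, hσ _ _ (hst _ _ ha.le)]
      · intro s h1 h2
        have h2 : s ≠ .tmp 0 := h2
        simp [Instr.dest, h1, h2])
  refine ⟨τ, h1.append g1, fun p => ?_⟩
  rw [g2, h2, h0, zero_add, Finset.sum_map_toList, Finset.sum_map_toList, Finset.sum_filter,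
    Finset.sum_filter, ← univ_product_univ, sum_product, sum_product]
  -- The first pass gives the part of row p in its own block and the blocks to the right: by
  -- sparsity one entry per task ℓ, at `proj ℓ p`.
  have e1 : ∑ q : Idx m, ∑ ℓ : Fin L, (if (q, ℓ).1.1 ≤ (q, ℓ).2 then if (q, ℓ).1 = p then
      M (q, ℓ).1 (proj (q, ℓ).2 (q, ℓ).1) * σ (.matB (proj (q, ℓ).2 (q, ℓ).1)) else 0 else 0) =
      ∑ q : Idx m, if p.1 ≤ q.1 then M p q * σ (.matB q) else 0 := by
    rw [sum_eq_single p (fun q _ hq => by simp [hq]) (by simp), Fintype.sum_sigma]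
    refine sum_congr rfl fun ℓ _ => ?_
    by_cases hl : p.1 ≤ ℓ
    · simp only [hl, if_true]
      refine ((sum_eq_single (proj ℓ p).2 ?_ ?_).trans ?_).symm
      · intro i _ hi
        rw [hM p ⟨ℓ, i⟩ hl, zero_mul]
        rintro ⟨-, e⟩
        apply hi
        have e : (⟨ℓ, (proj ℓ p).2⟩ : Idx m) = ⟨ℓ, i⟩ := e
        exact (eq_of_heq (Sigma.mk.inj e).2).symm
      · exact fun h => absurd (mem_univ _) h
      · rfl
    · simp [hl]
  -- The second pass supplies the blocks to the left, as conjugates of stored entries; the strict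
  -- inequality keeps diagonal blocks from being counted twice.
  have e2 : ∑ q : Idx m, ∑ ℓ : Fin L, (if (q, ℓ).1.1 < (q, ℓ).2 then
      if proj (q, ℓ).2 (q, ℓ).1 = p then
      star (M (q, ℓ).1 (proj (q, ℓ).2 (q, ℓ).1)) * σ (.matB (q, ℓ).1) else 0 else 0) =
      ∑ q : Idx m, if p.1 ≤ q.1 then 0 else M p q * σ (.matB q) := by
    refine sum_congr rfl fun q _ => ?_
    rw [sum_eq_single p.1]
    · by_cases hq : q.1 < p.1
      · simp only [hq, if_true, if_neg (not_le.2 hq)]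
        split_ifs with hp
        · rw [hp, hH.apply]
        · rw [← hH.apply, hM q p hq.le (fun h => hp h.2)]; simp
      · simp [hq, not_lt.1 hq]
    · intro ℓ _ hl
      split_ifs with a b
      · exact absurd (congrArg Sigma.fst b) hl
      · rfl
      · rfl
    · simp
  rw [e1, e2, ← sum_add_distrib]
  refine sum_congr rfl fun q _ => ?_
  split_ifs <;> simp

end FastMTGP

namespace FastMTGP
open Finset

variable {L : ℕ} {m : Fin L → ℕ} {k : Idx m → Idx m → ℂ}

/-! ### Index lists -/

theorem mem_before {ℓ : Fin L} {p : Idx m} : p ∈ before m ℓ ↔ p.1 < ℓ := by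
  simp [before, mem_rows]

theorem nodup_before (ℓ : Fin L) : (before m ℓ).Nodup := by
  refine List.nodup_flatMap.2 ⟨fun ℓ' _ => nodup_rows ℓ', ?_⟩
  refine ((List.nodup_finRange L).filter _).imp fun hne p hp hp' => hne ?_
  rw [← mem_rows.1 hp, ← mem_rows.1 hp']

theorem mem_pairs {ℓ e : Fin L} {a : Idx m × Idx m} :
    a ∈ pairs m ℓ e ↔ a.1.1 < ℓ ∧ a.2.1 < ℓ ∧ OnDiag e a.1 a.2 := by
  obtain ⟨p, q⟩ := a
  simp [pairs, mem_before]

theorem nodup_pairs (ℓ e : Fin L) : (pairs m ℓ e).Nodup := by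
  refine List.nodup_flatMap.2 ⟨fun p _ => ((nodup_before ℓ).filter _).map fun q q' h => by
    simpa using h, ?_⟩
  refine (nodup_before ℓ).imp fun hne a ha ha' => hne ?_
  obtain ⟨q, -, rfl⟩ := List.mem_map.1 ha
  obtain ⟨q', -, e⟩ := List.mem_map.1 ha'
  exact (congrArg Prod.fst e).symm

theorem sum_map_of_nodup {α : Type*} [Fintype α] [DecidableEq α] {l : List α} (hl : l.Nodup)
    {c : α → Prop} [DecidablePred c] (hc : ∀ a, a ∈ l ↔ c a) (f : α → ℂ) :
    (l.map f).sum = ∑ a with c a, f a := by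
  rw [← List.sum_toFinset f hl]
  exact sum_congr (by ext a; simp [hc]) fun _ _ => rfl

/-! ### The stages of the inversion algorithm -/

/-- The nonzero entry of row `p` of the matrix `L` of stage `ℓ`. -/
noncomputable def stageL (M A : Idx m → Idx m → ℂ) (ℓ : Fin L) (p : Idx m) : ℂ :=
  ∑ q with q.1 < ℓ ∧ OnDiag (prev ℓ) p q, A p q * M q (proj ℓ q)

/-- The diagonal of the Schur complement of stage `ℓ`. -/
noncomputable def stageS (M A : Idx m → Idx m → ℂ) (ℓ : Fin L) (r : Idx m) : ℂ :=
  M r r - ∑ p with p.1 < ℓ ∧ proj ℓ p = r, star (M p (proj ℓ p)) * stageL M A ℓ p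

/-- The nonzero entry of row `p` of the matrix `H` of stage `ℓ`. -/
noncomputable def stageH (M A : Idx m → Idx m → ℂ) (ℓ : Fin L) (p : Idx m) : ℂ :=
  stageL M A ℓ p * (1 / stageS M A ℓ (proj ℓ p))

/-- The first part of `stage`, which computes the Schur complement. -/
noncomputable def stageFst (m : Fin L → ℕ) (ℓ : Fin L) : Program m :=
  ((rows m ℓ).map fun r => .copy (.matD r) (.lam r r)) ++
  (((before m ℓ).map fun p => .copy (.matB p) (.lam p (proj ℓ p))) ++
  (((before m ℓ).map fun p => .const (.matL p) 0) ++
  (((pairs m ℓ (prev ℓ)).flatMap fun pq =>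
    [.mul (.tmp 0) (.matA pq.1 pq.2) (.matB pq.2), .add (.matL pq.1) (.matL pq.1) (.tmp 0)]) ++
  (((rows m ℓ).map fun r => .const (.matF r) 0) ++
  (((before m ℓ).flatMap fun p =>
    [.conj (.tmp 0) (.matB p), .mul (.tmp 0) (.tmp 0) (.matL p),
      .add (.matF (proj ℓ p)) (.matF (proj ℓ p)) (.tmp 0)]) ++
  ((rows m ℓ).map fun r => .sub (.matS r) (.matD r) (.matF r)))))))

/-- The second part of `stage`, which computes the determinant, `G` and `H`. -/
noncomputable def stageSnd (m : Fin L → ℕ) (ℓ : Fin L) : Program m :=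
  ((rows m ℓ).map fun r => .mul .det .det (.matS r)) ++
  ([.const (.tmp 0) 1] ++
  (((rows m ℓ).map fun r => .div (.matG r) (.tmp 0) (.matS r)) ++
  ((before m ℓ).map fun p => .mul (.matH p) (.matL p) (.matG (proj ℓ p)))))

/-- The third part of `stage`, which updates the inverse. -/
noncomputable def stageThd (m : Fin L → ℕ) (ℓ : Fin L) : Program m :=
  ((pairs m ℓ ℓ).flatMap fun pq =>
    [.conj (.tmp 0) (.matL pq.2), .mul (.matJ pq.1 pq.2) (.matH pq.1) (.tmp 0)]) ++
  (((pairs m ℓ ℓ).map fun pq =>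
    if OnDiag (prev ℓ) pq.1 pq.2 then
      .add (.matM pq.1 pq.2) (.matA pq.1 pq.2) (.matJ pq.1 pq.2)
    else .copy (.matM pq.1 pq.2) (.matJ pq.1 pq.2)) ++
  (((pairs m ℓ ℓ).map fun pq => .copy (.matA pq.1 pq.2) (.matM pq.1 pq.2)) ++
  (((before m ℓ).flatMap fun p =>
    [.neg (.matA p (proj ℓ p)) (.matH p), .conj (.tmp 0) (.matH p),
      .neg (.matA (proj ℓ p) p) (.tmp 0)]) ++
  ((rows m ℓ).map fun r => .copy (.matA r r) (.matG r)))))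

theorem stage_eq (ℓ : Fin L) :
    stage m ℓ = stageFst m ℓ ++ (stageSnd m ℓ ++ stageThd m ℓ) := by
  simp only [stage, stageFst, stageSnd, stageThd, List.append_assoc]

theorem exists_runs_prod {α : Type*} (X : α → Reg m) (hX : ∀ a, X a ≠ .det) :
    ∀ (l : List α) (σ : Reg m → ℂ), ∃ τ, Runs k (l.map fun a => .mul .det .det (X a)) σ τ ∧
      τ .det = σ .det * (l.map fun a => σ (X a)).prod ∧ ∀ s, s ≠ .det → τ s = σ s
  | [], σ => ⟨σ, rfl, by simp, fun _ _ => rfl⟩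
  | a :: l, σ => by
    classical
    obtain ⟨τ, h1, h2, h3⟩ := exists_runs_prod X hX l
      (Function.update σ .det (σ .det * σ (X a)))
    refine ⟨τ, ⟨trivial, h1⟩, ?_, ?_⟩
    · rw [h2, Function.update_self, List.map_cons, List.prod_cons, mul_assoc]
      congr 3
      exact List.map_congr_left fun b _ => Function.update_of_ne (hX b) _ _
    · intro s hs
      rw [h3 s hs, Function.update_of_ne hs]

theorem prod_map_rows (ℓ : Fin L) (f : Idx m → ℂ) :
    ((rows m ℓ).map f).prod = ∏ i : Fin (2 ^ m ℓ), f ⟨ℓ, i⟩ := by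
  rw [rows, List.map_map, Fin.prod_univ_def]
  rfl

/-- The result is expressed through whatever `lam` and `matA` contain. That these are the stored
entries of Λ and of an inverse enters only later, through the congruence lemmas. -/
theorem exists_runs_stageFst (ℓ : Fin L) (σ : Reg m → ℂ) :
    ∃ τ, Runs k (stageFst m ℓ) σ τ ∧
      (∀ p, p.1 < ℓ → τ (.matL p) =
        stageL (fun p q => σ (.lam p q)) (fun p q => σ (.matA p q)) ℓ p) ∧
      (∀ r, r.1 = ℓ → τ (.matS r) =
        stageS (fun p q => σ (.lam p q)) (fun p q => σ (.matA p q)) ℓ r) ∧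
      (∀ r, r.1 ≠ ℓ → τ (.matS r) = σ (.matS r)) ∧
      (∀ p q, τ (.lam p q) = σ (.lam p q)) ∧ (∀ p q, τ (.matA p q) = σ (.matA p q)) ∧
      τ .det = σ .det := by
  classical
  obtain ⟨σ₁, a1, a2, a3⟩ := exists_runs_map (k := k) (rows m ℓ)
    (fun r => .copy (.matD r) (.lam r r)) .matD (fun r => σ (.lam r r)) σ
    (nodup_map_rows (fun _ _ => Reg.matD.inj) ℓ) (fun _ => rfl)
    (fun r _ σ' _ e => ⟨trivial, e _ (by simp)⟩)
  obtain ⟨σ₂, b1, b2, b3⟩ := exists_runs_map (k := k) (before m ℓ)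
    (fun p => .copy (.matB p) (.lam p (proj ℓ p))) .matB (fun p => σ (.lam p (proj ℓ p))) σ₁
    ((nodup_before ℓ).map fun _ _ => Reg.matB.inj) (fun _ => rfl)
    (fun r _ σ' _ e => ⟨trivial, by
      simp only [Instr.value]
      rw [e _ (by simp), a3 _ (by simp)]⟩)
  obtain ⟨σ₃, c1, c2, c3⟩ := exists_runs_map (k := k) (before m ℓ)
    (fun p => .const (.matL p) 0) .matL (fun _ => 0) σ₂
    ((nodup_before ℓ).map fun _ _ => Reg.matL.inj) (fun _ => rfl)
    (fun r _ σ' _ e => ⟨trivial, rfl⟩)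
  obtain ⟨σ₄, d1, d2, d3⟩ := exists_runs_accumulate (k := k) (pairs m ℓ (prev ℓ))
    (fun pq => [.mul (.tmp 0) (.matA pq.1 pq.2) (.matB pq.2),
      .add (.matL pq.1) (.matL pq.1) (.tmp 0)]) .matL (fun a => a.1) {.tmp 0}
    (fun a => σ (.matA a.1 a.2) * σ (.lam a.2 (proj ℓ a.2))) σ₃
    (fun _ _ => Reg.matL.inj) (by simp) (by
      intro a ha σ' hf
      obtain ⟨-, h2, -⟩ := mem_pairs.1 ha
      refine ⟨_, ⟨trivial, trivial, rfl⟩, ?_, ?_⟩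
      · simp [Instr.dest, Instr.value, hf, c3, b2 _ (mem_before.2 h2), b3, a3]
      · intro s h1 h2
        have h2 : s ≠ .tmp 0 := h2
        simp [Instr.dest, h1, h2])
  obtain ⟨σ₅, e1, e2, e3⟩ := exists_runs_map (k := k) (rows m ℓ)
    (fun r => .const (.matF r) 0) .matF (fun _ => 0) σ₄
    (nodup_map_rows (fun _ _ => Reg.matF.inj) ℓ) (fun _ => rfl)
    (fun r _ σ' _ e => ⟨trivial, rfl⟩)
  have hL : ∀ p, p.1 < ℓ → σ₄ (.matL p) =
      stageL (fun p q => σ (.lam p q)) (fun p q => σ (.matA p q)) ℓ p := by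
    intro p hp
    rw [d2, c2 _ (mem_before.2 hp), zero_add,
      sum_map_of_nodup (nodup_pairs ℓ (prev ℓ)) (fun a => mem_pairs), sum_filter,
      ← univ_product_univ, sum_product, sum_eq_single p]
    · rw [stageL, sum_filter]
      refine sum_congr rfl fun q _ => ?_
      simp [hp]
    · intro q _ hq; simp [hq]
    · simp
  obtain ⟨σ₆, f1, f2, f3⟩ := exists_runs_accumulate (k := k) (before m ℓ)
    (fun p => [.conj (.tmp 0) (.matB p), .mul (.tmp 0) (.tmp 0) (.matL p),
      .add (.matF (proj ℓ p)) (.matF (proj ℓ p)) (.tmp 0)]) .matF (proj ℓ) {.tmp 0}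
    (fun p => star (σ (.lam p (proj ℓ p))) *
      stageL (fun p q => σ (.lam p q)) (fun p q => σ (.matA p q)) ℓ p) σ₅
    (fun _ _ => Reg.matF.inj) (by simp) (by
      intro p hp σ' hf
      refine ⟨_, ⟨trivial, trivial, trivial, rfl⟩, ?_, ?_⟩
      · simp [Instr.dest, Instr.value, hf, e3, d3, c3, b2 _ hp, hL _ (mem_before.1 hp)]
      · intro s h1 h2
        have h2 : s ≠ .tmp 0 := h2
        simp [Instr.dest, h1, h2])
  obtain ⟨τ, g1, g2, g3⟩ := exists_runs_map (k := k) (rows m ℓ)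
    (fun r => .sub (.matS r) (.matD r) (.matF r)) .matS
    (fun r => stageS (fun p q => σ (.lam p q)) (fun p q => σ (.matA p q)) ℓ r) σ₆
    (nodup_map_rows (fun _ _ => Reg.matS.inj) ℓ) (fun _ => rfl)
    (fun r hr σ' _ e => ⟨trivial, by
      simp only [Instr.value]
      rw [e _ (by simp), e _ (by simp), f2, f3 _ (by simp) (by simp), e3 _ (by simp), e2 _ hr,
        d3 _ (by simp) (by simp), c3 _ (by simp), b3 _ (by simp), a2 _ hr, zero_add,
        sum_map_of_nodup (nodup_before ℓ) (fun a => mem_before), stageS, ← sum_filter,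
        filter_filter]⟩)
  refine ⟨τ, a1.append (b1.append (c1.append (d1.append (e1.append (f1.append g1))))), ?_, ?_, ?_,
    ?_, ?_, ?_⟩
  · intro p hp
    rw [g3 _ (by simp), f3 _ (by simp) (by simp), e3 _ (by simp), hL p hp]
  · intro r hr
    exact g2 r (mem_rows.2 hr)
  · intro r hr
    rw [g3 _ (fun b hb h => hr (by rw [Reg.matS.inj h, mem_rows.1 hb])),
      f3 _ (by simp) (by simp), e3 _ (by simp), d3 _ (by simp) (by simp), c3 _ (by simp),
      b3 _ (by simp), a3 _ (by simp)]
  · intro p q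
    rw [g3 _ (by simp), f3 _ (by simp) (by simp), e3 _ (by simp), d3 _ (by simp) (by simp),
      c3 _ (by simp), b3 _ (by simp), a3 _ (by simp)]
  · intro p q
    rw [g3 _ (by simp), f3 _ (by simp) (by simp), e3 _ (by simp), d3 _ (by simp) (by simp),
      c3 _ (by simp), b3 _ (by simp), a3 _ (by simp)]
  · rw [g3 _ (by simp), f3 _ (by simp) (by simp), e3 _ (by simp), d3 _ (by simp) (by simp),
      c3 _ (by simp), b3 _ (by simp), a3 _ (by simp)]

theorem exists_runs_stageSnd (ℓ : Fin L) (σ : Reg m → ℂ)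
    (hS : ∀ r, r.1 = ℓ → σ (.matS r) ≠ 0) :
    ∃ τ, Runs k (stageSnd m ℓ) σ τ ∧
      τ .det = σ .det * ∏ i : Fin (2 ^ m ℓ), σ (.matS ⟨ℓ, i⟩) ∧
      (∀ r, r.1 = ℓ → τ (.matG r) = 1 / σ (.matS r)) ∧
      (∀ p, p.1 < ℓ → τ (.matH p) = σ (.matL p) * (1 / σ (.matS (proj ℓ p)))) ∧
      (∀ r, τ (.matS r) = σ (.matS r)) ∧ (∀ p, τ (.matL p) = σ (.matL p)) ∧
      (∀ p q, τ (.lam p q) = σ (.lam p q)) ∧ (∀ p q, τ (.matA p q) = σ (.matA p q)) := by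
  classical
  obtain ⟨σ₁, a1, a2, a3⟩ := exists_runs_prod (k := k) (fun r => .matS r) (by simp) (rows m ℓ) σ
  obtain ⟨σ₂, b1, b2, b3⟩ := exists_runs_map (k := k) (rows m ℓ)
    (fun r => .div (.matG r) (.tmp 0) (.matS r)) .matG (fun r => 1 / σ (.matS r))
    (Function.update σ₁ (.tmp 0) 1)
    (nodup_map_rows (fun _ _ => Reg.matG.inj) ℓ) (fun _ => rfl)
    (fun r hr σ' _ e => by
      have h : σ' (.matS r) = σ (.matS r) := by
        rw [e _ (by simp), Function.update_of_ne (by simp), a3 _ (by simp)]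
      refine ⟨?_, ?_⟩
      · show σ' (.matS r) ≠ 0
        rw [h]
        exact hS r (mem_rows.1 hr)
      · simp only [Instr.value]
        rw [h, e _ (by simp), Function.update_self])
  obtain ⟨τ, c1, c2, c3⟩ := exists_runs_map (k := k) (before m ℓ)
    (fun p => .mul (.matH p) (.matL p) (.matG (proj ℓ p))) .matH
    (fun p => σ (.matL p) * (1 / σ (.matS (proj ℓ p)))) σ₂
    ((nodup_before ℓ).map fun _ _ => Reg.matH.inj) (fun _ => rfl)
    (fun r _ σ' _ e => ⟨trivial, by
      simp only [Instr.value]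
      rw [e _ (by simp), e _ (by simp), b2 _ (mem_rows.2 rfl), b3 _ (by simp),
        Function.update_of_ne (by simp), a3 _ (by simp)]⟩)
  refine ⟨τ, a1.append (Runs.append ⟨trivial, rfl⟩ (b1.append c1)), ?_, ?_, ?_, ?_, ?_, ?_, ?_⟩
  · rw [c3 _ (by simp), b3 _ (by simp), Function.update_of_ne (by simp), a2, prod_map_rows]
  · intro r hr
    rw [c3 _ (by simp), b2 _ (mem_rows.2 hr)]
  · intro p hp
    exact c2 p (mem_before.2 hp)
  · intro r
    rw [c3 _ (by simp), b3 _ (by simp), Function.update_of_ne (by simp), a3 _ (by simp)]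
  · intro r
    rw [c3 _ (by simp), b3 _ (by simp), Function.update_of_ne (by simp), a3 _ (by simp)]
  · intro p q
    rw [c3 _ (by simp), b3 _ (by simp), Function.update_of_ne (by simp), a3 _ (by simp)]
  · intro p q
    rw [c3 _ (by simp), b3 _ (by simp), Function.update_of_ne (by simp), a3 _ (by simp)]

theorem exists_runs_stageThd (ℓ : Fin L) (σ : Reg m → ℂ) :
    ∃ τ, Runs k (stageThd m ℓ) σ τ ∧
      (∀ p q, p.1 < ℓ → q.1 < ℓ → OnDiag ℓ p q → τ (.matA p q) =
        (if OnDiag (prev ℓ) p q then σ (.matA p q) else 0) + σ (.matH p) * star (σ (.matL q))) ∧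
      (∀ p, p.1 < ℓ → τ (.matA p (proj ℓ p)) = -σ (.matH p) ∧
        τ (.matA (proj ℓ p) p) = -star (σ (.matH p))) ∧
      (∀ r, r.1 = ℓ → τ (.matA r r) = σ (.matG r)) ∧
      (∀ r, τ (.matS r) = σ (.matS r)) ∧ (∀ p q, τ (.lam p q) = σ (.lam p q)) ∧
      τ .det = σ .det := by
  classical
  have ndA : ((pairs m ℓ ℓ).map fun a => (.matA a.1 a.2 : Reg m)).Nodup :=
    (nodup_pairs ℓ ℓ).map fun a b h => Prod.ext (Reg.matA.inj h).1 (Reg.matA.inj h).2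
  obtain ⟨σ₁, a1, a2, a3⟩ := exists_runs_parallel_one (k := k) (pairs m ℓ ℓ)
    (fun pq => [.conj (.tmp 0) (.matL pq.2), .mul (.matJ pq.1 pq.2) (.matH pq.1) (.tmp 0)])
    (fun a => .matJ a.1 a.2) {.tmp 0} (fun a => σ (.matH a.1) * star (σ (.matL a.2))) σ
    ((nodup_pairs ℓ ℓ).map fun a b h => Prod.ext (Reg.matJ.inj h).1 (Reg.matJ.inj h).2)
    (by simp) (by
      intro a ha σ' _ hf
      refine ⟨_, ⟨trivial, trivial, rfl⟩, ?_, ?_⟩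
      · simp [Instr.dest, Instr.value, hf]
      · intro s h1 h2
        have h2 : s ≠ .tmp 0 := h2
        simp [Instr.dest, h1, h2])
  obtain ⟨σ₂, b1, b2, b3⟩ := exists_runs_map (k := k) (pairs m ℓ ℓ)
    (fun pq => if OnDiag (prev ℓ) pq.1 pq.2 then
        .add (.matM pq.1 pq.2) (.matA pq.1 pq.2) (.matJ pq.1 pq.2)
      else .copy (.matM pq.1 pq.2) (.matJ pq.1 pq.2))
    (fun a => .matM a.1 a.2)
    -- The pattern of stage ℓ is larger than that of the preceding one; outside the old pattern the
    -- registers may hold anything, and 0 is used instead.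
    (fun a => (if OnDiag (prev ℓ) a.1 a.2 then σ (.matA a.1 a.2) else 0) +
      σ (.matH a.1) * star (σ (.matL a.2))) σ₁
    ((nodup_pairs ℓ ℓ).map fun a b h => Prod.ext (Reg.matM.inj h).1 (Reg.matM.inj h).2)
    (fun a => by split_ifs <;> rfl)
    (fun a ha σ' _ e => by
      split_ifs
      · refine ⟨trivial, ?_⟩
        simp only [Instr.value]
        rw [e _ (by simp), e _ (by simp), a2 a ha, a3 _ (by simp) (by simp)]
      · refine ⟨trivial, ?_⟩
        simp only [Instr.value]
        rw [e _ (by simp), a2 a ha, zero_add])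
  obtain ⟨σ₃, c1, c2, c3⟩ := exists_runs_map (k := k) (pairs m ℓ ℓ)
    (fun pq => .copy (.matA pq.1 pq.2) (.matM pq.1 pq.2)) (fun a => .matA a.1 a.2)
    (fun a => (if OnDiag (prev ℓ) a.1 a.2 then σ (.matA a.1 a.2) else 0) +
      σ (.matH a.1) * star (σ (.matL a.2))) σ₂ ndA (fun _ => rfl)
    (fun a ha σ' _ e => ⟨trivial, by
      simp only [Instr.value]
      rw [e _ (by simp), b2 a ha]⟩)
  have hH : ∀ p, σ₃ (.matH p) = σ (.matH p) := fun p => by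
    rw [c3 _ (by simp), b3 _ (by simp), a3 _ (by simp) (by simp)]
  -- Hence the entries (p, `proj ℓ p`) and (`proj ℓ p`, p) are different registers, and an iteration
  -- does not overwrite its own result.
  have hne : ∀ p : Idx m, p.1 < ℓ → proj ℓ p ≠ p := fun p hp h => hp.ne' (congrArg Sigma.fst h)
  obtain ⟨σ₄, d1, d2, d3⟩ := exists_runs_parallel (k := k) (before m ℓ)
    (fun p => [.neg (.matA p (proj ℓ p)) (.matH p), .conj (.tmp 0) (.matH p),
      .neg (.matA (proj ℓ p) p) (.tmp 0)])
    (fun p => [.matA p (proj ℓ p), .matA (proj ℓ p) p]) {.tmp 0}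
    (fun p s => if s = .matA p (proj ℓ p) then -σ (.matH p) else -star (σ (.matH p))) σ₃
    (by
      refine List.Pairwise.imp_of_mem ?_ (nodup_before ℓ)
      intro p q hp hq hpq s hs hs'
      have hp := mem_before.1 hp
      have hq := mem_before.1 hq
      simp only [List.mem_cons, List.not_mem_nil, or_false] at hs hs'
      rcases hs with rfl | rfl <;> rcases hs' with h | h
      · exact hpq (Reg.matA.inj h).1
      · exact hp.ne (congrArg Sigma.fst (Reg.matA.inj h).1)
      · exact hp.ne (congrArg Sigma.fst (Reg.matA.inj h).2)
      · exact hpq (Reg.matA.inj h).2)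
    (by
      intro p _ s hs
      simp only [List.mem_cons, List.not_mem_nil, or_false] at hs
      rcases hs with rfl | rfl <;> simp)
    (by
      intro p hp σ' _ hf
      have hp := mem_before.1 hp
      have h1 := hne p hp
      have h2 := h1.symm
      have hHp : σ' (.matH p) = σ (.matH p) := by rw [hf _ (by simp) (by simp), hH]
      refine ⟨_, ⟨trivial, trivial, trivial, rfl⟩, ?_, ?_⟩
      · intro s hs
        simp only [List.mem_cons, List.not_mem_nil, or_false] at hs
        rcases hs with rfl | rfl
        · simp [Instr.dest, Instr.value, h2, hHp]
        · simp [Instr.dest, Instr.value, h1, hHp]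
      · intro s hs hsT
        have hsT : s ≠ .tmp 0 := hsT
        simp only [List.mem_cons, List.not_mem_nil, or_false, not_or] at hs
        simp [Instr.dest, hs.1, hs.2, hsT])
  obtain ⟨τ, e1, e2, e3⟩ := exists_runs_map (k := k) (rows m ℓ)
    (fun r => .copy (.matA r r) (.matG r)) (fun r => .matA r r) (fun r => σ (.matG r)) σ₄
    ((nodup_rows ℓ).map fun a b h => (Reg.matA.inj h).1) (fun _ => rfl)
    (fun r hr σ' _ e => ⟨trivial, by
      simp only [Instr.value]
      rw [e _ (by simp), d3 _ (by simp) (by simp), c3 _ (by simp), b3 _ (by simp),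
        a3 _ (by simp) (by simp)]⟩)
  refine ⟨τ, a1.append (b1.append (c1.append (d1.append e1))), ?_, ?_, ?_, ?_, ?_, ?_⟩
  · intro p q hp hq hpq
    rw [e3 _ (fun r hr h => hp.ne (by rw [(Reg.matA.inj h).1, mem_rows.1 hr])),
      d3 _ (fun r hr h => ?_) (by simp), c2 (p, q) (mem_pairs.2 ⟨hp, hq, hpq⟩)]
    simp only [List.mem_cons, List.not_mem_nil, or_false] at h
    rcases h with h | h
    · exact hq.ne (congrArg Sigma.fst (Reg.matA.inj h).2)
    · exact hp.ne (congrArg Sigma.fst (Reg.matA.inj h).1)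
  · intro p hp
    have h1 := hne p hp
    have hb := mem_before.2 hp
    refine ⟨?_, ?_⟩
    · rw [e3 _ (fun r hr h => hp.ne (by rw [(Reg.matA.inj h).1, mem_rows.1 hr])),
        d2 p hb _ (by simp), if_pos rfl]
    · rw [e3 _ (fun r hr h => hp.ne (by rw [(Reg.matA.inj h).2, mem_rows.1 hr])),
        d2 p hb _ (by simp), if_neg (by simp [h1])]
  · intro r hr
    exact e2 r (mem_rows.2 hr)
  · intro r
    rw [e3 _ (by simp), d3 _ (by simp) (by simp), c3 _ (by simp), b3 _ (by simp),
      a3 _ (by simp) (by simp)]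
  · intro p q
    rw [e3 _ (by simp), d3 _ (by simp) (by simp), c3 _ (by simp), b3 _ (by simp),
      a3 _ (by simp) (by simp)]
  · rw [e3 _ (by simp), d3 _ (by simp) (by simp), c3 _ (by simp), b3 _ (by simp),
      a3 _ (by simp) (by simp)]

theorem exists_runs_stage (ℓ : Fin L) (σ : Reg m → ℂ) {M A : Idx m → Idx m → ℂ}
    (hM : ∀ p q, σ (.lam p q) = M p q) (hA : ∀ p q, σ (.matA p q) = A p q)
    (hS : ∀ r, r.1 = ℓ → stageS M A ℓ r ≠ 0) :
    ∃ τ, Runs k (stage m ℓ) σ τ ∧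
      (∀ p q, p.1 < ℓ → q.1 < ℓ → OnDiag ℓ p q → τ (.matA p q) =
        (if OnDiag (prev ℓ) p q then A p q else 0) + stageH M A ℓ p * star (stageL M A ℓ q)) ∧
      (∀ p, p.1 < ℓ → τ (.matA p (proj ℓ p)) = -stageH M A ℓ p ∧
        τ (.matA (proj ℓ p) p) = -star (stageH M A ℓ p)) ∧
      (∀ r, r.1 = ℓ → τ (.matA r r) = 1 / stageS M A ℓ r) ∧
      (∀ r, r.1 = ℓ → τ (.matS r) = stageS M A ℓ r) ∧
      (∀ r, r.1 ≠ ℓ → τ (.matS r) = σ (.matS r)) ∧ (∀ p q, τ (.lam p q) = σ (.lam p q)) ∧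
      τ .det = σ .det * ∏ i : Fin (2 ^ m ℓ), stageS M A ℓ ⟨ℓ, i⟩ := by
  obtain rfl : (fun p q => σ (.lam p q)) = M := funext fun p => funext (hM p)
  obtain rfl : (fun p q => σ (.matA p q)) = A := funext fun p => funext (hA p)
  obtain ⟨σ₁, a1, aL, aS, aS', alam, aA, adet⟩ := exists_runs_stageFst (k := k) ℓ σ
  obtain ⟨σ₂, b1, bdet, bG, bH, bS, bL, blam, bA⟩ := exists_runs_stageSnd (k := k) ℓ σ₁
    (fun r hr => by rw [aS r hr]; exact hS r hr)
  obtain ⟨τ, c1, c2, c3, c4, cS, clam, cdet⟩ := exists_runs_stageThd (k := k) ℓ σ₂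
  have hH : ∀ p, p.1 < ℓ → σ₂ (.matH p) =
      stageH (fun p q => σ (.lam p q)) (fun p q => σ (.matA p q)) ℓ p := fun p hp => by
    rw [bH p hp, aL p hp, aS _ rfl, stageH]
  refine ⟨τ, by rw [stage_eq]; exact a1.append (b1.append c1), ?_, ?_, ?_, ?_, ?_, ?_, ?_⟩
  · intro p q hp hq hpq
    rw [c2 p q hp hq hpq, hH p hp, bL, aL q hq, bA, aA]
  · intro p hp
    rw [← hH p hp]
    exact c3 p hp
  · intro r hr
    rw [c4 r hr, bG r hr, aS r hr]
  · intro r hr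
    rw [cS, bS, aS r hr]
  · intro r hr
    rw [cS, bS, aS' r hr]
  · intro p q
    rw [clam, blam, alam]
  · rw [cdet, bdet, adet]
    congr 1
    exact prod_congr rfl fun i _ => aS _ rfl

theorem exists_runs_firstStage (ℓ : Fin L) (σ : Reg m → ℂ)
    (hS : ∀ r : Idx m, r.1 = ℓ → σ (.lam r r) ≠ 0) :
    ∃ τ, Runs k (firstStage m ℓ) σ τ ∧
      (∀ r, r.1 = ℓ → τ (.matA r r) = 1 / σ (.lam r r)) ∧
      (∀ p q, τ (.lam p q) = σ (.lam p q)) ∧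
      τ .det = ∏ i : Fin (2 ^ m ℓ), σ (.lam ⟨ℓ, i⟩ ⟨ℓ, i⟩) := by
  classical
  obtain ⟨σ₁, a1, a2, a3⟩ := exists_runs_map (k := k) (rows m ℓ)
    (fun r => .copy (.matD r) (.lam r r)) .matD (fun r => σ (.lam r r)) σ
    (nodup_map_rows (fun _ _ => Reg.matD.inj) ℓ) (fun _ => rfl)
    (fun r _ σ' _ e => ⟨trivial, e _ (by simp)⟩)
  obtain ⟨σ₂, b1, b2, b3⟩ := exists_runs_map (k := k) (rows m ℓ)
    (fun r => .div (.matA r r) (.tmp 0) (.matD r)) (fun r => .matA r r)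
    (fun r => 1 / σ (.lam r r)) (Function.update σ₁ (.tmp 0) 1)
    ((nodup_rows ℓ).map fun a b h => (Reg.matA.inj h).1) (fun _ => rfl)
    (fun r hr σ' _ e => by
      have h : σ' (.matD r) = σ (.lam r r) := by
        rw [e _ (by simp), Function.update_of_ne (by simp), a2 r hr]
      refine ⟨?_, ?_⟩
      · show σ' (.matD r) ≠ 0
        rw [h]
        exact hS r (mem_rows.1 hr)
      · simp only [Instr.value]
        rw [h, e _ (by simp), Function.update_self])
  obtain ⟨τ, c1, c2, c3⟩ := exists_runs_prod (k := k) (fun r => .matD r) (by simp) (rows m ℓ)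
    (Function.update σ₂ .det 1)
  refine ⟨τ, ?_, ?_, ?_, ?_⟩
  · rw [firstStage]
    have h1 : Runs k [.const (.tmp 0) 1] σ₁ (Function.update σ₁ (.tmp 0) 1) := ⟨trivial, rfl⟩
    have h2 : Runs k [.const .det 1] σ₂ (Function.update σ₂ .det 1) := ⟨trivial, rfl⟩
    exact (((a1.append h1).append b1).append h2).append c1
  · intro r hr
    rw [c3 _ (by simp), Function.update_of_ne (by simp), b2 r (mem_rows.2 hr)]
  · intro p q
    rw [c3 _ (by simp), Function.update_of_ne (by simp), b3 _ (by simp),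
      Function.update_of_ne (by simp), a3 _ (by simp)]
  · rw [c2, Function.update_self, one_mul, ← prod_map_rows ℓ fun r => σ (.lam r r)]
    congr 1
    refine List.map_congr_left fun r hr => ?_
    rw [Function.update_of_ne (by simp), b3 _ (by simp), Function.update_of_ne (by simp), a2 r hr]

end FastMTGP

namespace FastMTGP
open Finset
open scoped ComplexOrder

variable {L : ℕ} {m : Fin L → ℕ}

/-! ### Inversion of the leading blocks -/

theorem OnDiag.of_le {e ℓ : Fin L} {p q : Idx m} (h : OnDiag e p q) (hm : m ℓ ≤ m e) :
    OnDiag ℓ p q := by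
  have hd : 2 ^ m ℓ ∣ 2 ^ m e := pow_dvd_pow 2 hm
  unfold OnDiag at h ⊢
  rw [← Nat.mod_mod_of_dvd _ hd, h, Nat.mod_mod_of_dvd _ hd]

theorem onDiag_iff_proj_eq {ℓ : Fin L} {p q : Idx m} : OnDiag ℓ p q ↔ proj ℓ p = proj ℓ q := by
  simp [OnDiag, proj]

theorem proj_self (p : Idx m) : proj p.1 p = p := idx_self p

theorem prev_le (ℓ : Fin L) : prev ℓ ≤ ℓ := Nat.sub_le _ _

/-- The indices of the tasks before `n`. -/
abbrev Lead (m : Fin L → ℕ) (n : ℕ) : Type := {p : Idx m // (p.1 : ℕ) < n}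

/-- The leading blocks. -/
def lead (M : Matrix (Idx m) (Idx m) ℂ) (n : ℕ) : Matrix (Lead m n) (Lead m n) ℂ :=
  M.submatrix Subtype.val Subtype.val

/-- The inverse of the leading blocks, extended by zero. -/
noncomputable def leadInv (M : Matrix (Idx m) (Idx m) ℂ) (n : ℕ) (p q : Idx m) : ℂ :=
  if h : (p.1 : ℕ) < n ∧ (q.1 : ℕ) < n then (lead M n)⁻¹ ⟨p, h.1⟩ ⟨q, h.2⟩ else 0

theorem leadInv_eq (M : Matrix (Idx m) (Idx m) ℂ) {n : ℕ} (p q : Lead m n) :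
    leadInv M n p q = (lead M n)⁻¹ p q := by
  rw [leadInv, dif_pos ⟨p.2, q.2⟩]

/-- The leading blocks up to task `ℓ` are those before task `ℓ` and those of task `ℓ`. -/
noncomputable def leadEquiv (m : Fin L → ℕ) (ℓ : Fin L) :
    Lead m ℓ ⊕ Fin (2 ^ m ℓ) ≃ Lead m ((ℓ : ℕ) + 1) :=
  Equiv.ofBijective
    (Sum.elim (fun p => ⟨p.1, Nat.lt_succ_of_lt p.2⟩) fun i => ⟨⟨ℓ, i⟩, Nat.lt_succ_self _⟩) (by
    constructor
    · rintro (p | i) (q | j) h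
      · have : p.1 = q.1 := congrArg (fun x : Lead m (ℓ + 1) => x.1) h
        rw [Subtype.ext this]
      · have : p.1 = ⟨ℓ, j⟩ := congrArg Subtype.val h
        have h2 := p.2
        rw [this] at h2
        exact absurd h2 (lt_irrefl _)
      · have : ⟨ℓ, i⟩ = q.1 := congrArg Subtype.val h
        have h2 := q.2
        rw [← this] at h2
        exact absurd h2 (lt_irrefl _)
      · have : (⟨ℓ, i⟩ : Idx m) = ⟨ℓ, j⟩ := congrArg Subtype.val h
        rw [eq_of_heq (Sigma.mk.inj this).2]
    · rintro ⟨p, hp⟩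
      rcases Nat.lt_succ_iff_lt_or_eq.1 hp with h | h
      · exact ⟨Sum.inl ⟨p, h⟩, rfl⟩
      · have h : p.1 = ℓ := Fin.ext h
        subst h
        exact ⟨Sum.inr p.2, rfl⟩)

section Block

variable {α β : Type*} [Fintype α] [Fintype β] [DecidableEq α] [DecidableEq β]

/-- Block inversion in the form of the algorithm: only AB, the inverse G of the Schur complement and
their conjugate transposes occur. It is verified as a right inverse. -/
theorem inv_fromBlocks_hermitian {A A₀ : Matrix α α ℂ} {B : Matrix α β ℂ} {D G : Matrix β β ℂ}
    (hA : A * A₀ = 1) (hA₀ : A₀.IsHermitian)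
    (hG : (D - B.conjTranspose * A₀ * B) * G = 1) :
    (Matrix.fromBlocks A B B.conjTranspose D)⁻¹ =
      Matrix.fromBlocks (A₀ + A₀ * B * G * (A₀ * B).conjTranspose) (-(A₀ * B * G))
        (-(G * (A₀ * B).conjTranspose)) G := by
  have hL : (A₀ * B).conjTranspose = B.conjTranspose * A₀ := by
    rw [Matrix.conjTranspose_mul, hA₀.eq]
  have e1 : ∀ X : Matrix α β ℂ, A * (A₀ * X) = X := fun X => by
    rw [← Matrix.mul_assoc, hA, Matrix.one_mul]
  have e2 : ∀ X : Matrix α α ℂ, A * (A₀ * X) = X := fun X => by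
    rw [← Matrix.mul_assoc, hA, Matrix.one_mul]
  -- This is D = S + B*A₀B multiplied by G, where SG = 1.
  have hG' : D * G = 1 + B.conjTranspose * (A₀ * (B * G)) := by
    rw [← hG, Matrix.sub_mul, Matrix.mul_assoc, Matrix.mul_assoc, sub_add_cancel]
  refine Matrix.inv_eq_right_inv ?_
  rw [Matrix.fromBlocks_multiply, ← Matrix.fromBlocks_one, hL]
  congr 1
  · simp only [Matrix.mul_add, Matrix.mul_neg, Matrix.mul_assoc, hA, e2]
    abel
  · simp only [Matrix.mul_neg, Matrix.mul_assoc, e1]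
    abel
  · have : D * (G * (B.conjTranspose * A₀)) = B.conjTranspose * A₀ +
        B.conjTranspose * (A₀ * (B * (G * (B.conjTranspose * A₀)))) := by
      rw [← Matrix.mul_assoc, hG', Matrix.add_mul, Matrix.one_mul]
      simp only [Matrix.mul_assoc]
    simp only [Matrix.mul_add, Matrix.mul_neg, Matrix.mul_assoc, this]
    abel
  · simp only [Matrix.mul_neg, Matrix.mul_assoc, hG']
    abel

theorem det_fromBlocks_of_mul_eq_one {A A₀ : Matrix α α ℂ} {B : Matrix α β ℂ} {C : Matrix β α ℂ}
    {D : Matrix β β ℂ} (hA : A * A₀ = 1) :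
    (Matrix.fromBlocks A B C D).det = A.det * (D - C * A₀ * B).det := by
  let := invertibleOfRightInverse A A₀ hA
  rw [Matrix.det_fromBlocks₁₁, invOf_eq_right_inv hA]

end Block

/-- The position of `p` modulo the size of task `ℓ`. -/
def pos (ℓ : Fin L) (p : Idx m) : Fin (2 ^ m ℓ) := (proj ℓ p).2

theorem proj_eq (ℓ : Fin L) (p : Idx m) : proj ℓ p = ⟨ℓ, pos ℓ p⟩ := rfl

theorem proj_eq_mk_iff {ℓ : Fin L} {p : Idx m} {i : Fin (2 ^ m ℓ)} :
    proj ℓ p = ⟨ℓ, i⟩ ↔ pos ℓ p = i := by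
  rw [proj_eq]
  exact ⟨fun h => eq_of_heq (Sigma.mk.inj h).2, fun h => by rw [h]⟩

theorem onDiag_iff_pos_eq {ℓ : Fin L} {p q : Idx m} : OnDiag ℓ p q ↔ pos ℓ p = pos ℓ q := by
  rw [onDiag_iff_proj_eq, proj_eq ℓ q, proj_eq_mk_iff]

/-- A positive definite matrix with the sparsity of the transformed Gram matrix. -/
structure IsBlockSparse (M : Matrix (Idx m) (Idx m) ℂ) : Prop where
  posDef : M.PosDef
  antitone : Antitone m
  sparse : ∀ p q : Idx m, p.1 ≤ q.1 → ¬ Stored p q → M p q = 0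

namespace IsBlockSparse

variable {M : Matrix (Idx m) (Idx m) ℂ}

theorem lead_posDef (h : IsBlockSparse M) (n : ℕ) : (lead M n).PosDef :=
  h.posDef.submatrix Subtype.val_injective

theorem lead_mul_inv (h : IsBlockSparse M) (n : ℕ) : lead M n * (lead M n)⁻¹ = 1 :=
  Matrix.mul_nonsing_inv _ ((Matrix.isUnit_iff_isUnit_det _).1 (h.lead_posDef n).isUnit)

theorem apply_mk (h : IsBlockSparse M) {ℓ : Fin L} {p : Idx m} (hp : p.1 ≤ ℓ)
    (i : Fin (2 ^ m ℓ)) : M p ⟨ℓ, i⟩ = if pos ℓ p = i then M p (proj ℓ p) else 0 := by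
  split_ifs with e
  · rw [proj_eq, e]
  · exact h.sparse p ⟨ℓ, i⟩ hp fun hs => e (proj_eq_mk_iff.1 hs.2)

theorem sum_lead {ℓ : Fin L} (f : Idx m → ℂ) :
    ∑ p : Lead m ℓ, f p = ∑ p : Idx m with p.1 < ℓ, f p :=
  (Finset.sum_subtype _ (by simp) f).symm

section Step

variable {ℓ : Fin L}

/-- The inverse links p only to q ≡ p mod n_{ℓ-1}, hence mod n_ℓ, and row q of the block column has
its only entry at q mod n_ℓ. All terms of row p thus fall into the column p mod n_ℓ. -/
theorem inv_mul_apply (h : IsBlockSparse M)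
    (hsp : ∀ p q, ¬ OnDiag (prev ℓ) p q → leadInv M ℓ p q = 0) (p : Lead m ℓ) (i : Fin (2 ^ m ℓ)) :
    ((lead M ℓ)⁻¹ * M.submatrix (Subtype.val : Lead m ℓ → Idx m) fun i => ⟨ℓ, i⟩) p i =
      if pos ℓ p.1 = i then stageL M (leadInv M ℓ) ℓ p else 0 := by
  have hL : stageL M (leadInv M ℓ) ℓ p = ∑ q : Lead m ℓ,
      if OnDiag (prev ℓ) p.1 q.1 then leadInv M ℓ p.1 q.1 * M q.1 (proj ℓ q.1) else 0 := by
    rw [sum_lead fun q => if OnDiag (prev ℓ) p.1 q then leadInv M ℓ p.1 q * M q (proj ℓ q) else 0,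
      ← sum_filter, filter_filter]
    rfl
  rw [Matrix.mul_apply, hL]
  have hle : m ℓ ≤ m (prev ℓ) := h.antitone (prev_le ℓ)
  have e : ∀ q : Lead m ℓ, (lead M ℓ)⁻¹ p q * M q ⟨ℓ, i⟩ = if pos ℓ p.1 = i then
      (if OnDiag (prev ℓ) p.1 q.1 then leadInv M ℓ p q * M q (proj ℓ q) else 0) else 0 := by
    intro q
    rw [← leadInv_eq, h.apply_mk (Fin.le_of_lt q.2)]
    by_cases hd : OnDiag (prev ℓ) p.1 q.1
    · rw [onDiag_iff_pos_eq.1 (hd.of_le hle), if_pos hd]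
      split_ifs <;> simp
    · rw [hsp _ _ hd, if_neg hd]
      simp
  simp only [Matrix.submatrix_apply, e]
  split_ifs <;> simp

/-- Both factors of B*(AB) have at most one nonzero entry in row p, in the same column p mod n_ℓ, so
the product is diagonal. -/
theorem schur_eq (h : IsBlockSparse M)
    (hsp : ∀ p q, ¬ OnDiag (prev ℓ) p q → leadInv M ℓ p q = 0) :
    M.submatrix (fun i => (⟨ℓ, i⟩ : Idx m)) (fun i => ⟨ℓ, i⟩) -
      (M.submatrix (Subtype.val : Lead m ℓ → Idx m) fun i => ⟨ℓ, i⟩).conjTranspose *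
        (lead M ℓ)⁻¹ * (M.submatrix (Subtype.val : Lead m ℓ → Idx m) fun i => ⟨ℓ, i⟩) =
      Matrix.diagonal fun i => stageS M (leadInv M ℓ) ℓ ⟨ℓ, i⟩ := by
  ext i j
  rw [Matrix.mul_assoc, Matrix.sub_apply, Matrix.mul_apply]
  simp only [h.inv_mul_apply hsp, Matrix.conjTranspose_apply, Matrix.submatrix_apply]
  have e : ∀ p : Lead m ℓ, star (M p ⟨ℓ, i⟩) *
      (if pos ℓ p.1 = j then stageL M (leadInv M ℓ) ℓ p else 0) = if i = j then
      (if proj ℓ p.1 = ⟨ℓ, i⟩ then star (M p (proj ℓ p)) * stageL M (leadInv M ℓ) ℓ p else 0)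
      else 0 := by
    intro p
    rw [h.apply_mk (Fin.le_of_lt p.2)]
    simp only [proj_eq_mk_iff]
    by_cases h1 : pos ℓ p.1 = i
    · by_cases h2 : i = j <;> simp [h1, h2]
    · simp [h1]
  simp only [e]
  by_cases hij : i = j
  · subst hij
    simp only [if_true, Matrix.diagonal_apply_eq]
    rw [sum_lead fun p => if proj ℓ p = ⟨ℓ, i⟩ then
      star (M p (proj ℓ p)) * stageL M (leadInv M ℓ) ℓ p else 0, ← sum_filter, filter_filter]
    rfl
  · rw [Matrix.diagonal_apply_ne _ hij, h.apply_mk (p := ⟨ℓ, i⟩) le_rfl, if_neg]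
    · simp [hij]
    · rw [← proj_eq_mk_iff]
      intro e
      have : (⟨ℓ, i⟩ : Idx m) = ⟨ℓ, j⟩ := (proj_self ⟨ℓ, i⟩).symm.trans e
      exact hij (eq_of_heq (Sigma.mk.inj this).2)

theorem schur_eq_diagonal (h : IsBlockSparse M)
    (hsp : ∀ p q, ¬ OnDiag (prev ℓ) p q → leadInv M ℓ p q = 0) :
    schur M ℓ = Matrix.diagonal fun i => stageS M (leadInv M ℓ) ℓ ⟨ℓ, i⟩ := by
  -- The block row in `schur` is the conjugate transpose of the block column because M is Hermitian.
  rw [← h.schur_eq hsp, Matrix.conjTranspose_submatrix, h.posDef.isHermitian.eq]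
  rfl

theorem lead_succ_submatrix (h : IsBlockSparse M) (ℓ : Fin L) :
    (lead M ((ℓ : ℕ) + 1)).submatrix (leadEquiv m ℓ) (leadEquiv m ℓ) =
      Matrix.fromBlocks (lead M ℓ)
        (M.submatrix (Subtype.val : Lead m ℓ → Idx m) fun i => ⟨ℓ, i⟩)
        (M.submatrix (Subtype.val : Lead m ℓ → Idx m) fun i => ⟨ℓ, i⟩).conjTranspose
        (M.submatrix (fun i => (⟨ℓ, i⟩ : Idx m)) (fun i => ⟨ℓ, i⟩)) := by
  rw [Matrix.conjTranspose_submatrix, h.posDef.isHermitian.eq]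
  ext (p | i) (q | j) <;> rfl

theorem det_lead_succ (h : IsBlockSparse M)
    (hsp : ∀ p q, ¬ OnDiag (prev ℓ) p q → leadInv M ℓ p q = 0) :
    (lead M ((ℓ : ℕ) + 1)).det =
      (lead M ℓ).det * ∏ i, stageS M (leadInv M ℓ) ℓ ⟨ℓ, i⟩ := by
  rw [← Matrix.det_submatrix_equiv_self (leadEquiv m ℓ), h.lead_succ_submatrix,
    det_fromBlocks_of_mul_eq_one (h.lead_mul_inv ℓ), h.schur_eq hsp, Matrix.det_diagonal]

/-- The pivots are factors of the determinant of a leading principal block, which is positive. -/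
theorem stageS_ne_zero (h : IsBlockSparse M)
    (hsp : ∀ p q, ¬ OnDiag (prev ℓ) p q → leadInv M ℓ p q = 0) (i : Fin (2 ^ m ℓ)) :
    stageS M (leadInv M ℓ) ℓ ⟨ℓ, i⟩ ≠ 0 := by
  have h1 := (h.lead_posDef (ℓ + 1)).det_pos.ne'
  rw [h.det_lead_succ hsp] at h1
  exact (prod_ne_zero_iff.1 (right_ne_zero_of_mul h1)) i (mem_univ i)

theorem inv_lead_succ (h : IsBlockSparse M)
    (hsp : ∀ p q, ¬ OnDiag (prev ℓ) p q → leadInv M ℓ p q = 0) :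
    ((lead M ((ℓ : ℕ) + 1))⁻¹).submatrix (leadEquiv m ℓ) (leadEquiv m ℓ) =
      let G := Matrix.diagonal fun i => 1 / stageS M (leadInv M ℓ) ℓ ⟨ℓ, i⟩
      let K := (lead M ℓ)⁻¹ * M.submatrix (Subtype.val : Lead m ℓ → Idx m) fun i => ⟨ℓ, i⟩
      Matrix.fromBlocks ((lead M ℓ)⁻¹ + K * G * K.conjTranspose) (-(K * G))
        (-(G * K.conjTranspose)) G := by
  rw [← Matrix.inv_submatrix_equiv, h.lead_succ_submatrix]
  refine inv_fromBlocks_hermitian (h.lead_mul_inv ℓ) (h.lead_posDef ℓ).isHermitian.inv ?_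
  rw [h.schur_eq hsp, Matrix.diagonal_mul_diagonal, ← Matrix.diagonal_one]
  congr 1
  funext i
  exact mul_one_div_cancel (h.stageS_ne_zero hsp i)

theorem leadInv_succ_apply (x y : Lead m ℓ ⊕ Fin (2 ^ m ℓ)) :
    leadInv M ((ℓ : ℕ) + 1) (leadEquiv m ℓ x).1 (leadEquiv m ℓ y).1 =
      ((lead M ((ℓ : ℕ) + 1))⁻¹).submatrix (leadEquiv m ℓ) (leadEquiv m ℓ) x y :=
  leadInv_eq M _ _

theorem leadInv_succ_of_lt_of_lt (h : IsBlockSparse M)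
    (hsp : ∀ p q, ¬ OnDiag (prev ℓ) p q → leadInv M ℓ p q = 0) {p q : Idx m} (hp : p.1 < ℓ)
    (hq : q.1 < ℓ) :
    leadInv M ((ℓ : ℕ) + 1) p q = leadInv M ℓ p q + if OnDiag ℓ p q then
      stageH M (leadInv M ℓ) ℓ p * star (stageL M (leadInv M ℓ) ℓ q) else 0 := by
  refine (leadInv_succ_apply (Sum.inl ⟨p, hp⟩) (Sum.inl ⟨q, hq⟩)).trans ?_
  rw [h.inv_lead_succ hsp, Matrix.fromBlocks_apply₁₁, Matrix.add_apply,
    ← leadInv_eq M (⟨p, hp⟩ : Lead m ℓ) ⟨q, hq⟩, Matrix.mul_apply]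
  congr 1
  simp only [Matrix.mul_diagonal, Matrix.conjTranspose_apply, h.inv_mul_apply hsp,
    onDiag_iff_pos_eq, stageH, proj_eq]
  rw [sum_eq_single (pos ℓ p)]
  · by_cases e : pos ℓ p = pos ℓ q
    · simp [e]
    · simp [e, Ne.symm e]
  · intro i _ hi
    simp [Ne.symm hi]
  · simp

theorem leadInv_succ_of_lt_mk (h : IsBlockSparse M)
    (hsp : ∀ p q, ¬ OnDiag (prev ℓ) p q → leadInv M ℓ p q = 0) {p : Idx m} (hp : p.1 < ℓ)
    (i : Fin (2 ^ m ℓ)) :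
    leadInv M ((ℓ : ℕ) + 1) p ⟨ℓ, i⟩ =
      if pos ℓ p = i then -stageH M (leadInv M ℓ) ℓ p else 0 := by
  refine (leadInv_succ_apply (Sum.inl ⟨p, hp⟩) (Sum.inr i)).trans ?_
  rw [h.inv_lead_succ hsp, Matrix.fromBlocks_apply₁₂, Matrix.neg_apply, Matrix.mul_diagonal,
    h.inv_mul_apply hsp]
  by_cases e : pos ℓ p = i
  · subst e
    rw [if_pos rfl, if_pos rfl]
    rfl
  · rw [if_neg e, if_neg e, zero_mul, neg_zero]

theorem leadInv_mk_mk (h : IsBlockSparse M)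
    (hsp : ∀ p q, ¬ OnDiag (prev ℓ) p q → leadInv M ℓ p q = 0) (i j : Fin (2 ^ m ℓ)) :
    leadInv M ((ℓ : ℕ) + 1) ⟨ℓ, i⟩ ⟨ℓ, j⟩ =
      if i = j then 1 / stageS M (leadInv M ℓ) ℓ ⟨ℓ, i⟩ else 0 := by
  refine (leadInv_succ_apply (Sum.inr i) (Sum.inr j)).trans ?_
  rw [h.inv_lead_succ hsp, Matrix.fromBlocks_apply₂₂, Matrix.diagonal_apply]

theorem star_leadInv (h : IsBlockSparse M) (n : ℕ) (p q : Idx m) :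
    star (leadInv M n p q) = leadInv M n q p := by
  unfold leadInv
  by_cases hpq : (p.1 : ℕ) < n ∧ (q.1 : ℕ) < n
  · rw [dif_pos hpq, dif_pos hpq.symm]
    exact (h.lead_posDef n).isHermitian.inv.apply _ _
  · rw [dif_neg hpq, dif_neg (fun e => hpq e.symm), star_zero]

theorem leadInv_succ_mk_of_lt (h : IsBlockSparse M)
    (hsp : ∀ p q, ¬ OnDiag (prev ℓ) p q → leadInv M ℓ p q = 0) {p : Idx m} (hp : p.1 < ℓ)
    (i : Fin (2 ^ m ℓ)) :
    leadInv M ((ℓ : ℕ) + 1) ⟨ℓ, i⟩ p =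
      if pos ℓ p = i then -star (stageH M (leadInv M ℓ) ℓ p) else 0 := by
  rw [← h.star_leadInv, h.leadInv_succ_of_lt_mk hsp hp]
  split_ifs <;> simp

/-- The old inverse satisfies the finer congruence modulo n_{ℓ-1}. The correction HL* and the border
H carry one entry per row, at the residue mod n_ℓ, and G is diagonal. -/
theorem leadInv_succ_sparse (h : IsBlockSparse M)
    (hsp : ∀ p q, ¬ OnDiag (prev ℓ) p q → leadInv M ℓ p q = 0) {p q : Idx m}
    (hpq : ¬ OnDiag ℓ p q) : leadInv M ((ℓ : ℕ) + 1) p q = 0 := by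
  by_cases hlt : (p.1 : ℕ) < ℓ + 1 ∧ (q.1 : ℕ) < ℓ + 1
  · have hself : ∀ i : Fin (2 ^ m ℓ), pos ℓ (⟨ℓ, i⟩ : Idx m) = i := fun i =>
      proj_eq_mk_iff.1 (proj_self ⟨ℓ, i⟩)
    rw [onDiag_iff_pos_eq] at hpq
    have hc : ∀ r : Idx m, (r.1 : ℕ) < ℓ + 1 → r.1 < ℓ ∨ ∃ i, r = ⟨ℓ, i⟩ := fun r hr => by
      rcases Nat.lt_succ_iff_lt_or_eq.1 hr with h | h
      · exact Or.inl h
      · obtain ⟨a, i⟩ := r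
        obtain rfl : a = ℓ := Fin.ext h
        exact Or.inr ⟨i, rfl⟩
    rcases hc p hlt.1 with hp | ⟨i, rfl⟩ <;> rcases hc q hlt.2 with hq | ⟨j, rfl⟩
    · rw [h.leadInv_succ_of_lt_of_lt hsp hp hq, if_neg (fun e => hpq (onDiag_iff_pos_eq.1 e)),
        add_zero]
      exact hsp p q fun e => hpq (onDiag_iff_pos_eq.1 (e.of_le (h.antitone (prev_le ℓ))))
    · rw [h.leadInv_succ_of_lt_mk hsp hp, if_neg]
      rwa [hself] at hpq
    · rw [h.leadInv_succ_mk_of_lt hsp hq, if_neg]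
      rw [hself] at hpq
      exact Ne.symm hpq
    · rw [h.leadInv_mk_mk hsp, if_neg]
      rwa [hself, hself] at hpq
  · exact dif_neg hlt

end Step

/-- Induction over the tasks discharges the sparsity hypothesis of the step lemmas. For the first
task there are no leading blocks, and the extension by zero gives the claim. -/
theorem leadInv_sparse (h : IsBlockSparse M) : ∀ (n : ℕ) (ℓ : Fin L), (ℓ : ℕ) = n → ∀ p q,
    ¬ OnDiag (prev ℓ) p q → leadInv M ℓ p q = 0
  | 0, ℓ, hn, p, q, _ => dif_neg (by rw [hn]; simp)
  | n + 1, ℓ, hn, p, q, hpq => by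
    have hprev : (prev ℓ : ℕ) = n := by
      show (ℓ : ℕ) - 1 = n
      omega
    have := h.leadInv_succ_sparse (h.leadInv_sparse n (prev ℓ) hprev) hpq
    rwa [hprev, ← hn] at this

end IsBlockSparse

end FastMTGP

namespace FastMTGP
open Finset
open scoped ComplexOrder

variable {L : ℕ} {m : Fin L → ℕ} {k : Idx m → Idx m → ℂ}

/-! ### Correctness of the inversion algorithm -/

theorem stored_proj {ℓ : Fin L} {p : Idx m} (h : p.1 ≤ ℓ) : Stored p (proj ℓ p) := ⟨h, rfl⟩

theorem stored_self (p : Idx m) : Stored p p := ⟨le_rfl, proj_self p⟩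

section Congr

variable {M M' A A' : Idx m → Idx m → ℂ} {ℓ : Fin L}

/-- The formulas of a stage read M only at stored entries and A only on the diagonals of its
subblocks, so the contents of the other registers do not matter. -/
theorem stageL_congr (hM : ∀ p q, Stored p q → M p q = M' p q)
    (hA : ∀ p q : Idx m, p.1 < ℓ → q.1 < ℓ → OnDiag (prev ℓ) p q → A p q = A' p q) {p : Idx m}
    (hp : p.1 < ℓ) : stageL M A ℓ p = stageL M' A' ℓ p := by
  refine sum_congr rfl fun q hq => ?_
  obtain ⟨h1, h2⟩ := (mem_filter.1 hq).2
  rw [hA p q hp h1 h2, hM _ _ (stored_proj h1.le)]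

theorem stageS_congr (hM : ∀ p q, Stored p q → M p q = M' p q)
    (hA : ∀ p q : Idx m, p.1 < ℓ → q.1 < ℓ → OnDiag (prev ℓ) p q → A p q = A' p q) (r : Idx m) :
    stageS M A ℓ r = stageS M' A' ℓ r := by
  unfold stageS
  rw [hM _ _ (stored_self r)]
  congr 1
  refine sum_congr rfl fun p hp => ?_
  have h1 := (mem_filter.1 hp).2.1
  rw [stageL_congr hM hA h1, hM _ _ (stored_proj h1.le)]

theorem stageH_congr (hM : ∀ p q, Stored p q → M p q = M' p q)
    (hA : ∀ p q : Idx m, p.1 < ℓ → q.1 < ℓ → OnDiag (prev ℓ) p q → A p q = A' p q) {p : Idx m}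
    (hp : p.1 < ℓ) : stageH M A ℓ p = stageH M' A' ℓ p := by
  unfold stageH
  rw [stageL_congr hM hA hp, stageS_congr hM hA]

end Congr

/-- Without preceding tasks the correction is an empty sum; the first stage is thus covered by the
same formulas as the others. -/
theorem stageS_of_eq_zero {M A : Idx m → Idx m → ℂ} {ℓ : Fin L} (hℓ : (ℓ : ℕ) = 0) (r : Idx m) :
    stageS M A ℓ r = M r r := by
  rw [stageS, sum_eq_zero, sub_zero]
  intro p hp
  have h1 : (p.1 : ℕ) < ℓ := (mem_filter.1 hp).2.1
  omega

/-- The state of the algorithm after the first `n` stages. -/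
structure InvState (M : Matrix (Idx m) (Idx m) ℂ) (n : ℕ) (τ : Reg m → ℂ) : Prop where
  lam : ∀ p q, Stored p q → τ (.lam p q) = M p q
  matA : ∀ e : Fin L, (e : ℕ) + 1 = n → ∀ p q : Idx m, p.1 ≤ e → q.1 ≤ e → OnDiag e p q →
    τ (.matA p q) = leadInv M n p q
  det : 0 < n → τ .det = (lead M n).det
  matS : ∀ p : Idx m, 0 < (p.1 : ℕ) → (p.1 : ℕ) < n →
    τ (.matS p) = stageS M (leadInv M p.1) p.1 p

theorem onDiag_self_iff {p q : Idx m} (h : p.1 = q.1) : OnDiag p.1 p q ↔ p = q := by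
  rw [onDiag_iff_proj_eq, proj_self, h, proj_self]

namespace IsBlockSparse

variable {M : Matrix (Idx m) (Idx m) ℂ}

theorem exists_runs_firstStage (h : IsBlockSparse M) {ℓ : Fin L} (hℓ : (ℓ : ℕ) = 0)
    {σ : Reg m → ℂ} (hσ : InvState M ℓ σ) :
    ∃ τ, Runs k (firstStage m ℓ) σ τ ∧ InvState M (ℓ + 1) τ := by
  have hsp := h.leadInv_sparse ℓ ℓ rfl
  have hlam : ∀ r : Idx m, r.1 = ℓ →
      σ (.lam r r) = stageS M (leadInv M ℓ) ℓ r := fun r _ => by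
    rw [hσ.lam _ _ (stored_self r)]
    exact (stageS_of_eq_zero hℓ r).symm
  have hS : ∀ r : Idx m, r.1 = ℓ → stageS M (leadInv M ℓ) ℓ r ≠ 0 := by
    rintro ⟨_, i⟩ rfl
    exact h.stageS_ne_zero hsp i
  have key := FastMTGP.exists_runs_firstStage (k := k) ℓ σ
    (fun r hr => by rw [hlam r hr]; exact hS r hr)
  generalize firstStage m ℓ = prog at key ⊢
  obtain ⟨τ, h1, h2, h3, h4⟩ := key
  refine ⟨τ, h1, ⟨fun p q hpq => by rw [h3, hσ.lam p q hpq], ?_, fun _ => ?_, ?_⟩⟩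
  · intro e he p q hp hq hpq
    obtain rfl : e = ℓ := Fin.ext (by omega)
    have hp' : p.1 = e := le_antisymm hp (Fin.le_def.2 (by omega))
    have hq' : q.1 = e := le_antisymm hq (Fin.le_def.2 (by omega))
    subst hp'
    obtain rfl : p = q := (onDiag_self_iff hq'.symm).1 hpq
    rw [h2 p rfl, hlam p rfl]
    have := h.leadInv_mk_mk hsp p.2 p.2
    rw [if_pos rfl] at this
    exact this.symm
  · rw [h4, h.det_lead_succ hsp]
    have : IsEmpty (Lead m ℓ) := ⟨fun p => by have := p.2; omega⟩
    rw [Matrix.det_isEmpty, one_mul]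
    exact prod_congr rfl fun i _ => hlam _ rfl
  · intro p h1 h2
    omega

theorem exists_runs_stage (h : IsBlockSparse M) {ℓ : Fin L} (hℓ : (ℓ : ℕ) ≠ 0)
    {σ : Reg m → ℂ} (hσ : InvState M ℓ σ) :
    ∃ τ, Runs k (stage m ℓ) σ τ ∧ InvState M (ℓ + 1) τ := by
  have hsp := h.leadInv_sparse ℓ ℓ rfl
  have hprev : (prev ℓ : ℕ) + 1 = ℓ := by
    show (ℓ : ℕ) - 1 + 1 = ℓ
    omega
  have hA : ∀ p q : Idx m, p.1 < ℓ → q.1 < ℓ → OnDiag (prev ℓ) p q →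
      σ (.matA p q) = leadInv M ℓ p q := fun p q hp hq hpq =>
    hσ.matA (prev ℓ) hprev p q (Fin.le_def.2 (by have := Fin.lt_def.1 hp; omega))
      (Fin.le_def.2 (by have := Fin.lt_def.1 hq; omega)) hpq
  obtain ⟨M', hM'⟩ : ∃ M' : Idx m → Idx m → ℂ, ∀ p q, σ (.lam p q) = M' p q :=
    ⟨_, fun _ _ => rfl⟩
  obtain ⟨A', hA'⟩ : ∃ A' : Idx m → Idx m → ℂ, ∀ p q, σ (.matA p q) = A' p q :=
    ⟨_, fun _ _ => rfl⟩
  have cM : ∀ p q, Stored p q → M' p q = M p q := fun p q hpq => by rw [← hM', hσ.lam p q hpq]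
  have cA : ∀ p q : Idx m, p.1 < ℓ → q.1 < ℓ → OnDiag (prev ℓ) p q →
      A' p q = leadInv M ℓ p q := fun p q hp hq hpq => by rw [← hA', hA p q hp hq hpq]
  have eL := fun {p : Idx m} (hp : p.1 < ℓ) => stageL_congr cM cA hp
  have eS := stageS_congr cM cA
  have eH := fun {p : Idx m} (hp : p.1 < ℓ) => stageH_congr cM cA hp
  have hS : ∀ r : Idx m, r.1 = ℓ → stageS M (leadInv M ℓ) ℓ r ≠ 0 := by
    rintro ⟨_, i⟩ rfl
    exact h.stageS_ne_zero hsp i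
  have key := FastMTGP.exists_runs_stage (k := k) ℓ σ hM' hA'
    (fun r hr => by rw [eS]; exact hS r hr)
  generalize stage m ℓ = prog at key ⊢
  obtain ⟨τ, h1, h2, h3, h4, h5, h6, h7, h8⟩ := key
  refine ⟨τ, h1, ⟨fun p q hpq => by rw [h7, hσ.lam p q hpq], ?_, fun _ => ?_, ?_⟩⟩
  · intro e he p q hp hq hpq
    obtain rfl : e = ℓ := Fin.ext (by omega)
    -- The four cases are the blocks M, −H, −H* and G of the new inverse.
    rcases hp.lt_or_eq with hp | hp <;> rcases hq.lt_or_eq with hq | hq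
    · rw [h2 p q hp hq hpq, eH hp, eL hq, h.leadInv_succ_of_lt_of_lt hsp hp hq, if_pos hpq]
      congr 1
      split_ifs with hd
      · exact cA p q hp hq hd
      · exact (hsp p q hd).symm
    · subst hq
      have e1 : proj q.1 p = q := (onDiag_iff_proj_eq.1 hpq).trans (proj_self q)
      have e2 := (h3 p hp).1
      rw [e1] at e2
      rw [e2, eH hp]
      have := h.leadInv_succ_of_lt_mk hsp hp q.2
      rw [if_pos (proj_eq_mk_iff.1 e1)] at this
      exact this.symm
    · subst hp
      have e1 : proj p.1 q = p := (onDiag_iff_proj_eq.1 hpq).symm.trans (proj_self p)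
      have e2 := (h3 q hq).2
      rw [e1] at e2
      rw [e2, eH hq]
      have := h.leadInv_succ_mk_of_lt hsp hq p.2
      rw [if_pos (proj_eq_mk_iff.1 e1)] at this
      exact this.symm
    · subst hp
      obtain rfl : p = q := (onDiag_self_iff hq.symm).1 hpq
      rw [h4 p rfl, eS]
      have := h.leadInv_mk_mk hsp p.2 p.2
      rw [if_pos rfl] at this
      exact this.symm
  · rw [h8, h.det_lead_succ hsp, hσ.det (by omega)]
    congr 1
    exact prod_congr rfl fun i _ => eS _
  · intro p hp0 hp
    rcases Nat.lt_succ_iff_lt_or_eq.1 hp with hlt | heq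
    · rw [h6 p (fun e => by rw [e] at hlt; omega), hσ.matS p hp0 hlt]
    · have heq : p.1 = ℓ := Fin.ext heq
      subst heq
      rw [h5 p rfl, eS]

theorem lead_submatrix (M : Matrix (Idx m) (Idx m) ℂ) :
    lead M L = M.submatrix (Equiv.subtypeUnivEquiv fun p : Idx m => p.1.isLt)
      (Equiv.subtypeUnivEquiv fun p : Idx m => p.1.isLt) := rfl

theorem leadInv_eq_inv (M : Matrix (Idx m) (Idx m) ℂ) (p q : Idx m) :
    leadInv M L p q = M⁻¹ p q := by
  rw [leadInv, dif_pos ⟨p.1.isLt, q.1.isLt⟩, lead_submatrix, Matrix.inv_submatrix_equiv]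
  rfl

theorem inv_sparse (h : IsBlockSparse M) (hL : 0 < L) {p q : Idx m}
    (hpq : ¬ OnDiag (lastTask hL) p q) : M⁻¹ p q = 0 := by
  have := h.leadInv_succ_sparse (h.leadInv_sparse _ (lastTask hL) rfl) hpq
  have e : (lastTask hL : ℕ) + 1 = L := Nat.sub_add_cancel hL
  rwa [e, leadInv_eq_inv] at this

theorem schur_isDiag (h : IsBlockSparse M) (ℓ : Fin L) : (schur M ℓ).IsDiag := by
  rw [h.schur_eq_diagonal (h.leadInv_sparse ℓ ℓ rfl)]
  exact Matrix.isDiag_diagonal _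

theorem exists_runs_invDet (h : IsBlockSparse M) (hL : 0 < L) {σ : Reg m → ℂ}
    (hσ : ∀ p q, Stored p q → σ (.lam p q) = M p q) :
    ∃ τ, Runs k (invDet m) σ τ ∧
      (∀ p q, OnDiag (lastTask hL) p q → τ (.matA p q) = M⁻¹ p q) ∧ τ .det = M.det ∧
      ∀ p : Idx m, 0 < (p.1 : ℕ) → τ (.matS p) = schur M p.1 p.2 p.2 := by
  obtain ⟨τ, h1, h2⟩ := exists_runs_flatMap (k := k)
    (fun ℓ : Fin L => if (ℓ : ℕ) = 0 then firstStage m ℓ else stage m ℓ)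
    -- The invariant counts completed stages. Initially only `lam` is constrained: the condition on
    -- `matA` needs a last completed stage.
    (fun done τ => InvState M done.length τ) (List.finRange L) [] σ
    ⟨hσ, fun e he => by simp at he, by simp, by simp⟩ (by
      intro pre ℓ post e σ' hσ'
      have hℓ : (ℓ : ℕ) = pre.length := by
        have h1 : (List.finRange L)[pre.length]? = some ℓ := by rw [e]; simp
        obtain ⟨h2, h3⟩ := List.getElem?_eq_some_iff.1 h1
        rw [List.getElem_finRange] at h3
        rw [← h3]; rfl
      simp only [List.nil_append, List.length_append, List.length_singleton] at hσ' ⊢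
      rw [← hℓ] at hσ' ⊢
      split_ifs with h0
      · exact h.exists_runs_firstStage h0 hσ'
      · exact h.exists_runs_stage h0 hσ')
  simp only [List.nil_append, List.length_finRange] at h2
  have e : (lastTask hL : ℕ) + 1 = L := Nat.sub_add_cancel hL
  refine ⟨τ, h1, ?_, ?_, ?_⟩
  · intro p q hpq
    rw [h2.matA _ e p q (Fin.le_def.2 (by omega)) (Fin.le_def.2 (by omega)) hpq, leadInv_eq_inv]
  · rw [h2.det hL, lead_submatrix, Matrix.det_submatrix_equiv_self]
  · intro p hp
    rw [h2.matS p hp p.1.isLt, h.schur_eq_diagonal (h.leadInv_sparse _ p.1 rfl),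
      Matrix.diagonal_apply_eq]

end IsBlockSparse

end FastMTGP

namespace FastMTGP
open Finset

variable {L : ℕ} {m : Fin L → ℕ} {kc : ℕ}

/-! ### Numbers of operations -/

theorem cost_append (a b : Program m) : cost kc (a ++ b) = cost kc a + cost kc b := by
  simp [cost]

theorem cost_nil : cost kc ([] : Program m) = 0 := rfl

theorem cost_cons (i : Instr m) (a : Program m) : cost kc (i :: a) = i.cost kc + cost kc a := by
  simp [cost]

theorem cost_flatMap {α : Type*} (l : List α) (f : α → Program m) :
    cost kc (l.flatMap f) = (l.map fun a => cost kc (f a)).sum := by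
  induction l with
  | nil => rfl
  | cons a l ih => rw [List.flatMap_cons, cost_append, ih, List.map_cons, List.sum_cons]

theorem cost_flatMap_const {α : Type*} (l : List α) (f : α → Program m) {c : ℕ}
    (h : ∀ a, cost kc (f a) = c) : cost kc (l.flatMap f) = l.length * c := by
  rw [cost_flatMap, funext h]
  simp

theorem cost_map_const {α : Type*} (l : List α) (f : α → Instr m) {c : ℕ}
    (h : ∀ a, (f a).cost kc = c) : cost kc (l.map f) = l.length * c := by
  rw [cost, List.map_map, show Instr.cost kc ∘ f = fun _ => c from funext h]
  simp

/-- With four instructions per butterfly, T(n+1) = 2T(n) + 4·2^n. -/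
theorem cost_fastStar (v : Variant) : ∀ (n : ℕ) (r : ℕ → Reg m),
    cost kc (fastStar v n r) = 2 * n * 2 ^ n
  | 0, _ => rfl
  | n + 1, r => by
    rw [fastStar, cost_append, cost_append, cost_fastStar v n, cost_fastStar v n,
      cost_flatMap_const (c := 4) _ _ (fun _ => rfl), List.length_range]
    ring

theorem cost_fastTransform (v : Variant) : ∀ (n : ℕ) (r : ℕ → Reg m),
    cost kc (fastTransform v n r) = 2 * n * 2 ^ n
  | 0, _ => rfl
  | n + 1, r => by
    rw [fastTransform, cost_append, cost_append, cost_fastTransform v n, cost_fastTransform v n,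
      cost_flatMap_const (c := 4) _ _ (fun _ => rfl), List.length_range]
    ring

theorem length_rows (ℓ : Fin L) : (rows m ℓ).length = 2 ^ m ℓ := by simp [rows]

theorem cost_evalBlock_le (v : Variant) (ℓ ℓ' : Fin L) :
    cost kc (evalBlock v m ℓ ℓ') ≤ kc * 2 ^ m ℓ + 2 * m ℓ * 2 ^ m ℓ + 3 * 2 ^ m ℓ := by
  have h1 : cost kc (if ℓ = ℓ' then [Instr.add (.lam (idx m ℓ 0) (idx m ℓ' 0))
      (.lam (idx m ℓ 0) (idx m ℓ' 0)) (.noise ℓ)] else []) ≤ 1 := by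
    split_ifs
    · exact le_rfl
    · exact Nat.zero_le _
  have h2 : 1 ≤ 2 ^ m ℓ := Nat.one_le_two_pow
  rw [evalBlock, cost_append, cost_append, cost_append, cost_append, cost_fastStar,
    cost_map_const (c := kc) _ _ (fun _ => rfl), cost_map_const (c := 1) _ _ (fun _ => rfl),
    List.length_range, cost_cons, cost_nil]
  simp only [Instr.cost]
  nlinarith

theorem one_le_size (ℓ : Fin L) : 1 ≤ size m ℓ := one_le_pow₀ one_le_two

theorem size_pos (ℓ : Fin L) : 0 < size m ℓ := zero_lt_one.trans_le (one_le_size ℓ)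

/-- Binary logarithms are traded for natural ones by log 2 > 1/2. Since a task of size 1 has
logarithm 0, the linear terms of the costs are kept separate. -/
theorem mul_size_le (ℓ : Fin L) : m ℓ * size m ℓ ≤ 2 * (size m ℓ * Real.log (size m ℓ)) := by
  have h1 := Real.log_two_gt_d9
  have h2 : Real.log (size m ℓ) = m ℓ * Real.log 2 := by rw [size, Real.log_pow]
  have h3 : (0 : ℝ) ≤ m ℓ * size m ℓ := mul_nonneg (Nat.cast_nonneg _) (size_pos ℓ).le
  rw [h2]
  nlinarith

theorem log_size_nonneg (ℓ : Fin L) : 0 ≤ size m ℓ * Real.log (size m ℓ) :=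
  mul_nonneg (size_pos ℓ).le (Real.log_nonneg (one_le_size ℓ))

theorem sum_le_filter (f : Fin L → ℝ) :
    ∑ a ∈ univ.filter (fun a : Fin L × Fin L => a.1 ≤ a.2), f a.1 =
      ∑ ℓ : Fin L, ((L : ℝ) - (ℓ : ℕ)) * f ℓ := by
  rw [sum_filter, ← univ_product_univ, sum_product]
  refine sum_congr rfl fun ℓ _ => ?_
  have : (univ.filter fun ℓ' : Fin L => ℓ ≤ ℓ') = Finset.Ici ℓ := by ext; simp
  change (∑ ℓ' : Fin L, if ℓ ≤ ℓ' then f ℓ else 0) = _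
  rw [← sum_filter, sum_const, nsmul_eq_mul, this, Fin.card_Ici, Nat.cast_sub ℓ.isLt.le]

/-- Per block, the kernel evaluations cost at most κ d n_ℓ, the transform at most 4 n_ℓ log n_ℓ, and
the remaining 3 n_ℓ are absorbed by d n_ℓ; 7 = 4 + 3. -/
theorem cost_evalLam_le {κ d : ℕ} (hd : 0 < d) (hkc : kc ≤ κ * d) (v : Variant) :
    (cost kc (evalLam v m) : ℝ) ≤ (κ + 7) * triLog d m := by
  rw [evalLam, cost_flatMap, Finset.sum_map_toList, triLog,
    ← sum_le_filter fun ℓ => size m ℓ * Real.log (size m ℓ) + (d : ℝ) * size m ℓ, mul_sum]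
  push_cast
  refine sum_le_sum fun a _ => ?_
  have h1 : (cost kc (evalBlock v m a.1 a.2) : ℝ) ≤
      kc * size m a.1 + 2 * m a.1 * size m a.1 + 3 * size m a.1 := by
    have := cost_evalBlock_le (kc := kc) (m := m) v a.1 a.2
    unfold size
    exact_mod_cast this
  have h2 : (kc : ℝ) ≤ κ * d := by exact_mod_cast hkc
  have h3 := mul_size_le (m := m) a.1
  have h4 := size_pos (m := m) a.1
  have h5 := log_size_nonneg (m := m) a.1
  have h6 : (1 : ℝ) ≤ d := by exact_mod_cast hd
  have h7 : (kc : ℝ) * size m a.1 ≤ κ * d * size m a.1 := by gcongr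
  have h8 : 1 * size m a.1 ≤ d * size m a.1 := by gcongr
  have h9 : 0 ≤ (κ : ℝ) * (size m a.1 * Real.log (size m a.1)) := by positivity
  nlinarith

theorem card_stored : ((#{a : Idx m × Fin L | a.1.1 ≤ a.2} : ℕ) : ℝ) = tri m := by
  rw [card_filter, ← univ_product_univ, sum_product, Fintype.sum_sigma, tri]
  push_cast
  refine sum_congr rfl fun ℓ _ => ?_
  have h : ∀ i : Fin (2 ^ m ℓ), (∑ ℓ' : Fin L, if ((⟨ℓ, i⟩ : Idx m), ℓ').1.1 ≤
      ((⟨ℓ, i⟩ : Idx m), ℓ').2 then (1 : ℝ) else 0) = (L : ℝ) - (ℓ : ℕ) := by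
    intro i
    rw [← sum_filter, sum_const, nsmul_eq_mul, mul_one]
    have : (univ.filter fun ℓ' : Fin L => ℓ ≤ ℓ') = Finset.Ici ℓ := by ext; simp
    rw [show (univ.filter fun ℓ' : Fin L => ((⟨ℓ, i⟩ : Idx m), ℓ').1.1 ≤
      ((⟨ℓ, i⟩ : Idx m), ℓ').2) = Finset.Ici ℓ from this, Fin.card_Ici, Nat.cast_sub ℓ.isLt.le]
  rw [sum_congr rfl fun i _ => h i, sum_const, nsmul_eq_mul, card_univ, Fintype.card_fin, size]
  push_cast
  ring

theorem total_le_tri : total m ≤ tri m := by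
  refine sum_le_sum fun ℓ _ => ?_
  have h1 : ((ℓ : ℕ) : ℝ) + 1 ≤ L := by exact_mod_cast ℓ.isLt
  have h2 := size_pos (m := m) ℓ
  nlinarith

theorem cost_mulLam_le : (cost kc (mulLam m) : ℝ) ≤ 5 * tri m := by
  have h1 : #{a : Idx m × Fin L | a.1.1 < a.2} ≤ #{a : Idx m × Fin L | a.1.1 ≤ a.2} :=
    card_le_card fun a ha => by
      simp only [mem_filter, mem_univ, true_and] at ha ⊢
      exact ha.le
  have h2 : cost kc (mulLam m) ≤ 5 * #{a : Idx m × Fin L | a.1.1 ≤ a.2} := by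
    rw [mulLam, cost_append, cost_flatMap_const (c := 2) _ _ (fun _ => rfl),
      cost_flatMap_const (c := 3) _ _ (fun _ => rfl), Finset.length_toList, Finset.length_toList]
    omega
  rw [← card_stored]
  exact_mod_cast h2

theorem sum_map_finRange (f : Fin L → ℕ) : ((List.finRange L).map f).sum = ∑ ℓ, f ℓ :=
  (Fin.sum_univ_def f).symm

theorem cost_sandwich_le (v : Variant) (mid : Program m) :
    (cost kc (sandwich v m mid) : ℝ) ≤ 8 * sumLog m + 5 * total m + cost kc mid := by
  have h : cost kc (sandwich v m mid) =
      ∑ ℓ : Fin L, (4 * (m ℓ * 2 ^ m ℓ) + 3 * 2 ^ m ℓ + 2) + cost kc mid := by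
    rw [sandwich, cost_append, cost_append, cost_flatMap, cost_flatMap, sum_map_finRange,
      sum_map_finRange, add_comm (cost kc mid), ← add_assoc, ← sum_add_distrib]
    congr 1
    refine sum_congr rfl fun ℓ _ => ?_
    simp only [cost_append, cost_fastStar, cost_fastTransform, cost_cons, cost_nil, Instr.cost]
    rw [cost_map_const (c := 1) _ _ (fun _ => rfl), cost_map_const (c := 1) _ _ (fun _ => rfl),
      cost_map_const (c := 1) _ _ (fun _ => rfl), length_rows]
    ring
  rw [h, sumLog, total, mul_sum, mul_sum, ← sum_add_distrib]
  push_cast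
  refine add_le_add (sum_le_sum fun ℓ _ => ?_) le_rfl
  have h1 := mul_size_le (m := m) ℓ
  have h2 := one_le_size (m := m) ℓ
  unfold size at *
  linarith

/-! ### Sizes of the storage patterns -/

/-- A number with a given remainder is determined by its quotient, which has 2^(b−a) possible
values. -/
theorem card_mod_eq_le {a b : ℕ} (hab : a ≤ b) (c : ℕ) :
    #{i : Fin (2 ^ b) | c = (i : ℕ) % 2 ^ a} * 2 ^ a ≤ 2 ^ b := by
  have hb : 2 ^ b = 2 ^ (b - a) * 2 ^ a := by rw [← pow_add, Nat.sub_add_cancel hab]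
  have h : #{i : Fin (2 ^ b) | c = (i : ℕ) % 2 ^ a} ≤ #(range (2 ^ (b - a))) := by
    refine card_le_card_of_injOn (fun i => (i : ℕ) / 2 ^ a) ?_ ?_
    · intro i _
      have := i.isLt
      simp only [coe_range, Set.mem_Iio]
      rw [Nat.div_lt_iff_lt_mul (Nat.two_pow_pos a), ← hb]
      exact this
    · intro i hi j hj hij
      have hi : c = (i : ℕ) % 2 ^ a := by simpa using hi
      have hj : c = (j : ℕ) % 2 ^ a := by simpa using hj
      have hij : (i : ℕ) / 2 ^ a = (j : ℕ) / 2 ^ a := hij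
      refine Fin.ext ?_
      rw [← Nat.div_add_mod (i : ℕ) (2 ^ a), ← Nat.div_add_mod (j : ℕ) (2 ^ a), hij, ← hi, ← hj]
  rw [card_range] at h
  calc _ ≤ 2 ^ (b - a) * 2 ^ a := Nat.mul_le_mul_right _ h
    _ = 2 ^ b := hb.symm

theorem card_onDiag_mul_le {c : Fin L → Prop} [DecidablePred c] {e : Fin L}
    (hc : ∀ ℓ, c ℓ → m e ≤ m ℓ) (p : Idx m) :
    #{q : Idx m | c q.1 ∧ OnDiag e p q} * 2 ^ m e ≤ ∑ ℓ with c ℓ, 2 ^ m ℓ := by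
  rw [card_filter, Fintype.sum_sigma, sum_mul, sum_filter]
  refine sum_le_sum fun ℓ _ => ?_
  by_cases h : c ℓ
  · simp only [h, true_and, if_true]
    rw [← card_filter]
    exact card_mod_eq_le (hc ℓ h) _
  · simp [h]

theorem card_idx_filter {c : Fin L → Prop} [DecidablePred c] :
    #{q : Idx m | c q.1} = ∑ ℓ with c ℓ, 2 ^ m ℓ := by
  rw [card_filter, Fintype.sum_sigma, sum_filter]
  refine sum_congr rfl fun ℓ _ => ?_
  by_cases h : c ℓ <;> simp [h]

/-- Each index is congruent modulo n_e to at most a fraction 1/n_e of the selected indices, because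
n_e divides the sizes of the selected tasks. -/
theorem card_pairs_mul_le {c : Fin L → Prop} [DecidablePred c] {e : Fin L}
    (hc : ∀ ℓ, c ℓ → m e ≤ m ℓ) :
    #{a : Idx m × Idx m | c a.1.1 ∧ c a.2.1 ∧ OnDiag e a.1 a.2} * 2 ^ m e ≤
      (∑ ℓ with c ℓ, 2 ^ m ℓ) ^ 2 := by
  have h : #{a : Idx m × Idx m | c a.1.1 ∧ c a.2.1 ∧ OnDiag e a.1 a.2} =
      ∑ p : Idx m with c p.1, #{q : Idx m | c q.1 ∧ OnDiag e p q} := by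
    rw [card_filter, ← univ_product_univ, sum_product, sum_filter]
    refine sum_congr rfl fun p _ => ?_
    by_cases h : c p.1 <;> simp [h]
  rw [h, sum_mul]
  refine (sum_le_card_nsmul _ _ _ fun p _ => card_onDiag_mul_le hc p).trans ?_
  rw [card_idx_filter, smul_eq_mul, sq]

theorem length_eq_card {α : Type*} [Fintype α] [DecidableEq α] {l : List α} (hl : l.Nodup)
    {c : α → Prop} [DecidablePred c] (hc : ∀ a, a ∈ l ↔ c a) : l.length = #{a | c a} := by
  rw [← List.toFinset_card_of_nodup hl]
  congr 1
  ext a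
  simp [hc]

theorem length_before (ℓ : Fin L) : (before m ℓ).length = ∑ ℓ' ∈ Iio ℓ, 2 ^ m ℓ' := by
  rw [length_eq_card (nodup_before ℓ) (fun a => mem_before), card_idx_filter (c := fun a => a < ℓ)]
  exact sum_congr (by ext; simp) fun _ _ => rfl

theorem length_pairs_mul_le {ℓ e : Fin L} (he : m ℓ ≤ m e)
    (hc : ∀ ℓ' < ℓ, m e ≤ m ℓ') :
    (pairs m ℓ e).length * 2 ^ m ℓ ≤ (∑ ℓ' ∈ Iio ℓ, 2 ^ m ℓ') ^ 2 := by
  rw [length_eq_card (nodup_pairs ℓ e) (fun a => mem_pairs)]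
  refine (Nat.mul_le_mul_left _ (Nat.pow_le_pow_right two_pos he)).trans ?_
  refine (card_pairs_mul_le (c := fun a => a < ℓ) hc).trans_eq ?_
  congr 1
  exact sum_congr (by ext; simp) fun _ _ => rfl

theorem cost_stage (ℓ : Fin L) : cost kc (stage m ℓ) = 6 * 2 ^ m ℓ + 1 + 9 * (before m ℓ).length +
    2 * (pairs m ℓ (prev ℓ)).length + 4 * (pairs m ℓ ℓ).length := by
  have hif : ∀ pq : Idx m × Idx m, Instr.cost kc (if OnDiag (prev ℓ) pq.1 pq.2 then
      .add (.matM pq.1 pq.2) (.matA pq.1 pq.2) (.matJ pq.1 pq.2)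
    else .copy (.matM pq.1 pq.2) (.matJ pq.1 pq.2)) = 1 := fun pq => by split_ifs <;> rfl
  simp only [stage_eq, stageFst, stageSnd, stageThd, cost_append]
  rw [cost_map_const (c := 1) _ _ hif, cost_flatMap_const (c := 2) _ _ (fun _ => rfl),
    cost_flatMap_const (c := 3) _ _ (fun _ => rfl), cost_flatMap_const (c := 2) _ _ (fun _ => rfl),
    cost_flatMap_const (c := 3) _ _ (fun _ => rfl),
    cost_map_const (c := 1) _ _ (fun _ => rfl),
    cost_map_const (c := 1) _ _ (fun _ => rfl),
    cost_map_const (c := 1) _ _ (fun _ => rfl),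
    cost_map_const (c := 1) _ _ (fun _ => rfl),
    cost_map_const (c := 1) _ _ (fun _ => rfl),
    cost_map_const (c := 1) _ _ (fun _ => rfl),
    cost_map_const (c := 1) _ _ (fun _ => rfl),
    cost_map_const (c := 1) _ _ (fun _ => rfl),
    cost_map_const (c := 1) _ _ (fun _ => rfl),
    cost_map_const (c := 1) _ _ (fun _ => rfl)]
  simp only [length_rows, cost_cons, cost_nil, Instr.cost]
  ring

/-- Let B be the total size of the preceding tasks, so that n_ℓ ≤ n_{ℓ-1} ≤ B. Each of the 6 + 1 + 9
+ 2 + 4 = 22 units in the exact count, multiplied by n_ℓ, is at most B². -/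
theorem cost_stage_mul_le (hm : Antitone m) {ℓ : Fin L} (hℓ : 0 < (ℓ : ℕ)) :
    cost kc (stage m ℓ) * 2 ^ m ℓ ≤ 22 * (∑ ℓ' ∈ Iio ℓ, 2 ^ m ℓ') ^ 2 := by
  have hprev : prev ℓ < ℓ := Fin.lt_def.2 (Nat.sub_lt hℓ one_pos)
  have h1 := length_pairs_mul_le (ℓ := ℓ) (e := prev ℓ) (hm hprev.le)
    (fun ℓ' h => hm (Fin.le_def.2 (by
      show (ℓ' : ℕ) ≤ ℓ - 1
      have := Fin.lt_def.1 h
      omega)))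
  have h2 := length_pairs_mul_le (ℓ := ℓ) (e := ℓ) le_rfl (fun ℓ' h => hm h.le)
  have h3 : 2 ^ m ℓ ≤ ∑ ℓ' ∈ Iio ℓ, 2 ^ m ℓ' :=
    (Nat.pow_le_pow_right two_pos (hm hprev.le)).trans
      (single_le_sum (f := fun ℓ' => 2 ^ m ℓ') (fun _ _ => Nat.zero_le _) (mem_Iio.2 hprev))
  have h4 : 1 ≤ 2 ^ m ℓ := Nat.one_le_two_pow
  rw [cost_stage, length_before]
  generalize ∑ ℓ' ∈ Iio ℓ, 2 ^ m ℓ' = B at *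
  generalize 2 ^ m ℓ = n at *
  have h5 : n * n ≤ B ^ 2 := by rw [sq]; exact Nat.mul_le_mul h3 h3
  have h6 : B * n ≤ B ^ 2 := by rw [sq]; exact Nat.mul_le_mul_left _ h3
  have h7 : 1 * n ≤ n * n := Nat.mul_le_mul_right _ h4
  nlinarith

theorem cost_firstStage_le (ℓ : Fin L) : cost kc (firstStage m ℓ) ≤ 5 * 2 ^ m ℓ := by
  have h4 : 1 ≤ 2 ^ m ℓ := Nat.one_le_two_pow
  simp only [firstStage, cost_append]
  rw [cost_map_const (c := 1) _ _ (fun _ => rfl), cost_map_const (c := 1) _ _ (fun _ => rfl),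
    cost_map_const (c := 1) _ _ (fun _ => rfl)]
  simp only [length_rows, cost_cons, cost_nil, Instr.cost]
  omega

theorem cost_invDet : cost kc (invDet m) =
    ∑ ℓ : Fin L, if (ℓ : ℕ) = 0 then cost kc (firstStage m ℓ) else cost kc (stage m ℓ) := by
  rw [invDet, cost_flatMap, sum_map_finRange]
  refine sum_congr rfl fun ℓ _ => ?_
  split_ifs <;> rfl

theorem cost_invDet_le (hm : Antitone m) (hL : 2 ≤ L) :
    (cost kc (invDet m) : ℝ) ≤ 27 * schurSum m := by
  have hstage : ∀ ℓ : Fin L, 0 < (ℓ : ℕ) → (cost kc (stage m ℓ) : ℝ) ≤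
      22 * ((∑ ℓ' ∈ Iio ℓ, size m ℓ') ^ 2 / size m ℓ) := by
    intro ℓ hℓ
    rw [← mul_div_assoc, le_div_iff₀ (size_pos ℓ)]
    unfold size
    exact_mod_cast cost_stage_mul_le (kc := kc) hm hℓ
  let z : Fin L := ⟨0, by omega⟩
  let o : Fin L := ⟨1, by omega⟩
  have hnn : ∀ ℓ : Fin L, 0 ≤ (∑ ℓ' ∈ Iio ℓ, size m ℓ') ^ 2 / size m ℓ := fun ℓ =>
    div_nonneg (sq_nonneg _) (size_pos ℓ).le
  -- The cost of the first stage, at most 5n₁, is charged to the second task, whose term n₁²/n₂ is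
  -- at least n₁; whence 27 = 5 + 22.
  have hz : size m z ≤ schurSum m := by
    have h1 : (∑ ℓ' ∈ Iio o, size m ℓ') ^ 2 / size m o ≤ schurSum m :=
      single_le_sum (f := fun ℓ => (∑ ℓ' ∈ Iio ℓ, size m ℓ') ^ 2 / size m ℓ)
        (fun ℓ _ => hnn ℓ) (mem_filter.2 ⟨mem_univ o, Nat.one_pos⟩)
    have h2 : (Iio o) = {z} := by
      ext ℓ
      simp only [mem_Iio, mem_singleton, Fin.lt_def, Fin.ext_iff, o, z]
      omega
    rw [h2, sum_singleton] at h1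
    refine le_trans ?_ h1
    rw [le_div_iff₀ (size_pos o), sq]
    refine mul_le_mul_of_nonneg_left ?_ (size_pos z).le
    exact pow_le_pow_right₀ one_le_two (hm (Fin.le_def.2 (Nat.zero_le _)))
  have h1 : (cost kc (invDet m) : ℝ) ≤ ∑ ℓ : Fin L, ((if ℓ = z then 5 * size m z else 0) +
      if 0 < (ℓ : ℕ) then 22 * ((∑ ℓ' ∈ Iio ℓ, size m ℓ') ^ 2 / size m ℓ) else 0) := by
    rw [cost_invDet]
    push_cast
    refine sum_le_sum fun ℓ _ => ?_
    by_cases hℓ : (ℓ : ℕ) = 0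
    · have hz' : ℓ = z := Fin.ext hℓ
      rw [if_pos hℓ, if_pos hz', if_neg (by omega), add_zero, hz']
      have := cost_firstStage_le (kc := kc) (m := m) z
      unfold size
      exact_mod_cast this
    · have hz' : ℓ ≠ z := fun e => hℓ (congrArg Fin.val e)
      rw [if_neg hℓ, if_neg hz', if_pos (by omega), zero_add]
      exact hstage ℓ (by omega)
  refine h1.trans ?_
  rw [sum_add_distrib, sum_ite_eq', if_pos (mem_univ z), ← sum_filter, ← mul_sum]
  have : (∑ ℓ ∈ univ.filter (fun ℓ : Fin L => 0 < (ℓ : ℕ)),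
    (∑ ℓ' ∈ Iio ℓ, size m ℓ') ^ 2 / size m ℓ) = schurSum m := rfl
  rw [this]
  linarith

theorem cost_invDet_le_of_eq_one (hL : L = 1) : (cost kc (invDet m) : ℝ) ≤ 5 * total m := by
  subst hL
  rw [cost_invDet, total]
  simp only [Fin.sum_univ_one]
  rw [if_pos (by rfl)]
  have := cost_firstStage_le (kc := kc) (m := m) 0
  unfold size
  exact_mod_cast this

theorem card_onDiag_last_le (hm : Antitone m) (hL : 0 < L) :
    ((#{a : Idx m × Idx m | OnDiag (lastTask hL) a.1 a.2} : ℕ) : ℝ) ≤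
      total m ^ 2 / size m (lastTask hL) := by
  have h := card_pairs_mul_le (m := m) (c := fun _ => True) (e := lastTask hL)
    (fun ℓ _ => hm (Fin.le_def.2 (Nat.le_sub_one_of_lt ℓ.isLt)))
  simp only [true_and, filter_true] at h
  rw [le_div_iff₀ (size_pos _), total]
  unfold size
  exact_mod_cast h

/-- Since n_L is the smallest size, L n_L ≤ N. These bounds absorb vectors of length N, the stored
entries of Λ (at most NL) and constants into N²/n_L. -/
theorem total_le (hm : Antitone m) (hL : 0 < L) :
    total m ≤ total m ^ 2 / size m (lastTask hL) ∧
      total m * L ≤ total m ^ 2 / size m (lastTask hL) ∧ 1 ≤ total m := by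
  have h1 : ∀ ℓ, size m (lastTask hL) ≤ size m ℓ := fun ℓ =>
    pow_le_pow_right₀ one_le_two (hm (Fin.le_def.2 (Nat.le_sub_one_of_lt ℓ.isLt)))
  have h2 : L * size m (lastTask hL) ≤ total m := by
    have := card_nsmul_le_sum univ (size m) _ (fun ℓ _ => h1 ℓ)
    rwa [card_univ, Fintype.card_fin, nsmul_eq_mul] at this
  have hpos := size_pos (m := m) (lastTask hL)
  have h3 := one_le_size (m := m) (lastTask hL)
  have hL' : (1 : ℝ) ≤ L := by exact_mod_cast hL
  have h4 : size m (lastTask hL) ≤ total m := by nlinarith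
  have h5 : 1 ≤ total m := h3.trans h4
  refine ⟨?_, ?_, h5⟩
  · rw [le_div_iff₀ hpos, sq]
    exact mul_le_mul_of_nonneg_left h4 (by linarith)
  · rw [le_div_iff₀ hpos, sq, mul_assoc]
    exact mul_le_mul_of_nonneg_left h2 (by linarith)

theorem cost_mulMatA_le (hm : Antitone m) (hL : 0 < L) :
    (cost kc (mulMatA m (lastTask hL)) : ℝ) ≤ 2 * (total m ^ 2 / size m (lastTask hL)) := by
  rw [mulMatA, cost_flatMap_const (c := 2) _ _ (fun _ => rfl), Finset.length_toList]
  have := card_onDiag_last_le hm hL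
  push_cast
  linarith

end FastMTGP

namespace FastMTGP
open Finset

variable {L : ℕ} {m : Fin L → ℕ}

/-! ### Numbers of registers -/

theorem storage_le {prog : Program m} (T : Finset (Reg m))
    (h : ∀ i ∈ prog, ∀ r ∈ i.regs, r ∈ T) : storage prog ≤ #T := by
  rw [storage, ← Set.ncard_coe_finset]
  refine Set.ncard_le_ncard ?_ T.finite_toSet
  rintro r ⟨i, hi, hr⟩
  exact h i hi r hr

theorem mem_of_mem_fastStar {T : Finset (Reg m)} (h0 : .tmp 0 ∈ T) (v : Variant) :
    ∀ (n : ℕ) (r : ℕ → Reg m), (∀ i < 2 ^ n, r i ∈ T) →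
      ∀ i ∈ fastStar v n r, ∀ s ∈ i.regs, s ∈ T
  | 0, _, _ => by simp [fastStar]
  | n + 1, r, hr => by
    intro i hi
    rw [fastStar, List.mem_append, List.mem_append, List.mem_flatMap] at hi
    rcases hi with hi | hi | ⟨j, hj, hi⟩
    · exact mem_of_mem_fastStar h0 v n r (fun j hj => hr j (by rw [pow_succ]; omega)) i hi
    · exact mem_of_mem_fastStar h0 v n _ (fun j hj => hr _ (by rw [pow_succ]; omega)) i hi
    · have hj := List.mem_range.1 hj
      have h1 : r j ∈ T := hr j (by rw [pow_succ]; omega)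
      have h2 : r (j + 2 ^ n) ∈ T := hr _ (by rw [pow_succ]; omega)
      simp only [butterfly, List.mem_cons, List.not_mem_nil, or_false] at hi
      rcases hi with rfl | rfl | rfl | rfl <;> simp [Instr.regs, h0, h1, h2]

theorem proj_idx {ℓ ℓ' : Fin L} {i : ℕ} (hi : i < 2 ^ m ℓ) :
    proj ℓ' (idx m ℓ i) = idx m ℓ' i := by
  rw [proj_eq_idx, idx_snd_of_lt hi]

theorem natCast_le_total : (L : ℝ) ≤ total m := by
  have := card_nsmul_le_sum univ (size m) 1 (fun ℓ _ => one_le_size ℓ)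
  rwa [card_univ, Fintype.card_fin, nsmul_eq_mul, mul_one] at this

theorem storage_evalLam_le (hL : 0 < L) (v : Variant) :
    (storage (evalLam v m) : ℝ) ≤ 3 * tri m := by
  classical
  let T : Finset (Reg m) :=
    (univ.filter fun a : Idx m × Fin L => a.1.1 ≤ a.2).image (fun a => .lam a.1 (proj a.2 a.1)) ∪
      (univ.image .noise ∪ {.tmp 0})
  have h0 : Reg.tmp 0 ∈ T := by simp [T]
  have hnoise : ∀ ℓ, Reg.noise ℓ ∈ T := fun ℓ => by simp [T]
  have h : storage (evalLam v m) ≤ #T := by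
    refine storage_le T fun i hi => ?_
    simp only [evalLam, List.mem_flatMap, Finset.mem_toList, mem_filter, mem_univ, true_and] at hi
    obtain ⟨⟨ℓ, ℓ'⟩, hℓ, hi⟩ := hi
    have hlam : ∀ i < 2 ^ m ℓ, Reg.lam (idx m ℓ i) (idx m ℓ' i) ∈ T := fun i hi => by
      refine mem_union_left _ (mem_image.2 ⟨(idx m ℓ i, ℓ'), mem_filter.2 ⟨mem_univ _, hℓ⟩, ?_⟩)
      simp only [proj_idx hi]
    have hz := hlam 0 (Nat.two_pow_pos _)
    simp only [evalBlock, List.mem_append, List.mem_map, List.mem_range] at hi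
    rcases hi with ⟨j, hj, rfl⟩ | hi | hi | hi | ⟨j, hj, rfl⟩
    · simp [Instr.regs, hlam j hj]
    · split_ifs at hi
      · rw [List.mem_singleton] at hi
        subst hi
        simp [Instr.regs, hz, hnoise]
      · simp at hi
    · exact mem_of_mem_fastStar h0 v _ _ hlam i hi
    · rw [List.mem_singleton] at hi
      subst hi
      simp [Instr.regs, h0]
    · simp [Instr.regs, hlam j hj, h0]
  have hcard : #T ≤ #{a : Idx m × Fin L | a.1.1 ≤ a.2} + (L + 1) := by
    refine (card_union_le _ _).trans (add_le_add card_image_le ((card_union_le _ _).trans ?_))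
    refine add_le_add (card_image_le.trans_eq ?_) le_rfl
    simp
  have h1 : (storage (evalLam v m) : ℝ) ≤ (#{a : Idx m × Fin L | a.1.1 ≤ a.2} : ℕ) + (L + 1) := by
    exact_mod_cast h.trans hcard
  rw [card_stored] at h1
  -- The stored entries account for `tri m` registers; the L noise registers and the scratch
  -- register are each at most N ≤ `tri m`.
  have h2 := natCast_le_total (m := m)
  have h3 := total_le_tri (m := m)
  have h4 : (1 : ℝ) ≤ L := by exact_mod_cast hL
  linarith

theorem onDiag_proj (hm : Antitone m) {e ℓ : Fin L} (he : ℓ ≤ e) (p : Idx m) :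
    OnDiag e p (proj ℓ p) :=
  (Nat.mod_mod_of_dvd _ (pow_dvd_pow 2 (hm he))).symm

/-- With e the last task, the patterns of all earlier stages lie inside that of e, since n_e divides
every n_ℓ. One set of registers thus covers all stages. -/
theorem mem_of_mem_invDet (hm : Antitone m) {e : Fin L} (hle : ∀ ℓ, ℓ ≤ e) {T : Finset (Reg m)}
    (hlam : ∀ p ℓ, .lam p (proj ℓ p) ∈ T)
    (hpair : ∀ p q, OnDiag e p q → .matA p q ∈ T ∧ .matJ p q ∈ T ∧ .matM p q ∈ T)
    (hvec : ∀ p, .matD p ∈ T ∧ .matB p ∈ T ∧ .matL p ∈ T ∧ .matF p ∈ T ∧ .matS p ∈ T ∧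
      .matG p ∈ T ∧ .matH p ∈ T) (hdet : .det ∈ T) (h0 : .tmp 0 ∈ T) :
    ∀ i ∈ invDet m, ∀ r ∈ i.regs, r ∈ T := by
  intro i hi
  have hlam' : ∀ p, Reg.lam p p ∈ T := fun p => by
    have := hlam p p.1
    rwa [proj_self] at this
  have hA1 : ∀ p, Reg.matA p p ∈ T := fun p => (hpair p p rfl).1
  have hA2 : ∀ ℓ p, Reg.matA p (proj ℓ p) ∈ T := fun ℓ p =>
    (hpair _ _ (onDiag_proj hm (hle ℓ) p)).1
  have hA3 : ∀ ℓ p, Reg.matA (proj ℓ p) p ∈ T := fun ℓ p =>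
    (hpair _ _ (onDiag_proj hm (hle ℓ) p).symm).1
  have hpairs : ∀ ℓ e' a, a ∈ pairs m ℓ e' → .matA a.1 a.2 ∈ T ∧ .matJ a.1 a.2 ∈ T ∧
      .matM a.1 a.2 ∈ T := fun ℓ e' a ha =>
    hpair _ _ ((mem_pairs.1 ha).2.2.of_le (hm (hle e')))
  simp only [invDet, List.mem_flatMap, List.mem_finRange, true_and] at hi
  obtain ⟨ℓ, hi⟩ := hi
  split_ifs at hi
  · simp only [firstStage, List.mem_append, List.mem_map, List.mem_singleton, or_assoc] at hi
    rcases hi with ⟨p, -, rfl⟩ | rfl | ⟨p, -, rfl⟩ | rfl | ⟨p, -, rfl⟩ <;>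
      simp [Instr.regs, h0, hdet, hlam', hA1, hvec]
  · simp only [stage, List.mem_append, List.mem_map, List.mem_flatMap,
      List.mem_cons, List.not_mem_nil, or_false, or_assoc] at hi
    rcases hi with ⟨p, -, rfl⟩ | ⟨p, -, rfl⟩ | ⟨p, -, rfl⟩ | ⟨a, ha, rfl | rfl⟩ | ⟨p, -, rfl⟩ |
      ⟨p, -, rfl | rfl | rfl⟩ | ⟨p, -, rfl⟩ | ⟨p, -, rfl⟩ | rfl | ⟨p, -, rfl⟩ | ⟨p, -, rfl⟩ |
      ⟨a, ha, rfl | rfl⟩ | ⟨a, ha, rfl⟩ | ⟨a, ha, rfl⟩ | ⟨p, -, rfl | rfl | rfl⟩ | ⟨p, -, rfl⟩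
    all_goals first
      | simp [Instr.regs, h0, hdet, hlam, hlam', hA1, hA2, hA3, hvec]; done
      | have := hpairs _ _ a ha
        simp [Instr.regs, h0, hvec, this]; done
      | have := hpairs _ _ a ha
        split_ifs <;> simp [Instr.regs, this]

/-- The constant is 13 = 1 + 3 + 7 + 2: the entries of Λ, three matrices on the last pattern, seven
vectors of length N, and two scalars, each bounded by N²/n_L. -/
theorem storage_invDet_le (hm : Antitone m) (hL : 0 < L) :
    (storage (invDet m) : ℝ) ≤ 13 * (total m ^ 2 / size m (lastTask hL)) := by
  classical
  let A : Finset (Reg m) := (univ : Finset (Idx m × Fin L)).image (fun a => .lam a.1 (proj a.2 a.1))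
  let D : Finset (Idx m × Idx m) := {a | OnDiag (lastTask hL) a.1 a.2}
  let B : Finset (Reg m) := D.biUnion fun a => {.matA a.1 a.2, .matJ a.1 a.2, .matM a.1 a.2}
  let V : Finset (Reg m) := (univ : Finset (Idx m)).biUnion fun p =>
    {.matD p, .matB p, .matL p, .matF p, .matS p, .matG p, .matH p}
  let W : Finset (Reg m) := {.det, .tmp 0}
  have hA : #A ≤ Fintype.card (Idx m) * L := by
    refine card_image_le.trans_eq ?_
    rw [card_univ, Fintype.card_prod, Fintype.card_fin]
  have hB : #B ≤ #D * 3 := card_biUnion_le_card_mul _ _ _ fun _ _ => card_le_three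
  have hV : #V ≤ Fintype.card (Idx m) * 7 :=
    card_biUnion_le_card_mul _ _ _ fun p _ => (card_insert_le _ _).trans
      (Nat.succ_le_succ card_le_six)
  have hW : #W ≤ 2 := card_le_two
  have h : storage (invDet m) ≤ #(A ∪ (B ∪ (V ∪ W))) := by
    refine storage_le _ (mem_of_mem_invDet hm (e := lastTask hL)
      (fun ℓ => Fin.le_def.2 (Nat.le_sub_one_of_lt ℓ.isLt)) ?_ ?_ ?_ ?_ ?_)
    · exact fun p ℓ => mem_union_left _ (mem_image_of_mem _ (mem_univ (p, ℓ)))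
    · intro p q hpq
      have hs : ∀ r ∈ ({.matA p q, .matJ p q, .matM p q} : Finset (Reg m)),
          r ∈ A ∪ (B ∪ (V ∪ W)) := fun r hr => mem_union_right _ (mem_union_left _
        (mem_biUnion.2 ⟨(p, q), mem_filter.2 ⟨mem_univ _, hpq⟩, hr⟩))
      exact ⟨hs _ (by simp), hs _ (by simp), hs _ (by simp)⟩
    · intro p
      have hs : ∀ r ∈ ({.matD p, .matB p, .matL p, .matF p, .matS p, .matG p, .matH p} :
          Finset (Reg m)), r ∈ A ∪ (B ∪ (V ∪ W)) := fun r hr => mem_union_right _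
        (mem_union_right _ (mem_union_left _ (mem_biUnion.2 ⟨p, mem_univ _, hr⟩)))
      exact ⟨hs _ (by simp), hs _ (by simp), hs _ (by simp), hs _ (by simp), hs _ (by simp),
        hs _ (by simp), hs _ (by simp)⟩
    · exact mem_union_right _ (mem_union_right _ (mem_union_right _ (by simp [W])))
    · exact mem_union_right _ (mem_union_right _ (mem_union_right _ (by simp [W])))
  have hN : ((Fintype.card (Idx m) : ℕ) : ℝ) = total m := by
    simp [Fintype.card_sigma, total, size]
  have h1 : storage (invDet m) ≤ Fintype.card (Idx m) * L + (#D * 3 +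
      (Fintype.card (Idx m) * 7 + 2)) :=
    h.trans ((card_union_le _ _).trans (add_le_add hA ((card_union_le _ _).trans
      (add_le_add hB ((card_union_le _ _).trans (add_le_add hV hW))))))
  have h2 : (storage (invDet m) : ℝ) ≤ total m * L + ((#D : ℕ) * 3 + (total m * 7 + 2)) := by
    rw [← hN]
    exact_mod_cast h1
  have h3 := card_onDiag_last_le hm hL
  obtain ⟨h4, h5, h6⟩ := total_le hm hL
  have h7 : ((#D : ℕ) : ℝ) ≤ total m ^ 2 / size m (lastTask hL) := h3
  linarith

end FastMTGP

/-! ### Assembly of the theorem. -/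

namespace FastMTGP
open Finset

variable {d L : ℕ} {m : Fin L → ℕ} {v : Variant}

theorem Problem.IsFast.lam_eq_zero {P : Problem d m} (h : P.IsFast v) (hm : Antitone m)
    {p q : Idx m} (hpq : p.1 ≤ q.1) (hs : ¬ Stored p q) : P.lam v p q = 0 := by
  rw [h.lam_eq (hm hpq), if_neg]
  intro e
  refine hs ⟨hpq, ?_⟩
  obtain ⟨ℓ, i⟩ := q
  exact Sigma.ext rfl (heq_of_eq (Fin.ext e))

theorem Problem.IsFast.isBlockSparse_lam {P : Problem d m} (h : P.IsFast v)
    (hn : P.Nondegenerate) (hm : Antitone m) : IsBlockSparse (P.lam v) :=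
  ⟨h.lam_posDef hn, hm, fun _ _ => h.lam_eq_zero hm⟩

theorem schurSum_nonneg : 0 ≤ schurSum m :=
  sum_nonneg fun ℓ _ => div_nonneg (sq_nonneg _) (size_pos ℓ).le

theorem sumLog_nonneg : 0 ≤ sumLog m := sum_nonneg fun ℓ _ => log_size_nonneg ℓ

theorem total_nonneg : 0 ≤ total m := sum_nonneg fun ℓ _ => (size_pos ℓ).le

theorem triLog_nonneg : 0 ≤ triLog d m := by
  refine sum_nonneg fun ℓ _ => mul_nonneg ?_ (add_nonneg (log_size_nonneg ℓ)
    (mul_nonneg (Nat.cast_nonneg _) (size_pos ℓ).le))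
  rw [sub_nonneg]
  exact_mod_cast ℓ.isLt.le

theorem Problem.IsFast.exists_runs_mul {P : Problem d m} (h : P.IsFast v) (hm : Antitone m)
    {k : Idx m → Idx m → ℂ} {σ : Reg m → ℂ} {y : Idx m → ℝ}
    (hσ : ∀ p q, Stored p q → σ (.lam p q) = P.lam v p q)
    (hy : ∀ p, σ (.vec p) = ((y p : ℝ) : ℂ)) :
    ∃ τ, Runs k (sandwich v m (mulLam m)) σ τ ∧
      ∀ p, τ (.out p) = ((P.gram.mulVec y p : ℝ) : ℂ) := by
  obtain ⟨τ, h1, h2⟩ := exists_runs_sandwich (k := k) (v := v) (mid := mulLam m) (σ := σ)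
    (M := P.lam v) fun σ' hl _ h0 => exists_runs_mulLam h.lam_isHermitian
      (fun p q => h.lam_eq_zero hm) (fun p q hpq => by rw [hl, hσ p q hpq]) h0
  refine ⟨τ, h1, fun p => ?_⟩
  rw [h2, ← P.gramC_eq v, ← P.gramC_mulVec, funext hy]

theorem Problem.IsFast.exists_runs_solve {P : Problem d m} (h : P.IsFast v)
    (hn : P.Nondegenerate) (hm : Antitone m) (hL : 0 < L)
    {k : Idx m → Idx m → ℂ} {σ : Reg m → ℂ} {y : Idx m → ℝ}
    (hσ : ∀ p q, OnDiag (lastTask hL) p q → σ (.matA p q) = (P.lam v)⁻¹ p q)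
    (hy : ∀ p, σ (.vec p) = ((y p : ℝ) : ℂ)) :
    ∃ τ, Runs k (sandwich v m (mulMatA m (lastTask hL))) σ τ ∧
      ∀ p, τ (.out p) = ((P.gram⁻¹.mulVec y p : ℝ) : ℂ) := by
  obtain ⟨τ, h1, h2⟩ := exists_runs_sandwich (k := k) (v := v) (mid := mulMatA m (lastTask hL))
    (σ := σ) (M := (P.lam v)⁻¹) fun σ' _ hA h0 => exists_runs_mulMatA
      (fun p q => (h.isBlockSparse_lam hn hm).inv_sparse hL)
      (fun p q hpq => by rw [hA, hσ p q hpq]) h0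
  refine ⟨τ, h1, fun p => ?_⟩
  rw [h2, ← P.gramC_inv v, ← P.gramC_inv_mulVec (h.gram_posDef hn).det_pos.ne'.isUnit, funext hy]

end FastMTGP
theorem mainTheorem1 (κ : ℕ) :
    ∃ C : ℝ, ∀ (d L : ℕ) (_hd : 0 < d) (hL : 0 < L) (m : Fin L → ℕ) (_hm : Antitone m)
      (v : Variant) (kc : ℕ) (_hkc : 1 ≤ kc) (_hkd : kc ≤ κ * d),
      -- the programs, fixed before the kernel, the points, the noise and the vectors
      ∃ evalProg mulProg solveProg : Program m,
        -- numbers of operations and of registers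
        (cost kc evalProg : ℝ) ≤ C * triLog d m ∧
        (storage evalProg : ℝ) ≤ C * tri m ∧
        (cost kc mulProg : ℝ) ≤ C * (sumLog m + tri m) ∧
        (2 ≤ L → (cost kc (invDet m) : ℝ) ≤ C * schurSum m) ∧
        (L = 1 → (cost kc (invDet m) : ℝ) ≤ C * total m) ∧
        (storage (invDet m) : ℝ) ≤ C * (total m ^ 2 / size m (lastTask hL)) ∧
        (cost kc solveProg : ℝ) ≤ C * (sumLog m + total m ^ 2 / size m (lastTask hL)) ∧
        ∀ P : Problem d m, P.IsFast v →
          -- the decomposition, and the entries by which the transformed matrix is represented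
          transformBlocks v m ∈ Matrix.unitaryGroup (Idx m) ℂ ∧
          P.gramC = transformBlocks v m * P.lam v * (transformBlocks v m).conjTranspose ∧
          (P.lam v).det = ((P.gram.det : ℝ) : ℂ) ∧
          (P.lam v).IsHermitian ∧
          (∀ p q : Idx m, p.1 ≤ q.1 → ¬ Stored p q → P.lam v p q = 0) ∧
          -- evaluation of the transformed matrix
          (∀ σ : Reg m → ℂ, (∀ ℓ, σ (.noise ℓ) = ((P.ξ ℓ : ℝ) : ℂ)) →
            ∃ τ, Runs (fun p q => ((P.kernelAt p q : ℝ) : ℂ)) evalProg σ τ ∧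
              ∀ p q, Stored p q → τ (.lam p q) = P.lam v p q) ∧
          -- multiplication by the Gram matrix (whatever a kernel evaluation would return)
          (∀ (k : Idx m → Idx m → ℂ) (σ : Reg m → ℂ) (y : Idx m → ℝ),
            (∀ p q, Stored p q → σ (.lam p q) = P.lam v p q) →
            (∀ p, σ (.vec p) = ((y p : ℝ) : ℂ)) →
            ∃ τ, Runs k mulProg σ τ ∧ ∀ p, τ (.out p) = ((P.gram.mulVec y p : ℝ) : ℂ)) ∧
          (P.Nondegenerate →
            -- the inverse, and its sparsity
            IsUnit P.gram.det ∧ IsUnit (P.lam v).det ∧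
            P.gramC⁻¹ = transformBlocks v m * (P.lam v)⁻¹ * (transformBlocks v m).conjTranspose ∧
            (∀ p q : Idx m, ¬ OnDiag (lastTask hL) p q → (P.lam v)⁻¹ p q = 0) ∧
            (∀ ℓ, (schur (P.lam v) ℓ).IsDiag) ∧
            -- the algorithm computes the inverse, the determinant and the Schur complements
            (∀ (k : Idx m → Idx m → ℂ) (σ : Reg m → ℂ),
              (∀ p q, Stored p q → σ (.lam p q) = P.lam v p q) →
              ∃ τ, Runs k (invDet m) σ τ ∧
                (∀ p q, OnDiag (lastTask hL) p q → τ (.matA p q) = (P.lam v)⁻¹ p q) ∧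
                τ .det = (P.lam v).det ∧
                ∀ p : Idx m, 0 < (p.1 : ℕ) → τ (.matS p) = schur (P.lam v) p.1 p.2 p.2) ∧
            -- solution of linear systems, given the stored inverse
            (∀ (k : Idx m → Idx m → ℂ) (σ : Reg m → ℂ) (y : Idx m → ℝ),
              (∀ p q, OnDiag (lastTask hL) p q → σ (.matA p q) = (P.lam v)⁻¹ p q) →
              (∀ p, σ (.vec p) = ((y p : ℝ) : ℂ)) →
              ∃ τ, Runs k solveProg σ τ ∧
                ∀ p, τ (.out p) = ((P.gram⁻¹.mulVec y p : ℝ) : ℂ))) := by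

  -- A crude common constant: the separate bounds need κ + 7, 3, 10, 27, 5, 13 and 8. Only the
  -- evaluation of kernels depends on κ.
  refine ⟨κ + 40, fun d L hd hL m hm v kc _ hkd => ⟨evalLam v m, sandwich v m (mulLam m),
    sandwich v m (mulMatA m (lastTask hL)), ?_, ?_, ?_, ?_, ?_, ?_, ?_, ?_⟩⟩
  · refine (cost_evalLam_le hd hkd v).trans ?_
    gcongr
    · exact triLog_nonneg
    · norm_num
  · have h1 := storage_evalLam_le (m := m) hL v
    have h2 := (total_nonneg (m := m)).trans total_le_tri
    have h3 : (0 : ℝ) ≤ κ * tri m := by positivity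
    linarith
  · have h1 := cost_sandwich_le (kc := kc) v (mulLam m)
    have h2 := cost_mulLam_le (kc := kc) (m := m)
    have h3 := total_le_tri (m := m)
    have h4 := (total_nonneg (m := m)).trans h3
    have h5 := sumLog_nonneg (m := m)
    have h6 : (0 : ℝ) ≤ κ * (sumLog m + tri m) := by positivity
    linarith
  · intro h
    have h1 := cost_invDet_le (kc := kc) hm h
    have h2 := schurSum_nonneg (m := m)
    have h3 : (0 : ℝ) ≤ κ * schurSum m := by positivity
    linarith
  · intro h
    have h1 := cost_invDet_le_of_eq_one (kc := kc) (m := m) h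
    have h2 := total_nonneg (m := m)
    have h3 : (0 : ℝ) ≤ κ * total m := by positivity
    linarith
  · have h1 := storage_invDet_le hm hL
    obtain ⟨h2, -, h3⟩ := total_le hm hL
    have h4 : (0 : ℝ) ≤ κ * (total m ^ 2 / size m (lastTask hL)) :=
      mul_nonneg (Nat.cast_nonneg _) (by linarith)
    linarith
  · have h1 := cost_sandwich_le (kc := kc) v (mulMatA m (lastTask hL))
    have h2 := cost_mulMatA_le (kc := kc) hm hL
    obtain ⟨h3, -, h4⟩ := total_le hm hL
    have h5 := sumLog_nonneg (m := m)
    have h6 : (0 : ℝ) ≤ κ * (sumLog m + total m ^ 2 / size m (lastTask hL)) :=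
      mul_nonneg (Nat.cast_nonneg _) (by linarith)
    linarith
  · refine fun P h => ⟨transformBlocks_mem_unitaryGroup v m, P.gramC_eq v, P.det_lam v,
      h.lam_isHermitian, fun p q => h.lam_eq_zero hm, fun σ hσ => h.exists_runs_evalLam hm σ hσ,
      fun k σ y hσ hy => h.exists_runs_mul hm hσ hy, fun hn => ?_⟩
    have hS := h.isBlockSparse_lam hn hm
    exact ⟨(h.gram_posDef hn).det_pos.ne'.isUnit, by
        rw [P.det_lam v]
        exact (Complex.ofReal_ne_zero.2 (h.gram_posDef hn).det_pos.ne').isUnit,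
      P.gramC_inv v, fun p q => hS.inv_sparse hL, hS.schur_isDiag,
      fun k σ hσ => hS.exists_runs_invDet hL hσ,
      fun k σ y hσ hy => h.exists_runs_solve hn hm hL hσ hy⟩
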